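/- **Setting.** Let $(\Omega,\mathcal F,\mathbb P)$ be a probability space and $\theta:\Omega\to\Omega$ a bi-measurable bijection which preserves $\mathbb P$ and is ergodic. Let $\Xi$ be a compact metric space, $d\in\mathbb N$, $M=\Xi\times\mathbb R^d$ with a canonical product metric, and consider $$T:\Omega\times M\to\Omega\times M,\qquad T(\omega,\xi,y)=(\theta\omega,\,g_\omega(\xi),\,h_{\omega,\xi}(y)).$$ Write $T_\omega(\xi,y)=(g_\omega(\xi),h_{\omega,\xi}(y))$. Assume that for every $\omega$ the map $g_\omega:\Xi\to\Xi$ is a homeomorphism, $(\xi,y)\mapsto h_{\omega,\xi}(y)$ is continuous and differentiable in $y$, and $(\xi,y)\mapsto Dh_{\omega,\xi}(y)$ is continuous; and that $\omega\mapsto T_\omega(\xi,y)$ is measurable for all $(\xi,y)$. Denote by $h^k_{\omega,\xi}$ the last component of $T^k(\omega,\xi,\cdot)$ and put, for $k\ge1$, $$\Phi_k(\omega,\xi,y)=\log\|D_yh^k_{\omega,\xi}(y)\|\in[-\infty,\infty),\qquad \log 0=-\infty.$$ For a set $K\subseteq\Omega\times X$ with $X$ metric, write $K(\omega)=\{x\in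 X:(\omega,x)\in K\}$. $K$ is a *random compact (closed) set* if all $K(\omega)$ are compact (closed) and $\omega\mapsto d(x,K(\omega))$ is measurable for every $x\in X$ (with $d(x,\emptyset)=\infty$). The map $\theta\ltimes g:(\omega,\xi)\mapsto(\theta\omega,g_\omega(\xi))$ is *random minimal* if every random closed set $C\subseteq\Omega\times\Xi$ with $g_\omega(C(\omega))\subseteq C(\theta\omega)$ for $\mathbb P$-a.e. $\omega$ satisfies either $C(\omega)=\Xi$ for $\mathbb P$-a.e. $\omega$, or $C(\omega)=\emptyset$ for $\mathbb P$-a.e. $\omega$. Let $K\subseteq\Omega\times M$ be a random compact set that is $T$-invariant, i.e. $T_\omega(K(\omega))=K(\theta\omega)$ for $\mathbb P$-a.e. $\omega$, and non-empty, i.e. $\{\omega:K(\omega)\neq\emptyset\}$ is not a $\mathbb P$-null set. Put $K(\omega,\xi)=\{y\in\mathbb R^d:(\omega,\xi,y)\in K\}$. Let $\mathcal M^K_{\mathbb P}(T)$ be the set of $T$-invariant probability measures on $\Omega\times M$ which project to $\mathbb P$ and are supported on $K$, and for such $\mu$ let $\lambda(\mu,T)=\inf_{n\ge1}\frac1n\int\Phi_n\,d\mu\in[-\infty,\infty)$.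 **Theorem.** Assume that 1. $\sup\{\Phi_1(\omega,\xi,y):\omega\in\Omega,\ (\xi,y)\in K(\omega)\}<\infty$, and for all $k\ge1$ and all $\varepsilon>0$ there is $r>0$ such that $$\sup\{\Phi_k(\omega,\xi,y):\omega\in\Omega,\ (\xi,y)\in B_r(K(\omega))\}\le\sup\{\Phi_k(\omega,\xi,y):\omega\in\Omega,\ (\xi,y)\in K(\omega)\}+\varepsilon,$$ where $B_r(K(\omega))=\{x\in M:d(x,K(\omega))<r\}$; 2. $\lambda(\mu,T)<0$ for all $\mu\in\mathcal M^K_{\mathbb P}(T)$; 3. $\theta\ltimes g$ is random minimal. Then there are a (non-random) integer $n>0$ and a measurable function $c:\Omega\to(0,\infty)$ such that for $\mathbb P$-a.e. $\omega\in\Omega$: - (i) $\#K(\omega,\xi)=n$ for all $\xi\in\Xi$; - (ii) the map $\xi\mapsto K(\omega,\xi)$ from $\Xi$ to the space $\mathcal K(\mathbb R^d)$ of non-empty compact subsets of $\mathbb R^d$ with the Hausdorff distance is continuous; - (iii) for all $\xi\in\Xi$, any two different points of $K(\omega,\xi)$ have distance at least $c(\omega)$. -/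

import Mathlib

open Set Filter Topology MeasureTheory
open scoped ENNReal

noncomputable section

namespace RandomGraphs

/-! ### Random maps over a base `(Ω, P, θ)` -/

section Basic

variable {Ω M : Type*}

/-- The skew product `(ω, x) ↦ (θ ω, F_ω x)`. -/
def skewProduct (θ : Ω → Ω) (F : Ω → M → M) : Ω × M → Ω × M :=
  fun p => (θ p.1, F p.1 p.2)

/-- The fibre `K(ω) = {x | (ω, x) ∈ K}`. -/
def fibre (K : Set (Ω × M)) (ω : Ω) : Set M := {x | (ω, x) ∈ K}

/-- The fibre maps of a random map: continuous in `x`, measurable in `ω`. -/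
structure IsRandomMap [MeasurableSpace Ω] [TopologicalSpace M] [MeasurableSpace M]
    (F : Ω → M → M) : Prop where
  continuous : ∀ ω, Continuous (F ω)
  measurable : ∀ x, Measurable fun ω => F ω x

/-- The fibre maps of a random homeomorphism. -/
structure IsRandomHomeomorph [MeasurableSpace Ω] [TopologicalSpace M] [MeasurableSpace M]
    (F : Ω → M → M) : Prop extends IsRandomMap F where
  isHomeomorph : ∀ ω, IsHomeomorph (F ω)

/-- Random closed sets: closed fibres and measurable distance functions. The distance to the
empty set is `∞`, so that the extended distance is used. -/
structure IsRandomClosed [MeasurableSpace Ω] [PseudoEMetricSpace M] (K : Set (Ω × M)) :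
    Prop where
  isClosed : ∀ ω, IsClosed (fibre K ω)
  measurable : ∀ x, Measurable fun ω => Metric.infEDist x (fibre K ω)

/-- Random compact sets: compact fibres and measurable distance functions. -/
structure IsRandomCompact [MeasurableSpace Ω] [PseudoEMetricSpace M] (K : Set (Ω × M)) :
    Prop where
  isCompact : ∀ ω, IsCompact (fibre K ω)
  measurable : ∀ x, Measurable fun ω => Metric.infEDist x (fibre K ω)

/-- Forward invariance: `F_ω (K(ω)) ⊆ K(θ ω)` for almost every `ω`. -/
def IsForwardInvariant [MeasurableSpace Ω] (P : Measure Ω) (θ : Ω → Ω) (F : Ω → M → M)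
    (K : Set (Ω × M)) : Prop :=
  ∀ᵐ ω ∂P, F ω '' fibre K ω ⊆ fibre K (θ ω)

/-- Invariance: `F_ω (K(ω)) = K(θ ω)` for almost every `ω`. -/
def IsInvariant [MeasurableSpace Ω] (P : Measure Ω) (θ : Ω → Ω) (F : Ω → M → M)
    (K : Set (Ω × M)) : Prop :=
  ∀ᵐ ω ∂P, F ω '' fibre K ω = fibre K (θ ω)

/-- Random minimality: a forward invariant random closed set has almost surely full fibres, or
almost surely empty fibres. -/
def IsRandomMinimal [MeasurableSpace Ω] [PseudoEMetricSpace M] (P : Measure Ω) (θ : Ω → Ω)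
    (F : Ω → M → M) : Prop :=
  ∀ C : Set (Ω × M), IsRandomClosed C → IsForwardInvariant P θ F C →
    (∀ᵐ ω ∂P, fibre C ω = univ) ∨ (∀ᵐ ω ∂P, fibre C ω = ∅)

/-- The set `M_P^K(T)` of the invariant probability measures of the skew product `T` which
project to `P` and are supported on `K`. -/
def invariantMeasures [MeasurableSpace Ω] [MeasurableSpace M] (P : Measure Ω) (θ : Ω → Ω)
    (F : Ω → M → M) (K : Set (Ω × M)) : Set (Measure (Ω × M)) :=
  {μ | IsProbabilityMeasure μ ∧ MeasurePreserving (skewProduct θ F) μ μ ∧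
    μ.map Prod.fst = P ∧ ∀ᵐ p ∂μ, p ∈ K}

end Basic

/-- The integral `∫ f⁺ dμ - ∫ f⁻ dμ` of a function with values in `[-∞, ∞]`, meaningful when one
of the two parts has a finite integral (below, the positive part is essentially bounded). -/
def extIntegral {α : Type*} [MeasurableSpace α] (μ : Measure α) (f : α → EReal) : EReal :=
  ((∫⁻ x, (f x).toENNReal ∂μ : ℝ≥0∞) : EReal) - ((∫⁻ x, (-f x).toENNReal ∂μ : ℝ≥0∞) : EReal)

/-! ### Double skew products `T(ω, ξ, y) = (θ ω, g_ω(ξ), h_{ω,ξ}(y))` -/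

section Double

variable {Ω Ξ : Type*} {d : ℕ}

/-- The fibre maps `T_ω(ξ, y) = (g_ω(ξ), h_{ω,ξ}(y))` on `Ξ × ℝ^d`. -/
def doubleFibreMap (g : Ω → Ξ → Ξ)
    (h : Ω → Ξ → EuclideanSpace ℝ (Fin d) → EuclideanSpace ℝ (Fin d)) :
    Ω → Ξ × EuclideanSpace ℝ (Fin d) → Ξ × EuclideanSpace ℝ (Fin d) :=
  fun ω p => (g ω p.1, h ω p.1 p.2)

/-- The regularity of a double skew product: `T` is a random map, the `g_ω` form a random
homeomorphism, and `h_{ω,ξ}(y)` is differentiable in `y` with derivative continuous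
in `(ξ, y)`. -/
structure IsDoubleSkewProduct [MeasurableSpace Ω] [TopologicalSpace Ξ] [MeasurableSpace Ξ]
    (g : Ω → Ξ → Ξ)
    (h : Ω → Ξ → EuclideanSpace ℝ (Fin d) → EuclideanSpace ℝ (Fin d)) : Prop where
  isRandomHomeomorph : IsRandomHomeomorph g
  isRandomMap : IsRandomMap (doubleFibreMap g h)
  differentiable : ∀ ω ξ, Differentiable ℝ (h ω ξ)
  continuous_fderiv : ∀ ω,
    Continuous fun p : Ξ × EuclideanSpace ℝ (Fin d) => fderiv ℝ (h ω p.1) p.2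

/-- The fibre maps `h^k_{ω,ξ}` of the `k`-th iterate: the last component of `T^k(ω, ξ, y)`. -/
def iterFibre (θ : Ω → Ω) (g : Ω → Ξ → Ξ)
    (h : Ω → Ξ → EuclideanSpace ℝ (Fin d) → EuclideanSpace ℝ (Fin d))
    (k : ℕ) (ω : Ω) (ξ : Ξ) (y : EuclideanSpace ℝ (Fin d)) : EuclideanSpace ℝ (Fin d) :=
  ((skewProduct θ (doubleFibreMap g h))^[k] (ω, ξ, y)).2.2

/-- `Φ_k(ω, ξ, y) = log ‖D_y h^k_{ω,ξ}(y)‖`, with values in `[-∞, ∞)` and `log 0 = -∞`. -/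
def logDeriv (θ : Ω → Ω) (g : Ω → Ξ → Ξ)
    (h : Ω → Ξ → EuclideanSpace ℝ (Fin d) → EuclideanSpace ℝ (Fin d))
    (k : ℕ) (p : Ω × Ξ × EuclideanSpace ℝ (Fin d)) : EReal :=
  ENNReal.log ‖fderiv ℝ (iterFibre θ g h k p.1 p.2.1) p.2.2‖ₑ

/-- The maximal Lyapunov exponent `λ(μ, T) = inf_{n ≥ 1} (1/n) ∫ Φ_n dμ`. -/
def lyapunovExponent [MeasurableSpace Ω] [MeasurableSpace Ξ] (θ : Ω → Ω) (g : Ω → Ξ → Ξ)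
    (h : Ω → Ξ → EuclideanSpace ℝ (Fin d) → EuclideanSpace ℝ (Fin d))
    (μ : Measure (Ω × Ξ × EuclideanSpace ℝ (Fin d))) : EReal :=
  ⨅ n : ℕ, ⨅ _ : 1 ≤ n, (((n : ℝ)⁻¹ : ℝ) : EReal) * extIntegral μ (logDeriv θ g h n)

/-- `sup {Φ_k(ω, ξ, y) | ω ∈ Ω, (ξ, y) ∈ K(ω)}`. -/
def supOn (θ : Ω → Ω) (g : Ω → Ξ → Ξ)
    (h : Ω → Ξ → EuclideanSpace ℝ (Fin d) → EuclideanSpace ℝ (Fin d))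
    (K : Set (Ω × Ξ × EuclideanSpace ℝ (Fin d))) (k : ℕ) : EReal :=
  ⨆ ω, ⨆ x ∈ fibre K ω, logDeriv θ g h k (ω, x)

/-- `sup {Φ_k(ω, ξ, y) | ω ∈ Ω, (ξ, y) ∈ B_r(K(ω))}`, where
`B_r(K(ω)) = {x | d(x, K(ω)) < r}` for the (maximum) product metric on `Ξ × ℝ^d`. -/
def supNear [PseudoEMetricSpace Ξ] (θ : Ω → Ω) (g : Ω → Ξ → Ξ)
    (h : Ω → Ξ → EuclideanSpace ℝ (Fin d) → EuclideanSpace ℝ (Fin d))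
    (K : Set (Ω × Ξ × EuclideanSpace ℝ (Fin d))) (k : ℕ) (r : ℝ) : EReal :=
  ⨆ ω, ⨆ x ∈ Metric.thickening r (fibre K ω), logDeriv θ g h k (ω, x)

/-- The fibre `K(ω, ξ) = {y | (ω, ξ, y) ∈ K}`. -/
def fibre₂ (K : Set (Ω × Ξ × EuclideanSpace ℝ (Fin d))) (ω : Ω) (ξ : Ξ) :
    Set (EuclideanSpace ℝ (Fin d)) :=
  {y | (ω, ξ, y) ∈ K}

end Double

end RandomGraphs

end

/-! Negative exponents give a contraction of nearby points of `K` over a common base point; random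
minimality then makes the number of mutually non-near points independent of the base point.

Contraction. Suppose that for all `n` and all truncation levels the suprema over `K(ω)` of the
truncated functions Φ_n had non-negative mean. The functions whose Birkhoff sums along `K` are
asymptotically non-negative, up to base functions of non-negative mean and multiples of Φ_n, form a
convex cone without negative constants. The M. Riesz extension theorem yields a functional that is
non-negative on the bounded Carathéodory functions in this cone, and Daniell's theorem represents it
by an invariant measure on `K` (`exists_invariantMeasure_integral_nonneg`). No topology on Ω is
involved. The truncated integrals of all Φ_n are non-negative for this measure, hence so is its
exponent (`lyapunovExponent_nonneg`), a contradiction. So for some k the supremum of the truncated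
Φ_{k+1} over `K(ω)` has negative mean, and so has its supremum ψ(ω) over a small neighbourhood. A
maximal ergodic inequality shows that the Birkhoff sums of ψ tend to -∞, for θ and for its inverse
(`ae_tendsto_birkhoffSum_atBot`).

The function ψ bounds k+1 steps at once, but θ^{k+1} need not be ergodic. This is why pairs of
orbits are measured by the product W_j of k+1 consecutive distances: W_{j+1}/W_j = d_{j+k+1}/d_j ≤
exp ψ(θ^j ω), so that W_j follows the Birkhoff sums of ψ under θ itself. With b(ω) = inf_n b₀
exp(-S_nψ(ω)), the relation "W_0 < b(ω) and the distances in the window are less than r" is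
preserved along orbits in `K` (`isNearInvariant_stableRadius`).

Counting. Preimages of non-near pairs are non-near, so the random closed set of the (ω, ξ) carrying
m+1 pairwise non-near points of `K` is backward invariant. Random minimality passes to the inverse,
so this set is almost surely full or almost surely empty; compactness of `K(ω)` excludes that it is
full for all m (`exists_card_separatedSet`). Take the last m for which it is full. If m+2 distinct
points lay over (ω, ξ), two of their preimages in the far past would be near, and the contraction
would bring their images closer than they are (`not_injective_of_separatedSet_eq_empty`). Hence each
fibre has exactly m+1 points with a separation depending only on ω, and continuity follows from
compactness of `K(ω)` (`continuous_slices`). -/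

namespace RandomGraphs

/-! ### The Daniell extension of a positive functional on a function algebra -/

section Daniell

variable {α : Type*}

/-- A sequence of non-negative functions in `H` whose sum is at least `1` on `A`. -/
structure IsCover (H : Subalgebra ℝ (α → ℝ)) (A : Set α) (f : ℕ → α → ℝ) : Prop where
  mem : ∀ n, f n ∈ H
  nonneg : ∀ n, 0 ≤ f n
  one_le : ∀ x ∈ A, 1 ≤ ∑' n, ENNReal.ofReal (f n x)

/-- The infimum of the values of the covers of `A`. -/
noncomputable def daniellFun (H : Subalgebra ℝ (α → ℝ)) (L : (α → ℝ) →ₗ[ℝ] ℝ) (A : Set α) : ℝ≥0∞ :=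
  ⨅ (f : ℕ → α → ℝ) (_ : IsCover H A f), ∑' n, ENNReal.ofReal (L (f n))

theorem daniellFun_le {H : Subalgebra ℝ (α → ℝ)} {L : (α → ℝ) →ₗ[ℝ] ℝ} {A : Set α}
    {f : ℕ → α → ℝ} (hf : IsCover H A f) : daniellFun H L A ≤ ∑' n, ENNReal.ofReal (L (f n)) :=
  iInf₂_le f hf

theorem daniellFun_le_of_double {H : Subalgebra ℝ (α → ℝ)} {L : (α → ℝ) →ₗ[ℝ] ℝ} {A : Set α}
    {f : ℕ → ℕ → α → ℝ} (hf : ∀ i n, f i n ∈ H) (h0 : ∀ i n, 0 ≤ f i n)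
    (h1 : ∀ x ∈ A, 1 ≤ ∑' i, ∑' n, ENNReal.ofReal (f i n x)) :
    daniellFun H L A ≤ ∑' i, ∑' n, ENNReal.ofReal (L (f i n)) := by
  have key : ∀ u : ℕ → ℕ → ℝ≥0∞,
      ∑' k : ℕ, u k.unpair.1 k.unpair.2 = ∑' i, ∑' n, u i n := by
    intro u
    rw [← ENNReal.tsum_prod, ← Nat.pairEquiv.symm.tsum_eq]
    rfl
  have hc : IsCover H A (fun k => f k.unpair.1 k.unpair.2) :=
    ⟨fun k => hf _ _, fun k => h0 _ _, fun x hx => by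
      rw [key fun i n => ENNReal.ofReal (f i n x)]
      exact h1 x hx⟩
  exact (daniellFun_le hc).trans_eq (key fun i n => ENNReal.ofReal (L (f i n)))

/-- The outer measure of a positive linear functional. -/
noncomputable def daniellOuter (H : Subalgebra ℝ (α → ℝ)) (L : (α → ℝ) →ₗ[ℝ] ℝ) : OuterMeasure α where
  measureOf := daniellFun H L
  empty := by
    refine le_antisymm ?_ bot_le
    have : IsCover H (∅ : Set α) (fun _ => (0 : α → ℝ)) :=
      ⟨fun _ => H.zero_mem, fun _ => le_rfl, fun x hx => hx.elim⟩
    simpa using daniellFun_le (L := L) this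
  mono := fun {A B} hAB => le_iInf₂ fun f hf =>
    daniellFun_le ⟨hf.mem, hf.nonneg, fun x hx => hf.one_le x (hAB hx)⟩
  iUnion_nat := by
    intro s _
    refine ENNReal.le_of_forall_pos_le_add fun ε hε hfin => ?_
    obtain ⟨δ, hδ, hδs⟩ := ENNReal.exists_pos_sum_of_countable (ι := ℕ) (ENNReal.coe_pos.2 hε).ne'
    have : ∀ i, ∃ f, IsCover H (s i) f ∧
        ∑' n, ENNReal.ofReal (L (f n)) < daniellFun H L (s i) + δ i := by
      intro i
      have hlt : daniellFun H L (s i) < daniellFun H L (s i) + δ i :=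
        ENNReal.lt_add_right ((ENNReal.le_tsum i).trans_lt hfin).ne (by simpa using (hδ i).ne')
      unfold daniellFun at hlt
      simp only [iInf_lt_iff] at hlt
      obtain ⟨f, hf, h⟩ := hlt
      exact ⟨f, hf, h⟩
    choose f hf hlt using this
    refine (daniellFun_le_of_double (f := f) (fun i => (hf i).mem) (fun i => (hf i).nonneg) ?_).trans
      ?_
    · intro x hx
      obtain ⟨i, hi⟩ := mem_iUnion.1 hx
      exact ((hf i).one_le x hi).trans
        (ENNReal.le_tsum (f := fun i => ∑' n, ENNReal.ofReal (f i n x)) i)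
    · calc ∑' i, ∑' n, ENNReal.ofReal (L (f i n)) ≤ ∑' i, (daniellFun H L (s i) + δ i) :=
            ENNReal.tsum_le_tsum fun i => (hlt i).le
        _ = ∑' i, daniellFun H L (s i) + ∑' i, (δ i : ℝ≥0∞) := ENNReal.tsum_add
        _ ≤ _ := by gcongr

variable {H : Subalgebra ℝ (α → ℝ)} {L : (α → ℝ) →ₗ[ℝ] ℝ}

theorem daniellOuter_apply (A : Set α) : daniellOuter H L A = daniellFun H L A := rfl

theorem const_mem_subalgebra (c : ℝ) : (fun _ => c : α → ℝ) ∈ H := by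
  simpa [Algebra.algebraMap_eq_smul_one, Pi.smul_def] using H.algebraMap_mem c

theorem min_mem_of_posPart_mem (hsup : ∀ f ∈ H, (fun x => max (f x) 0) ∈ H) {f g : α → ℝ}
    (hf : f ∈ H) (hg : g ∈ H) : (fun x => min (f x) (g x)) ∈ H := by
  have : (fun x => min (f x) (g x)) = f - fun x => max ((f - g) x) 0 := by
    ext x
    simp only [Pi.sub_apply]
    rcases le_total (f x) (g x) with h | h
    · rw [min_eq_left h, max_eq_right (by linarith)]; ring
    · rw [min_eq_right h, max_eq_left (by linarith)]; ring
  rw [this]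
  exact H.sub_mem hf (hsup _ (H.sub_mem hf hg))

/-- The functions min(1, k f) in `H` increase to the indicator of {f > 0}. Multiplying a cover by
their increments covers the part of `t` inside, multiplying it by 1 - min(1, K f) covers the part
outside, and after K increments the two costs add up to at most the cost of the original cover. -/
theorem isCaratheodory_daniellOuter (hsup : ∀ f ∈ H, (fun x => max (f x) 0) ∈ H)
    (hpos : ∀ f ∈ H, 0 ≤ f → 0 ≤ L f) {f : α → ℝ} (hf : f ∈ H) (hf0 : 0 ≤ f) :
    (daniellOuter H L).IsCaratheodory {x | 0 < f x} := by
  refine (OuterMeasure.isCaratheodory_iff_le' _).2 fun t => ?_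
  set g : ℕ → α → ℝ := fun k x => min 1 (k * f x) with hg
  have hgH : ∀ k, g k ∈ H := fun k =>
    min_mem_of_posPart_mem hsup (const_mem_subalgebra 1)
      (by simpa [Pi.smul_def] using H.smul_mem hf (k : ℝ))
  have hg01 : ∀ k x, 0 ≤ g k x ∧ g k x ≤ 1 := fun k x =>
    ⟨le_min zero_le_one (mul_nonneg k.cast_nonneg (hf0 x)), min_le_left _ _⟩
  have hgm : ∀ k x, g k x ≤ g (k + 1) x := fun k x => by
    refine min_le_min le_rfl (mul_le_mul_of_nonneg_right ?_ (hf0 x))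
    push_cast; linarith
  have hg0 : ∀ x, g 0 x = 0 := fun x => by simp [hg]
  refine le_iInf₂ fun c hc => ?_
  have hA : daniellFun H L (t ∩ {x | 0 < f x}) ≤
      ∑' k, ∑' n, ENNReal.ofReal (L (c n * (g (k + 1) - g k))) := by
    refine daniellFun_le_of_double
      (fun k n => H.mul_mem (hc.mem n) (H.sub_mem (hgH _) (hgH _)))
      (fun k n x => mul_nonneg (hc.nonneg n x) (sub_nonneg.2 (hgm k x))) ?_
    rintro x ⟨hxt, hxf⟩
    have h1 : (1 : ℝ≥0∞) ≤ ∑' k, ENNReal.ofReal (g (k + 1) x - g k x) := by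
      obtain ⟨K, hK⟩ := exists_nat_gt (1 / f x)
      have hx0 : 0 < f x := hxf
      have hgK : g K x = 1 := by
        refine min_eq_left ?_
        rw [div_lt_iff₀ hx0] at hK
        exact hK.le
      have := ENNReal.sum_le_tsum (f := fun k => ENNReal.ofReal (g (k + 1) x - g k x))
        (Finset.range K)
      rw [← ENNReal.ofReal_sum_of_nonneg (fun k _ => sub_nonneg.2 (hgm k x)),
        Finset.sum_range_sub (fun k => g k x), hgK, hg0] at this
      simpa using this
    calc (1 : ℝ≥0∞) = 1 * 1 := by simp
      _ ≤ (∑' k, ENNReal.ofReal (g (k + 1) x - g k x)) * ∑' n, ENNReal.ofReal (c n x) :=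
        mul_le_mul' h1 (hc.one_le x hxt)
      _ = _ := by
        rw [← ENNReal.tsum_mul_right]
        refine tsum_congr fun k => ?_
        rw [← ENNReal.tsum_mul_left]
        refine tsum_congr fun n => ?_
        rw [← ENNReal.ofReal_mul (sub_nonneg.2 (hgm k x)), mul_comm]
        rfl
  have hB : ∀ K, daniellFun H L (t \ {x | 0 < f x}) ≤
      ∑' n, ENNReal.ofReal (L (c n * (1 - g K))) := by
    intro K
    refine daniellFun_le ⟨fun n => H.mul_mem (hc.mem n) (H.sub_mem H.one_mem (hgH K)),
      fun n x => mul_nonneg (hc.nonneg n x) (sub_nonneg.2 (hg01 K x).2), ?_⟩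
    rintro x ⟨hxt, hxf⟩
    have : f x = 0 := le_antisymm (not_lt.1 hxf) (hf0 x)
    have hgx : g K x = 0 := by simp [hg, this]
    simpa [hgx] using hc.one_le x hxt
  simp only [daniellOuter_apply]
  refine (add_le_add_left hA _).trans ?_
  rw [ENNReal.tsum_eq_iSup_nat, ENNReal.iSup_add]
  refine iSup_le fun K => ?_
  refine (add_le_add_right (hB K) _).trans ?_
  have hswap : ∑ k ∈ Finset.range K, ∑' n, ENNReal.ofReal (L (c n * (g (k + 1) - g k))) =
      ∑' n, ENNReal.ofReal (L (c n * g K)) := by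
    rw [← Summable.tsum_finsetSum (fun _ _ => ENNReal.summable)]
    refine tsum_congr fun n => ?_
    rw [← ENNReal.ofReal_sum_of_nonneg, ← map_sum, ← Finset.mul_sum, Finset.sum_range_sub]
    · congr 3
      ext x; simp [hg0]
    · exact fun k _ => hpos _ (H.mul_mem (hc.mem n) (H.sub_mem (hgH _) (hgH _)))
        fun x => mul_nonneg (hc.nonneg n x) (sub_nonneg.2 (hgm k x))
  rw [hswap, ← ENNReal.tsum_add]
  refine ENNReal.tsum_le_tsum fun n => ?_
  rw [← ENNReal.ofReal_add, ← map_add, ← mul_add]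
  · simp
  · exact hpos _ (H.mul_mem (hc.mem n) (hgH K)) fun x => mul_nonneg (hc.nonneg n x) (hg01 K x).1
  · exact hpos _ (H.mul_mem (hc.mem n) (H.sub_mem H.one_mem (hgH K)))
      fun x => mul_nonneg (hc.nonneg n x) (sub_nonneg.2 (hg01 K x).2)

/-- The part of `h` not yet covered by the first N functions of a cover decreases pointwise to 0.
Continuity of `L` along such sequences turns finite subadditivity into the countable bound. -/
theorem le_daniellFun (hsup : ∀ f ∈ H, (fun x => max (f x) 0) ∈ H)
    (hpos : ∀ f ∈ H, 0 ≤ f → 0 ≤ L f)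
    (hcont : ∀ f : ℕ → α → ℝ, (∀ n, f n ∈ H) → (∀ n, 0 ≤ f n) → Antitone f →
      (∀ x, Tendsto (fun n => f n x) atTop (𝓝 0)) → Tendsto (fun n => L (f n)) atTop (𝓝 0))
    {h : α → ℝ} {A : Set α} (hh : h ∈ H) (h1 : h ≤ 1) (hA : ∀ x ∉ A, h x = 0) :
    ENNReal.ofReal (L h) ≤ daniellFun H L A := by
  refine le_iInf₂ fun c hc => ?_
  set s : ℕ → α → ℝ := fun N => ∑ n ∈ Finset.range N, c n with hs
  have hsH : ∀ N, s N ∈ H := fun N => H.sum_mem fun n _ => hc.mem n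
  have hsmono : Monotone s := monotone_nat_of_le_succ fun N x => by
    simp only [hs, Finset.sum_range_succ, Pi.add_apply]
    exact le_add_of_nonneg_right (hc.nonneg N x)
  set f : ℕ → α → ℝ := fun N x => max ((h - s N) x) 0 with hf
  have hfH : ∀ N, f N ∈ H := fun N => hsup _ (H.sub_mem hh (hsH N))
  have hlim : Tendsto (fun N => L (f N)) atTop (𝓝 0) := by
    refine hcont f hfH (fun N x => le_max_right _ _)
      (fun N N' hN x => max_le_max (sub_le_sub_left (hsmono hN x) _) le_rfl) fun x => ?_
    by_cases hx : x ∈ A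
    · rw [Metric.tendsto_atTop]
      intro ε hε
      have h3 := hc.one_le x hx
      have h4 : ENNReal.ofReal (1 - ε) < ∑' n, ENNReal.ofReal (c n x) := by
        refine lt_of_lt_of_le ?_ h3
        rw [ENNReal.ofReal_lt_one]; linarith
      rw [ENNReal.tsum_eq_iSup_nat, lt_iSup_iff] at h4
      obtain ⟨N, hN⟩ := h4
      rw [← ENNReal.ofReal_sum_of_nonneg (fun n _ => hc.nonneg n x)] at hN
      have hN' := (ENNReal.ofReal_lt_ofReal_iff').1 hN
      refine ⟨N, fun n hn => ?_⟩
      have hsn : 1 - ε < s n x := lt_of_lt_of_le (by simpa [hs] using hN'.1) (hsmono hn x)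
      have := h1 x
      simp only [Pi.one_apply] at this
      rw [Real.dist_eq, sub_zero, abs_of_nonneg (le_max_right _ _)]
      exact max_lt (by simp only [Pi.sub_apply]; linarith) hε
    · have : ∀ N, f N x = 0 := fun N => by
        refine max_eq_right ?_
        have : 0 ≤ s N x := by
          simp only [hs, Finset.sum_apply]
          exact Finset.sum_nonneg fun n _ => hc.nonneg n x
        simp only [Pi.sub_apply, hA x hx]
        linarith
      simp [this]
  have hle : ∀ N, ENNReal.ofReal (L h) ≤
      ∑' n, ENNReal.ofReal (L (c n)) + ENNReal.ofReal (L (f N)) := by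
    intro N
    have h5 : L h ≤ ∑ n ∈ Finset.range N, L (c n) + L (f N) := by
      have := hpos (s N + f N - h) (H.sub_mem (H.add_mem (hsH N) (hfH N)) hh) fun x => by
        have : (h - s N) x ≤ f N x := le_max_left _ _
        simp only [Pi.sub_apply, Pi.add_apply, Pi.zero_apply] at this ⊢
        linarith
      rw [map_sub, map_add, hs, map_sum] at this
      linarith
    refine (ENNReal.ofReal_le_ofReal h5).trans (ENNReal.ofReal_add_le.trans ?_)
    rw [ENNReal.ofReal_sum_of_nonneg fun n _ => hpos _ (hc.mem n) (hc.nonneg n)]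
    gcongr
    exact ENNReal.sum_le_tsum _
  have := (tendsto_const_nhds (x := ∑' n, ENNReal.ofReal (L (c n)))).add
    (ENNReal.tendsto_ofReal hlim)
  rw [ENNReal.ofReal_zero, add_zero] at this
  exact ge_of_tendsto' this hle

/-- **Daniell's theorem**: a positive functional on an algebra of bounded functions which is
continuous along decreasing sequences is the integral with respect to a measure. -/
theorem exists_probabilityMeasure_integral_eq [mα : MeasurableSpace α]
    (hsup : ∀ f ∈ H, (fun x => max (f x) 0) ∈ H)
    (hbdd : ∀ f ∈ H, ∃ B, ∀ x, |f x| ≤ B) (hmeas : ∀ f ∈ H, Measurable f)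
    (hgen : ∃ 𝒢 : Set (Set α), mα = MeasurableSpace.generateFrom 𝒢 ∧
      ∀ G ∈ 𝒢, ∃ f ∈ H, 0 ≤ f ∧ G = {x | 0 < f x})
    (hpos : ∀ f ∈ H, 0 ≤ f → 0 ≤ L f) (hone : L 1 = 1)
    (hcont : ∀ f : ℕ → α → ℝ, (∀ n, f n ∈ H) → (∀ n, 0 ≤ f n) → Antitone f →
      (∀ x, Tendsto (fun n => f n x) atTop (𝓝 0)) → Tendsto (fun n => L (f n)) atTop (𝓝 0)) :
    ∃ μ : Measure α, IsProbabilityMeasure μ ∧ ∀ f ∈ H, ∫ x, f x ∂μ = L f := by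
  have hcar : mα ≤ (daniellOuter H L).caratheodory := by
    obtain ⟨𝒢, h𝒢, hG⟩ := hgen
    rw [h𝒢]
    refine MeasurableSpace.generateFrom_le fun G hG' => ?_
    obtain ⟨f, hf, hf0, rfl⟩ := hG G hG'
    exact isCaratheodory_daniellOuter hsup hpos hf hf0
  set μ := (daniellOuter H L).toMeasure hcar with hμ
  have hμle : ∀ {h : α → ℝ} {A : Set α}, MeasurableSet A → h ∈ H → h ≤ 1 →
      (∀ x ∉ A, h x = 0) → ENNReal.ofReal (L h) ≤ μ A := by
    intro h A hAm hh h1 hA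
    rw [hμ, toMeasure_apply _ _ hAm]
    exact le_daniellFun hsup hpos hcont hh h1 hA
  have huniv : μ univ = 1 := by
    refine le_antisymm ?_ ?_
    · rw [hμ, toMeasure_apply _ _ MeasurableSet.univ]
      have : IsCover H univ (fun n => if n = 0 then (1 : α → ℝ) else 0) :=
        ⟨fun n => by split_ifs; exacts [H.one_mem, H.zero_mem],
          fun n => by split_ifs; exacts [zero_le_one, le_rfl], fun x _ => by
            refine le_trans ?_ (ENNReal.le_tsum 0)
            simp⟩
      refine (daniellFun_le this).trans ?_
      rw [tsum_eq_single 0 (fun n hn => by simp [hn])]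
      simp [hone]
    · have := hμle MeasurableSet.univ H.one_mem le_rfl (fun x hx => (hx trivial).elim)
      simpa [hone] using this
  have : IsProbabilityMeasure μ := ⟨huniv⟩
  have hint : ∀ f ∈ H, Integrable f μ := fun f hf => by
    obtain ⟨B, hB⟩ := hbdd f hf
    exact Integrable.of_bound (hmeas f hf).aestronglyMeasurable B (ae_of_all _ hB)
  have hle : ∀ f ∈ H, 0 ≤ f → L f ≤ ∫ x, f x ∂μ := by
    intro f hf hf0
    obtain ⟨B, hB⟩ := hbdd f hf
    refine le_of_forall_pos_le_add fun ε hε => ?_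
    obtain ⟨N, hN⟩ := exists_nat_ge (B / ε)
    -- Horizontal slices of `f` of thickness ε, as in the layer-cake formula; N+1 of them exhaust
    -- `f`.
    set F : ℕ → α → ℝ := fun i x => min ε (max (f x - i * ε) 0) with hF
    have hFH : ∀ i, F i ∈ H := fun i => min_mem_of_posPart_mem hsup (const_mem_subalgebra ε)
      (hsup _ (H.sub_mem hf (const_mem_subalgebra _)))
    have hFsum : ∀ j : ℕ, ∀ x, ∑ i ∈ Finset.range j, F i x = min (f x) (j * ε) := by
      intro j x
      induction j with
      | zero => simpa using (hf0 x)
      | succ j ih =>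
        rw [Finset.sum_range_succ, ih]
        simp only [hF]
        push_cast
        have e : (j + 1 : ℝ) * ε = j * ε + ε := by ring
        rw [e]
        rcases le_total (f x) (j * ε) with h | h
        · rw [min_eq_left h, max_eq_right (by linarith), min_eq_right hε.le,
            min_eq_left (by linarith)]; ring
        · rw [min_eq_right h, max_eq_left (by linarith)]
          rcases le_total (f x) (j * ε + ε) with h' | h'
          · rw [min_eq_right (by linarith), min_eq_left h']; ring
          · rw [min_eq_left (by linarith), min_eq_right h']
    have hfF : f = ∑ i ∈ Finset.range (N + 1), F i := by
      ext x
      rw [Finset.sum_apply, hFsum, min_eq_left]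
      rw [div_le_iff₀ hε] at hN
      push_cast
      nlinarith [le_of_abs_le (hB x)]
    -- The level set {f > (i+1)ε} separates consecutive slices: `F (i + 1)` vanishes off it and `F
    -- i` equals ε on it. The index shift costs only the bottom slice, which contributes at most ε.
    have hstep : ∀ i, L (F (i + 1)) ≤ ∫ x, F i x ∂μ := by
      intro i
      have hm : MeasurableSet {x | (i + 1 : ℝ) * ε < f x} :=
        measurableSet_lt measurable_const (hmeas f hf)
      have h1 : L (ε⁻¹ • F (i + 1)) ≤ μ.real {x | (i + 1 : ℝ) * ε < f x} := by
        have := hμle hm (H.smul_mem (hFH (i + 1)) ε⁻¹)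
          (fun x => by
            have : ε⁻¹ * F (i + 1) x ≤ ε⁻¹ * ε :=
              mul_le_mul_of_nonneg_left (min_le_left _ _) (inv_nonneg.2 hε.le)
            rwa [inv_mul_cancel₀ hε.ne'] at this)
          (fun x hx => by
            have : f x - (i + 1 : ℝ) * ε ≤ 0 := by
              have : f x ≤ (i + 1 : ℝ) * ε := not_lt.1 hx
              linarith
            simp [hF, max_eq_right this, hε.le])
        exact (ENNReal.ofReal_le_iff_le_toReal (measure_ne_top _ _)).1 this
      have h2 : μ.real {x | (i + 1 : ℝ) * ε < f x} ≤ ∫ x, ε⁻¹ * F i x ∂μ := by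
        rw [← integral_indicator_one hm]
        refine integral_mono ((integrable_const (1 : ℝ)).indicator hm)
          ((hint _ (hFH i)).const_mul _) fun x => ?_
        by_cases hx : x ∈ {x | (i + 1 : ℝ) * ε < f x}
        · have hx' : (i + 1 : ℝ) * ε < f x := hx
          rw [indicator_of_mem hx]
          have : F i x = ε := by
            refine min_eq_left (le_max_of_le_left ?_)
            linarith
          simp [this, hε.ne']
        · rw [indicator_of_notMem hx]
          exact mul_nonneg (inv_nonneg.2 hε.le) (le_min hε.le (le_max_right _ _))
      rw [map_smul, smul_eq_mul] at h1
      rw [integral_const_mul] at h2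
      exact le_of_mul_le_mul_left (h1.trans h2) (inv_pos.2 hε)
    have h0 : L (F 0) ≤ ε := by
      have := hpos ((fun _ => ε) - F 0) (H.sub_mem (const_mem_subalgebra ε) (hFH 0)) fun x =>
        sub_nonneg.2 (min_le_left _ _)
      have hc : L (fun _ => ε) = ε := by
        have : (fun _ => ε : α → ℝ) = ε • (1 : α → ℝ) := by ext; simp
        rw [this, map_smul, hone, smul_eq_mul, mul_one]
      rw [map_sub, hc] at this
      linarith
    have h3 : ∑ i ∈ Finset.range N, ∫ x, F i x ∂μ ≤ ∫ x, f x ∂μ := by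
      rw [← integral_finsetSum _ fun i _ => hint _ (hFH i)]
      refine integral_mono (integrable_finsetSum _ fun i _ => hint _ (hFH i)) (hint f hf)
        fun x => ?_
      simp only
      rw [hFsum]
      exact min_le_left _ _
    calc L f = ∑ i ∈ Finset.range N, L (F (i + 1)) + L (F 0) := by
          conv_lhs => rw [hfF]
          rw [map_sum, Finset.sum_range_succ']
      _ ≤ ∑ i ∈ Finset.range N, ∫ x, F i x ∂μ + ε :=
          add_le_add (Finset.sum_le_sum fun i _ => hstep i) h0
      _ ≤ _ := by linarith
  have hconst : ∀ c : ℝ, L (fun _ => c) = c := fun c => by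
    have : (fun _ => c : α → ℝ) = c • (1 : α → ℝ) := by ext; simp
    rw [this, map_smul, hone, smul_eq_mul, mul_one]
  -- The one-sided bound for non-negative functions, applied to B - f and B + f, gives both
  -- inequalities.
  refine ⟨μ, inferInstance, fun f hf => le_antisymm ?_ ?_⟩
  · obtain ⟨B, hB⟩ := hbdd f hf
    have := hle ((fun _ => B) - f) (H.sub_mem (const_mem_subalgebra B) hf) fun x =>
      sub_nonneg.2 (le_of_abs_le (hB x))
    rw [map_sub, hconst] at this
    simp only [Pi.sub_apply] at this
    rw [integral_sub (integrable_const _) (hint f hf)] at this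
    simp at this
    linarith
  · obtain ⟨B, hB⟩ := hbdd f hf
    have := hle ((fun _ => B) + f) (H.add_mem (const_mem_subalgebra B) hf) fun x => by
      have := neg_le_of_abs_le (hB x)
      simp only [Pi.add_apply, Pi.zero_apply]
      linarith
    rw [map_add, hconst] at this
    simp only [Pi.add_apply] at this
    rw [integral_add (integrable_const _) (hint f hf)] at this
    simp at this
    linarith

end Daniell

/-! ### Birkhoff sums of functions with negative mean -/

section Birkhoff

variable {Ω : Type*} {θ : Ω → Ω}

/-- The maximum of `0` and the first `n` Birkhoff sums. -/
noncomputable def maxBirkhoffSum (θ : Ω → Ω) (ψ : Ω → ℝ) : ℕ → Ω → ℝ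
  | 0, _ => 0
  | n + 1, ω => max 0 (ψ ω + maxBirkhoffSum θ ψ n (θ ω))

theorem birkhoffSum_le_maxBirkhoffSum (ψ : Ω → ℝ) (n : ℕ) (ω : Ω) :
    birkhoffSum θ ψ n ω ≤ maxBirkhoffSum θ ψ n ω := by
  induction n generalizing ω with
  | zero => simp [maxBirkhoffSum]
  | succ n ih =>
    rw [birkhoffSum_succ', maxBirkhoffSum]
    exact le_max_of_le_right (by linarith [ih (θ ω)])

theorem maxBirkhoffSum_nonneg (ψ : Ω → ℝ) (n : ℕ) (ω : Ω) : 0 ≤ maxBirkhoffSum θ ψ n ω := by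
  cases n with
  | zero => exact le_rfl
  | succ n => exact le_max_left _ _

theorem maxBirkhoffSum_le_succ (ψ : Ω → ℝ) (n : ℕ) (ω : Ω) :
    maxBirkhoffSum θ ψ n ω ≤ maxBirkhoffSum θ ψ (n + 1) ω := by
  induction n generalizing ω with
  | zero => exact maxBirkhoffSum_nonneg ψ 1 ω
  | succ n ih =>
    rw [maxBirkhoffSum, maxBirkhoffSum]
    exact max_le_max le_rfl (by linarith [ih (θ ω)])

theorem maxBirkhoffSum_le {ψ : Ω → ℝ} {B : ℝ} (hB : ∀ ω, |ψ ω| ≤ B) (n : ℕ) (ω : Ω) :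
    maxBirkhoffSum θ ψ n ω ≤ n * B := by
  induction n generalizing ω with
  | zero => simp [maxBirkhoffSum]
  | succ n ih =>
    have h0 : 0 ≤ B := (abs_nonneg _).trans (hB ω)
    rw [maxBirkhoffSum]
    push_cast
    refine max_le (by positivity) ?_
    linarith [ih (θ ω), le_of_abs_le (hB ω)]

variable [MeasurableSpace Ω]

theorem measurable_maxBirkhoffSum (hθ : Measurable θ) {ψ : Ω → ℝ} (hψ : Measurable ψ) (n : ℕ) :
    Measurable (maxBirkhoffSum θ ψ n) := by
  induction n with
  | zero => exact measurable_const
  | succ n ih => exact measurable_const.max (hψ.add (ih.comp hθ))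

theorem measurable_birkhoffSum (hθ : Measurable θ) {ψ : Ω → ℝ} (hψ : Measurable ψ) (n : ℕ) :
    Measurable (birkhoffSum θ ψ n) := by
  unfold birkhoffSum
  exact Finset.measurable_fun_sum _ fun i _ => hψ.comp (hθ.iterate i)

variable {P : Measure Ω} [IsProbabilityMeasure P]

omit [IsProbabilityMeasure P] in
theorem integral_comp_of_measurePreserving (hθ : MeasurePreserving θ P P) {f : Ω → ℝ}
    (hf : Measurable f) : ∫ ω, f (θ ω) ∂P = ∫ ω, f ω ∂P := by
  rw [← integral_map (f := f) hθ.aemeasurable (by exact hf.aestronglyMeasurable), hθ.map_eq]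

/-- The maximal ergodic inequality: if the Birkhoff sums are almost surely unbounded above, then
the mean is non-negative. -/
theorem ae_bddAbove_birkhoffSum (hθ : Ergodic θ P) {ψ : Ω → ℝ} (hψ : Measurable ψ) {B : ℝ}
    (hB : ∀ ω, |ψ ω| ≤ B) (hneg : ∫ ω, ψ ω ∂P < 0) :
    ∀ᵐ ω ∂P, BddAbove (range fun n => birkhoffSum θ ψ n ω) := by
  have hm : MeasurableSet {ω | BddAbove (range fun n => birkhoffSum θ ψ n ω)} :=
    measurableSet_bddAbove_range fun n => measurable_birkhoffSum hθ.measurable hψ n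
  have hinv : θ ⁻¹' {ω | BddAbove (range fun n => birkhoffSum θ ψ n ω)} =
      {ω | BddAbove (range fun n => birkhoffSum θ ψ n ω)} := by
    ext ω
    constructor
    · rintro ⟨b, hb⟩
      refine ⟨max 0 (ψ ω + b), ?_⟩
      rintro _ ⟨n, rfl⟩
      cases n with
      | zero => simp
      | succ n =>
        simp only [birkhoffSum_succ']
        exact le_max_of_le_right (by linarith [hb ⟨n, rfl⟩])
    · rintro ⟨b, hb⟩
      refine ⟨b - ψ ω, ?_⟩
      rintro _ ⟨n, rfl⟩
      have := hb ⟨n + 1, rfl⟩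
      simp only [birkhoffSum_succ'] at this
      simp only
      linarith
  -- In the remaining case almost every ω eventually enters the sets `A n` where the maximal sum is
  -- positive. The integrals of ψ over `A n` are non-negative and converge to the full integral.
  rcases hθ.toPreErgodic.ae_mem_or_ae_notMem hm hinv with h | h
  · exact h
  exfalso
  have hint : Integrable ψ P := Integrable.of_bound hψ.aestronglyMeasurable B (ae_of_all _ hB)
  have hMm := measurable_maxBirkhoffSum hθ.measurable hψ
  have hMint : ∀ n, Integrable (maxBirkhoffSum θ ψ n) P := fun n =>
    Integrable.of_bound (hMm n).aestronglyMeasurable (n * B) (ae_of_all _ fun ω => by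
      rw [Real.norm_eq_abs, abs_of_nonneg (maxBirkhoffSum_nonneg ψ n ω)]
      exact maxBirkhoffSum_le hB n ω)
  set A : ℕ → Set Ω := fun n => {ω | 0 < maxBirkhoffSum θ ψ (n + 1) ω} with hA
  have hAm : ∀ n, MeasurableSet (A n) := fun n => measurableSet_lt measurable_const (hMm _)
  have hstep : ∀ n, 0 ≤ ∫ ω, (A n).indicator ψ ω ∂P := by
    intro n
    have h1 : ∫ ω, maxBirkhoffSum θ ψ (n + 1) ω ∂P ≤
        ∫ ω, ((A n).indicator ψ ω + maxBirkhoffSum θ ψ n (θ ω)) ∂P := by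
      refine integral_mono (hMint _) ((hint.indicator (hAm n)).add
        (hθ.toMeasurePreserving.integrable_comp_of_integrable (hMint n))) fun ω => ?_
      by_cases hω : ω ∈ A n
      · simp only [indicator_of_mem hω]
        have hω' : 0 < max 0 (ψ ω + maxBirkhoffSum θ ψ n (θ ω)) := hω
        have : 0 < ψ ω + maxBirkhoffSum θ ψ n (θ ω) := by
          rcases lt_max_iff.1 hω' with h | h
          · exact absurd h (lt_irrefl _)
          · exact h
        rw [maxBirkhoffSum, max_eq_right this.le]
      · simp only [indicator_of_notMem hω, zero_add]
        exact (not_lt.1 hω).trans (maxBirkhoffSum_nonneg ψ n _)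
    have h3 : Integrable (fun ω => maxBirkhoffSum θ ψ n (θ ω)) P :=
      hθ.toMeasurePreserving.integrable_comp_of_integrable (hMint n)
    rw [integral_add (hint.indicator (hAm n)) h3,
      integral_comp_of_measurePreserving hθ.toMeasurePreserving (hMm n)] at h1
    have h2 := integral_mono (hMint n) (hMint (n + 1)) (maxBirkhoffSum_le_succ ψ n)
    linarith
  have hlim : Tendsto (fun n => ∫ ω, (A n).indicator ψ ω ∂P) atTop (𝓝 (∫ ω, ψ ω ∂P)) := by
    refine tendsto_integral_of_dominated_convergence (fun _ => B)
      (fun n => (hψ.indicator (hAm n)).aestronglyMeasurable) (integrable_const _)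
      (fun n => ae_of_all _ fun ω => (norm_indicator_le_norm_self _ _).trans (hB ω)) ?_
    filter_upwards [h] with ω hω
    have hex : ∃ n, 0 < birkhoffSum θ ψ n ω := by
      by_contra! hcon
      exact hω ⟨0, by rintro _ ⟨n, rfl⟩; exact hcon n⟩
    obtain ⟨N, hN⟩ := hex
    refine tendsto_const_nhds.congr' ?_
    filter_upwards [eventually_ge_atTop N] with n hn
    have hmono : Monotone fun n => maxBirkhoffSum θ ψ n ω :=
      monotone_nat_of_le_succ fun n => maxBirkhoffSum_le_succ ψ n ω
    have : ω ∈ A n := (hN.trans_le (birkhoffSum_le_maxBirkhoffSum ψ N ω)).trans_le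
      (hmono (hn.trans n.le_succ))
    rw [indicator_of_mem this]
  exact absurd (ge_of_tendsto' hlim hstep) (not_le.2 hneg)

/-- Adding half of |∫ψ| keeps the mean negative, so the shifted sums are still bounded above;
undoing the shift leaves a linear decay. -/
theorem ae_tendsto_birkhoffSum_atBot (hθ : Ergodic θ P) {ψ : Ω → ℝ} (hψ : Measurable ψ) {B : ℝ}
    (hB : ∀ ω, |ψ ω| ≤ B) (hneg : ∫ ω, ψ ω ∂P < 0) :
    ∀ᵐ ω ∂P, Tendsto (fun n => birkhoffSum θ ψ n ω) atTop atBot := by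
  set ε : ℝ := -(∫ ω, ψ ω ∂P) / 2 with hε
  have hε0 : 0 < ε := by rw [hε]; linarith
  have hint : Integrable ψ P := Integrable.of_bound hψ.aestronglyMeasurable B (ae_of_all _ hB)
  have := ae_bddAbove_birkhoffSum hθ (ψ := fun ω => ψ ω + ε) (hψ.add_const ε) (B := B + ε)
    (fun ω => (abs_add_le _ _).trans (by rw [abs_of_pos hε0]; linarith [hB ω]))
    (by rw [integral_add hint (integrable_const _)]; simp; rw [hε]; linarith)
  filter_upwards [this] with ω ⟨b, hb⟩
  have hle : ∀ n : ℕ, birkhoffSum θ ψ n ω ≤ b - n * ε := by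
    intro n
    have h1 := hb ⟨n, rfl⟩
    have h2 : birkhoffSum θ (fun ω => ψ ω + ε) n ω = birkhoffSum θ ψ n ω + n * ε := by
      simp [birkhoffSum, Finset.sum_add_distrib]
    simp only [h2] at h1
    linarith
  refine tendsto_atBot_mono hle ?_
  refine tendsto_atBot_add_const_left _ _ (tendsto_neg_atTop_atBot.comp ?_)
  exact tendsto_natCast_atTop_atTop.atTop_mul_const hε0

end Birkhoff

/-! ### Carathéodory functions and random sets -/

section Caratheodory

variable {Ω M : Type*} [MeasurableSpace Ω] [MetricSpace M] [MeasurableSpace M] [BorelSpace M]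

/-- Jointly measurable functions which are continuous in the second variable. -/
structure IsCaratheodory (f : Ω × M → ℝ) : Prop where
  measurable : Measurable f
  continuous : ∀ ω, Continuous fun x => f (ω, x)

theorem measurable_of_continuous_of_measurable [SecondCountableTopology M] {β : Type*}
    [TopologicalSpace β] [TopologicalSpace.PseudoMetrizableSpace β] [MeasurableSpace β]
    [BorelSpace β] {f : Ω × M → β} (hc : ∀ ω, Continuous fun x => f (ω, x))
    (hm : ∀ x, Measurable fun ω => f (ω, x)) : Measurable f :=
  (measurable_uncurry_of_continuous_of_measurable (u := fun x ω => f (ω, x)) hc hm).comp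
    measurable_swap

theorem IsCaratheodory.mk' [SecondCountableTopology M] {f : Ω × M → ℝ}
    (hc : ∀ ω, Continuous fun x => f (ω, x)) (hm : ∀ x, Measurable fun ω => f (ω, x)) :
    IsCaratheodory f :=
  ⟨measurable_of_continuous_of_measurable hc hm, hc⟩

omit [BorelSpace M] in
theorem IsCaratheodory.measurable_left {f : Ω × M → ℝ} (hf : IsCaratheodory f) (x : M) :
    Measurable fun ω => f (ω, x) :=
  hf.measurable.comp measurable_prodMk_right

end Caratheodory

/-! ### Iterates of skew products. -/

section SkewProduct

variable {Ω M : Type*} {θ : Ω → Ω} {F : Ω → M → M}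

theorem skewProduct_iterate_fst (j : ℕ) (p : Ω × M) :
    ((skewProduct θ F)^[j] p).1 = θ^[j] p.1 := by
  induction j with
  | zero => rfl
  | succ j ih => rw [Function.iterate_succ_apply', Function.iterate_succ_apply', ← ih]; rfl

theorem skewProduct_iterate_succ_snd (j : ℕ) (p : Ω × M) :
    ((skewProduct θ F)^[j + 1] p).2 = F (θ^[j] p.1) ((skewProduct θ F)^[j] p).2 := by
  rw [Function.iterate_succ_apply', ← skewProduct_iterate_fst (F := F)]; rfl

theorem continuous_skewProduct_iterate_snd [TopologicalSpace M] (hF : ∀ ω, Continuous (F ω))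
    (j : ℕ) (ω : Ω) : Continuous fun x => ((skewProduct θ F)^[j] (ω, x)).2 := by
  induction j with
  | zero => exact continuous_id
  | succ j ih =>
    simp only [skewProduct_iterate_succ_snd]
    exact (hF _).comp ih

theorem bijective_skewProduct_iterate_snd (hF : ∀ ω, Function.Bijective (F ω))
    (j : ℕ) (ω : Ω) : Function.Bijective fun x => ((skewProduct θ F)^[j] (ω, x)).2 := by
  induction j with
  | zero => exact Function.bijective_id
  | succ j ih =>
    simp only [skewProduct_iterate_succ_snd]
    exact (hF _).comp ih

theorem measurable_skewProduct [MeasurableSpace Ω] [MetricSpace M] [MeasurableSpace M]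
    [BorelSpace M] [SecondCountableTopology M] (hθ : Measurable θ) (hF : IsRandomMap F) :
    Measurable (skewProduct θ F) :=
  (hθ.comp measurable_fst).prodMk
    (measurable_of_continuous_of_measurable (f := fun p => F p.1 p.2) hF.continuous hF.measurable)

theorem IsCaratheodory.comp_iterate [MeasurableSpace Ω] [MetricSpace M] [MeasurableSpace M]
    [BorelSpace M] [SecondCountableTopology M] (hθ : Measurable θ) (hF : IsRandomMap F)
    {f : Ω × M → ℝ} (hf : IsCaratheodory f) (j : ℕ) :
    IsCaratheodory fun p => f ((skewProduct θ F)^[j] p) := by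
  refine ⟨hf.measurable.comp ((measurable_skewProduct hθ hF).iterate j), fun ω => ?_⟩
  have : (fun x => f ((skewProduct θ F)^[j] (ω, x))) =
      fun x => f (θ^[j] ω, ((skewProduct θ F)^[j] (ω, x)).2) := by
    ext x
    rw [← skewProduct_iterate_fst (F := F) j (ω, x)]
  rw [this]
  exact (hf.continuous _).comp (continuous_skewProduct_iterate_snd hF.continuous j ω)

end SkewProduct

/-! ### Measurability of random compact and random closed sets. -/

section RandomSets

variable {Ω M : Type*} [MeasurableSpace Ω] [MetricSpace M]

/-- Compactness replaces a measurable projection theorem: an exact tuple exists as soon as, for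
every tolerance 1/(m+1), a tuple from a countable dense set satisfies the conditions up to that
tolerance. -/
theorem measurableSet_exists_tuple [SecondCountableTopology M] {K : Set (Ω × M)}
    (hK : IsRandomCompact K) {n : ℕ} {F : Ω → (Fin n → M) → ℝ} (hFc : ∀ ω, Continuous (F ω))
    (hFm : ∀ x, Measurable fun ω => F ω x) :
    MeasurableSet {ω | ∃ x : Fin n → M, (∀ i, x i ∈ fibre K ω) ∧ 0 ≤ F ω x} := by
  obtain ⟨D, hDc, hDd⟩ := TopologicalSpace.exists_countable_dense (Fin n → M)
  have hpos : ∀ m : ℕ, (0 : ℝ) < 1 / ((m : ℝ) + 1) := fun m => Nat.one_div_pos_of_nat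
  have heq : {ω | ∃ x : Fin n → M, (∀ i, x i ∈ fibre K ω) ∧ 0 ≤ F ω x} =
      ⋂ m : ℕ, ⋃ x ∈ D, {ω | (∀ i, Metric.infEDist (x i) (fibre K ω) <
        ENNReal.ofReal (1 / ((m : ℝ) + 1))) ∧ -(1 / ((m : ℝ) + 1)) < F ω x} := by
    ext ω
    simp only [mem_ofPred_eq, mem_iInter, mem_iUnion, exists_prop]
    constructor
    · rintro ⟨x, hx, hF⟩ m
      have hopen : IsOpen {x : Fin n → M | (∀ i, Metric.infEDist (x i) (fibre K ω) <
          ENNReal.ofReal (1 / ((m : ℝ) + 1))) ∧ -(1 / ((m : ℝ) + 1)) < F ω x} := by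
        rw [ofPred_and, ofPred_forall]
        refine (isOpen_iInter_of_finite fun i => ?_).inter (isOpen_lt continuous_const (hFc ω))
        exact isOpen_lt (Metric.continuous_infEDist.comp (continuous_apply i)) continuous_const
      obtain ⟨y, hyD, hy⟩ := hDd.exists_mem_open hopen ⟨x, fun i => by
        rw [Metric.infEDist_zero_of_mem (hx i)]
        exact ENNReal.ofReal_pos.2 (hpos m), by linarith [hpos m]⟩
      exact ⟨y, hyD, hy⟩
    · intro h
      choose x _ hxK hxF using h
      have : ∀ m i, ∃ y ∈ fibre K ω, edist (x m i) y < ENNReal.ofReal (1 / ((m : ℝ) + 1)) :=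
        fun m i => Metric.infEDist_lt_iff.1 (hxK m i)
      choose y hyK hy using this
      obtain ⟨z, hz, φ, hφ, hlim⟩ := (isCompact_univ_pi fun _ : Fin n => hK.isCompact ω).tendsto_subseq
        (x := y) fun m i _ => hyK m i
      have hx : Tendsto (fun m => x (φ m)) atTop (𝓝 z) := by
        rw [tendsto_pi_nhds] at hlim ⊢
        intro i
        refine tendsto_of_tendsto_of_dist (hlim i) ?_
        have h0 : Tendsto (fun m : ℕ => 1 / (((φ m : ℕ) : ℝ) + 1)) atTop (𝓝 0) :=
          tendsto_one_div_add_atTop_nhds_zero_nat.comp hφ.tendsto_atTop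
        refine squeeze_zero (fun _ => dist_nonneg) (fun m => ?_) h0
        have := hy (φ m) i
        rw [edist_dist, ENNReal.ofReal_lt_ofReal_iff (hpos _)] at this
        rw [dist_comm]
        exact this.le
      refine ⟨z, fun i => hz i trivial, ?_⟩
      have h0 : Tendsto (fun m : ℕ => -(1 / (((φ m : ℕ) : ℝ) + 1))) atTop (𝓝 (-0)) :=
        (tendsto_one_div_add_atTop_nhds_zero_nat.comp hφ.tendsto_atTop).neg
      rw [neg_zero] at h0
      exact le_of_tendsto_of_tendsto' h0 (((hFc ω).tendsto z).comp hx) fun m => (hxF (φ m)).le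
  rw [heq]
  refine MeasurableSet.iInter fun m => MeasurableSet.biUnion hDc fun x _ => ?_
  rw [ofPred_and, ofPred_forall]
  exact (MeasurableSet.iInter fun i => measurableSet_lt (hK.measurable _) measurable_const).inter
    (measurableSet_lt measurable_const (hFm x))

omit [MeasurableSpace Ω] in
theorem infEDist_le_iff_exists_dist_le {s : Set M} (hs : IsCompact s) (x : M) {c : ℝ≥0∞}
    (hc : c ≠ ⊤) : Metric.infEDist x s ≤ c ↔ ∃ y ∈ s, dist x y ≤ c.toReal := by
  constructor
  · intro h
    have hne : s.Nonempty := by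
      by_contra hne
      rw [not_nonempty_iff_eq_empty.1 hne, Metric.infEDist_empty] at h
      exact hc (top_le_iff.1 h)
    obtain ⟨y, hy, hxy⟩ := hs.exists_infEDist_eq_edist hne x
    refine ⟨y, hy, ?_⟩
    rw [hxy, edist_dist] at h
    exact (ENNReal.ofReal_le_iff_le_toReal hc).1 h
  · rintro ⟨y, hy, h⟩
    refine (Metric.infEDist_le_edist_of_mem hy).trans ?_
    rw [edist_dist]
    exact (ENNReal.ofReal_le_iff_le_toReal hc).2 h

/-- In a compact space, a set with closed fibres is a random closed set if the events
`C(ω) ∩ closedBall x s ≠ ∅` are measurable. -/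
theorem IsRandomClosed.of_measurableSet [CompactSpace M] {C : Set (Ω × M)}
    (hC : ∀ ω, IsClosed (fibre C ω))
    (hm : ∀ x s, MeasurableSet {ω | ∃ y ∈ fibre C ω, dist x y ≤ s}) : IsRandomClosed C := by
  refine ⟨hC, fun x => measurable_of_Iic fun c => ?_⟩
  rcases eq_or_ne c ⊤ with rfl | hc
  · simp
  · convert hm x c.toReal using 1
    ext ω
    exact infEDist_le_iff_exists_dist_le (hC ω).isCompact x hc

theorem isRandomCompact_univ [CompactSpace M] : IsRandomCompact (univ : Set (Ω × M)) := by
  have : ∀ ω : Ω, fibre (univ : Set (Ω × M)) ω = univ := fun ω => rfl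
  refine ⟨fun ω => by rw [this]; exact isCompact_univ, fun x => ?_⟩
  simp only [this, Metric.infEDist_zero_of_mem (mem_univ x)]
  exact measurable_const

theorem IsRandomCompact.isRandomClosed {K : Set (Ω × M)} (hK : IsRandomCompact K) :
    IsRandomClosed K := ⟨fun ω => (hK.isCompact ω).isClosed, hK.measurable⟩

theorem measurableSet_fibre_nonempty {C : Set (Ω × M)}
    (hC : ∀ x, Measurable fun ω => Metric.infEDist x (fibre C ω)) [hM : Nonempty M] :
    MeasurableSet {ω | (fibre C ω).Nonempty} := by
  obtain ⟨x⟩ := hM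
  convert measurableSet_lt (hC x) (measurable_const (a := (⊤ : ℝ≥0∞))) using 1
  ext ω
  rw [mem_ofPred_eq, mem_ofPred_eq, lt_top_iff_ne_top, Ne, Metric.infEDist_eq_top_iff,
    nonempty_iff_ne_empty]

/-- The distance to the fibres of a random set, cut off at `1`. -/
noncomputable def cutDist (C : Set (Ω × M)) (p : Ω × M) : ℝ :=
  (min 1 (Metric.infEDist p.2 (fibre C p.1))).toReal

omit [MeasurableSpace Ω] in
theorem cutDist_nonneg (C : Set (Ω × M)) (p : Ω × M) : 0 ≤ cutDist C p := ENNReal.toReal_nonneg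

omit [MeasurableSpace Ω] in
theorem cutDist_le_one (C : Set (Ω × M)) (p : Ω × M) : cutDist C p ≤ 1 :=
  ENNReal.toReal_mono ENNReal.one_ne_top (min_le_left _ _)

omit [MeasurableSpace Ω] in
theorem cutDist_eq_zero_iff {C : Set (Ω × M)} {p : Ω × M} (hC : IsClosed (fibre C p.1)) :
    cutDist C p = 0 ↔ p ∈ C := by
  have hne : min 1 (Metric.infEDist p.2 (fibre C p.1)) ≠ ⊤ :=
    ((min_le_left _ _).trans_lt ENNReal.one_lt_top).ne
  have h : p ∈ C ↔ Metric.infEDist p.2 (fibre C p.1) = 0 :=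
    Metric.mem_iff_infEDist_zero_of_closed (x := p.2) hC
  rw [cutDist, ENNReal.toReal_eq_zero_iff, or_iff_left hne, h]
  constructor
  · intro h
    rcases min_choice 1 (Metric.infEDist p.2 (fibre C p.1)) with h' | h'
    · exact absurd (h'.symm.trans h) one_ne_zero
    · exact h'.symm.trans h
  · intro h
    rw [h, min_eq_right zero_le_one]

theorem IsRandomClosed.isCaratheodory_cutDist [MeasurableSpace M] [BorelSpace M]
    [SecondCountableTopology M] {C : Set (Ω × M)} (hC : IsRandomClosed C) :
    IsCaratheodory (cutDist C) := by
  refine .mk' (fun ω => ?_) fun x => ?_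
  · have hc : Continuous fun x => min 1 (Metric.infEDist x (fibre C ω)) :=
      continuous_const.min Metric.continuous_infEDist
    refine ENNReal.continuousOn_toReal.comp_continuous hc fun x => ?_
    exact ((min_le_left _ _).trans_lt ENNReal.one_lt_top).ne
  · exact (measurable_const.min (hC.measurable x)).ennreal_toReal

end RandomSets

/-! ### Suprema over the fibres and over their neighbourhoods. -/

section Envelope

variable {Ω M : Type*} [MetricSpace M] [SecondCountableTopology M] [Nonempty M]

/-- The supremum of `f(ω, x)` over the points `x` of the `r`-neighbourhood of `K(ω)`, for
functions bounded by `B`. -/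
noncomputable def envelope (K : Set (Ω × M)) (f : Ω × M → ℝ) (B r : ℝ) (ω : Ω) : ℝ :=
  open Classical in
  ⨆ i : ℕ, if TopologicalSpace.denseSeq M i ∈ Metric.thickening r (fibre K ω) then
    f (ω, TopologicalSpace.denseSeq M i) else -B

variable {K : Set (Ω × M)} {f : Ω × M → ℝ} {B : ℝ}

theorem envelope_le {r b : ℝ} {ω : Ω} (hb : -B ≤ b)
    (h : ∀ x ∈ Metric.thickening r (fibre K ω), f (ω, x) ≤ b) : envelope K f B r ω ≤ b := by
  classical
  refine ciSup_le fun i => ?_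
  split_ifs with hi
  · exact h _ hi
  · exact hb

theorem bddAbove_envelope (hB : ∀ p, |f p| ≤ B) (r : ℝ) (ω : Ω) :
    open Classical in
    BddAbove (range fun i : ℕ =>
      if TopologicalSpace.denseSeq M i ∈ Metric.thickening r (fibre K ω) then
        f (ω, TopologicalSpace.denseSeq M i) else -B) := by
  refine ⟨B, ?_⟩
  rintro _ ⟨i, rfl⟩
  have h0 := (abs_nonneg _).trans (hB (ω, TopologicalSpace.denseSeq M i))
  dsimp only
  split_ifs
  · exact le_of_abs_le (hB _)
  · linarith

theorem le_envelope (hf : ∀ ω, Continuous fun x => f (ω, x)) (hB : ∀ p, |f p| ≤ B) {r : ℝ} {ω : Ω}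
    {x : M} (hx : x ∈ Metric.thickening r (fibre K ω)) : f (ω, x) ≤ envelope K f B r ω := by
  classical
  by_contra! hlt
  obtain ⟨i, hi1, hi2⟩ := (TopologicalSpace.denseRange_denseSeq M).exists_mem_open
    (Metric.isOpen_thickening.inter (isOpen_lt continuous_const (hf ω))) ⟨x, hx, hlt⟩
  have := le_ciSup (bddAbove_envelope (K := K) hB r ω) i
  simp only [if_pos hi1] at this
  exact absurd hi2 (not_lt.2 this)

theorem abs_envelope_le (hB : ∀ p, |f p| ≤ B) (r : ℝ) (ω : Ω) : |envelope K f B r ω| ≤ B := by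
  classical
  have h0 := (abs_nonneg _).trans (hB (ω, TopologicalSpace.denseSeq M 0))
  refine abs_le.2 ⟨?_, envelope_le (by linarith) fun x _ => le_of_abs_le (hB _)⟩
  refine le_trans ?_ (le_ciSup (bddAbove_envelope (K := K) hB r ω) 0)
  split_ifs
  · exact neg_le_of_abs_le (hB _)
  · exact le_rfl

theorem measurable_envelope [MeasurableSpace Ω]
    (hK : ∀ x, Measurable fun ω => Metric.infEDist x (fibre K ω))
    (hf : ∀ x, Measurable fun ω => f (ω, x)) (r : ℝ) : Measurable (envelope K f B r) := by
  classical
  refine Measurable.iSup fun i => Measurable.ite ?_ (hf _) measurable_const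
  exact measurableSet_lt (hK _) measurable_const

/-- The supremum of `f` over the fibres of `K`, for functions bounded by `B`. -/
noncomputable def fibreSup (K : Set (Ω × M)) (f : Ω × M → ℝ) (B : ℝ) (ω : Ω) : ℝ :=
  ⨅ j : ℕ, envelope K f B (1 / ((j : ℝ) + 1)) ω

theorem bddBelow_envelope (hB : ∀ p, |f p| ≤ B) (ω : Ω) :
    BddBelow (range fun j : ℕ => envelope K f B (1 / ((j : ℝ) + 1)) ω) := by
  refine ⟨-B, ?_⟩
  rintro _ ⟨j, rfl⟩
  exact neg_le_of_abs_le (abs_envelope_le hB _ _)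

theorem abs_fibreSup_le (hB : ∀ p, |f p| ≤ B) (ω : Ω) : |fibreSup K f B ω| ≤ B :=
  abs_le.2 ⟨le_ciInf fun _ => neg_le_of_abs_le (abs_envelope_le hB _ _),
    (ciInf_le (bddBelow_envelope hB ω) 0).trans (le_of_abs_le (abs_envelope_le hB _ _))⟩

theorem measurable_fibreSup [MeasurableSpace Ω]
    (hK : ∀ x, Measurable fun ω => Metric.infEDist x (fibre K ω))
    (hf : ∀ x, Measurable fun ω => f (ω, x)) : Measurable (fibreSup K f B) :=
  Measurable.iInf fun _ => measurable_envelope hK hf _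

theorem le_fibreSup (hf : ∀ ω, Continuous fun x => f (ω, x)) (hB : ∀ p, |f p| ≤ B) {ω : Ω} {x : M}
    (hx : x ∈ fibre K ω) : f (ω, x) ≤ fibreSup K f B ω :=
  le_ciInf fun _ => le_envelope hf hB
    (Metric.self_subset_thickening Nat.one_div_pos_of_nat _ hx)

theorem tendsto_envelope (hB : ∀ p, |f p| ≤ B) (ω : Ω) :
    Tendsto (fun j : ℕ => envelope K f B (1 / ((j : ℝ) + 1)) ω) atTop (𝓝 (fibreSup K f B ω)) := by
  refine tendsto_atTop_ciInf (fun i j hij => ?_) (bddBelow_envelope hB ω)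
  classical
  refine ciSup_mono (bddAbove_envelope hB _ _) fun n => ?_
  have hsub : Metric.thickening (1 / ((j : ℝ) + 1)) (fibre K ω) ⊆
      Metric.thickening (1 / ((i : ℝ) + 1)) (fibre K ω) :=
    Metric.thickening_mono (Nat.one_div_le_one_div hij) _
  split_ifs with h1 h2 h2
  · exact le_rfl
  · exact absurd (hsub h1) h2
  · exact neg_le_of_abs_le (hB _)
  · exact le_rfl

/-- A countable dense set may miss `K(ω)` but not its open neighbourhoods, whence the infimum over
shrinking radii. By compactness, every bound max f + ε already holds on some neighbourhood of the
fibre. -/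
theorem exists_eq_fibreSup (hf : ∀ ω, Continuous fun x => f (ω, x)) (hB : ∀ p, |f p| ≤ B) {ω : Ω}
    (hK : IsCompact (fibre K ω)) (hne : (fibre K ω).Nonempty) :
    ∃ x ∈ fibre K ω, fibreSup K f B ω = f (ω, x) := by
  obtain ⟨x, hx, hmax⟩ := hK.exists_isMaxOn hne (hf ω).continuousOn
  refine ⟨x, hx, le_antisymm (le_of_forall_pos_le_add fun ε hε => ?_) (le_fibreSup hf hB hx)⟩
  obtain ⟨δ, hδ, hsub⟩ := hK.exists_thickening_subset_open
    (isOpen_lt (hf ω) (continuous_const (y := f (ω, x) + ε)))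
    (fun y hy => (show f (ω, y) ≤ f (ω, x) from hmax hy).trans_lt (lt_add_of_pos_right _ hε))
  obtain ⟨j, hj⟩ := exists_nat_one_div_lt hδ
  refine (ciInf_le (bddBelow_envelope hB ω) j).trans (envelope_le ?_ fun y hy => ?_)
  · linarith [neg_le_of_abs_le (hB (ω, x))]
  · exact (hsub (Metric.thickening_mono hj.le _ hy)).le

end Envelope

/-! ### Ergodic dichotomies and random minimality of the inverse. -/

section Minimality

variable {Ω : Type*} [MeasurableSpace Ω] {P : Measure Ω} [IsProbabilityMeasure P] {θ : Ω → Ω}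

omit [IsProbabilityMeasure P] in
theorem ae_forall_iterate (hθ : MeasurePreserving θ P P) {p : Ω → Prop} (h : ∀ᵐ ω ∂P, p ω) :
    ∀ᵐ ω ∂P, ∀ j : ℕ, p (θ^[j] ω) :=
  ae_all_iff.2 fun j => (hθ.iterate j).quasiMeasurePreserving.ae h

theorem ae_mem_or_ae_notMem_of_ae_imp (hθ : Ergodic θ P) {A : Set Ω} (hA : MeasurableSet A)
    (h : ∀ᵐ ω ∂P, θ ω ∈ A → ω ∈ A) : (∀ᵐ ω ∂P, ω ∈ A) ∨ (∀ᵐ ω ∂P, ω ∉ A) := by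
  rcases hθ.ae_empty_or_univ_of_preimage_ae_le hA.nullMeasurableSet h with h | h
  · right
    filter_upwards [h] with ω hω hA
    exact hω.mp hA
  · left
    filter_upwards [h] with ω hω
    exact hω.mpr trivial

/-- Random minimality passes to the inverse: a random closed set with
`C(θ ω) ⊆ g_ω(C(ω))` has almost surely full, or almost surely empty fibres. -/
theorem IsRandomMinimal.ae_eq_univ_or_empty {Ξ : Type*} [MetricSpace Ξ] [CompactSpace Ξ]
    [MeasurableSpace Ξ] [BorelSpace Ξ] [Nonempty Ξ] {g : Ω → Ξ → Ξ} (hθ : Ergodic θ P)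
    (hg : IsRandomHomeomorph g) (hmin : IsRandomMinimal P θ g) {C : Set (Ω × Ξ)}
    (hC : IsRandomClosed C) (hback : ∀ᵐ ω ∂P, fibre C (θ ω) ⊆ g ω '' fibre C ω) :
    (∀ᵐ ω ∂P, fibre C ω = univ) ∨ (∀ᵐ ω ∂P, fibre C ω = ∅) := by
  have hne : (∀ᵐ ω ∂P, ω ∈ {ω | (fibre C ω).Nonempty}) ∨
      (∀ᵐ ω ∂P, ω ∉ {ω | (fibre C ω).Nonempty}) := by
    refine ae_mem_or_ae_notMem_of_ae_imp hθ (measurableSet_fibre_nonempty hC.measurable) ?_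
    filter_upwards [hback] with ω hω hne
    exact (hne.mono hω).of_image
  rcases hne with hne | hne
  swap
  · right
    filter_upwards [hne] with ω hω
    exact not_nonempty_iff_eq_empty.1 hω
  left
  -- The points whose whole forward orbit stays in `C` form a forward invariant set, to which random
  -- minimality applies.
  set D : Set (Ω × Ξ) := {p | ∀ j, (skewProduct θ g)^[j] p ∈ C} with hD
  have hDfib : ∀ ω, fibre D ω =
      ⋂ j, (fun x => ((skewProduct θ g)^[j] (ω, x)).2) ⁻¹' fibre C (θ^[j] ω) := by
    intro ω
    ext x
    simp only [fibre, hD, mem_ofPred_eq, mem_iInter, mem_preimage]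
    refine forall_congr' fun j => ?_
    rw [← skewProduct_iterate_fst (F := g) j (ω, x)]
  have hclosed : ∀ ω j, IsClosed
      ((fun x => ((skewProduct θ g)^[j] (ω, x)).2) ⁻¹' fibre C (θ^[j] ω)) := fun ω j =>
    (hC.isClosed _).preimage (continuous_skewProduct_iterate_snd hg.continuous j ω)
  -- A Carathéodory function whose zero set is `D`; it makes the fibres of `D` accessible to
  -- `measurableSet_exists_tuple`.
  set v : Ω × Ξ → ℝ := fun p => ∑' j : ℕ, (1 / 2 : ℝ) ^ j * cutDist C ((skewProduct θ g)^[j] p)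
    with hv
  have hcut : ∀ j : ℕ, IsCaratheodory fun p =>
      (1 / 2 : ℝ) ^ j * cutDist C ((skewProduct θ g)^[j] p) := fun j => by
    have := hC.isCaratheodory_cutDist.comp_iterate hθ.measurable hg.toIsRandomMap j
    exact ⟨this.measurable.const_mul _, fun ω => (this.continuous ω).const_mul _⟩
  have hbound : ∀ (j : ℕ) (p : Ω × Ξ),
      ‖(1 / 2 : ℝ) ^ j * cutDist C ((skewProduct θ g)^[j] p)‖ ≤ (1 / 2 : ℝ) ^ j := fun j p => by
    rw [Real.norm_of_nonneg (mul_nonneg (by positivity) (cutDist_nonneg _ _))]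
    exact mul_le_of_le_one_right (by positivity) (cutDist_le_one _ _)
  have hsum : ∀ p : Ω × Ξ,
      Summable fun j : ℕ => (1 / 2 : ℝ) ^ j * cutDist C ((skewProduct θ g)^[j] p) := fun p =>
    Summable.of_norm_bounded summable_geometric_two fun j => hbound j p
  have hvc : ∀ ω, Continuous fun x => v (ω, x) := fun ω =>
    continuous_tsum (fun j => (hcut j).continuous ω) summable_geometric_two fun j x => hbound j _
  have hvm : Measurable v := by
    refine measurable_of_tendsto_metrizable
      (f := fun n p => ∑ j ∈ Finset.range n, (1 / 2 : ℝ) ^ j * cutDist C ((skewProduct θ g)^[j] p))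
      (fun n => Finset.measurable_fun_sum _ fun j _ => (hcut j).measurable) ?_
    exact tendsto_pi_nhds.2 fun p => (hsum p).hasSum.tendsto_sum_nat
  have hvD : ∀ p, 0 ≤ -v p ↔ p ∈ D := by
    intro p
    have hnn : ∀ j : ℕ, 0 ≤ (1 / 2 : ℝ) ^ j * cutDist C ((skewProduct θ g)^[j] p) := fun j =>
      mul_nonneg (by positivity) (cutDist_nonneg _ _)
    have h1 : 0 ≤ -v p ↔ v p = 0 :=
      ⟨fun h => le_antisymm (by linarith) (tsum_nonneg hnn), fun h => by rw [h, neg_zero]⟩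
    rw [h1, hv, (hsum p).hasSum_iff.symm, hasSum_zero_iff_of_nonneg hnn, funext_iff]
    refine forall_congr' fun j => ?_
    rw [Pi.zero_apply, mul_eq_zero, or_iff_right (by positivity), cutDist_eq_zero_iff (hC.isClosed _)]
  have hDclosed : IsRandomClosed D := by
    refine .of_measurableSet (fun ω => by rw [hDfib]; exact isClosed_iInter (hclosed ω))
      fun x s => ?_
    convert measurableSet_exists_tuple (isRandomCompact_univ (Ω := Ω) (M := Ξ)) (n := 1)
      (F := fun ω y => min (s - dist x (y 0)) (-v (ω, y 0)))
      (fun ω => ((continuous_const.sub (continuous_const.dist (continuous_apply 0))).min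
        ((hvc ω).comp (continuous_apply 0)).neg))
      (fun y => measurable_const.min (hvm.comp measurable_prodMk_right).neg) using 1
    ext ω
    simp only [mem_ofPred_eq, le_min_iff, sub_nonneg, hvD]
    constructor
    · rintro ⟨y, hy, hxy⟩
      exact ⟨fun _ => y, fun _ => trivial, hxy, hy⟩
    · rintro ⟨y, -, hxy, hy⟩
      exact ⟨y 0, hy, hxy⟩
  have hDinv : IsForwardInvariant P θ g D := by
    refine ae_of_all _ fun ω => ?_
    rintro _ ⟨x, hx, rfl⟩ j
    exact hx (j + 1)
  rcases hmin D hDclosed hDinv with h | h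
  · filter_upwards [h] with ω hω
    refine eq_univ_of_forall fun x => ?_
    have : x ∈ fibre D ω := hω ▸ mem_univ x
    exact this 0
  · exfalso
    have hfalse : ∀ᵐ ω ∂P, False := by
      filter_upwards [h, ae_forall_iterate hθ.toMeasurePreserving hback,
        ae_forall_iterate hθ.toMeasurePreserving hne] with ω hω hb hn
      rw [hDfib] at hω
      -- The preimages of `C(θ^j ω)` decrease in `j` by backward invariance and injectivity, and are
      -- non-empty by surjectivity. Their intersection is the fibre of `D`, which therefore cannot
      -- be empty.
      refine (IsCompact.nonempty_iInter_of_sequence_nonempty_isCompact_isClosed _ (fun j x hx => ?_)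
        (fun j => ?_) (hclosed ω 0).isCompact (hclosed ω)).ne_empty hω
      · simp only [mem_preimage, skewProduct_iterate_succ_snd] at hx ⊢
        rw [Function.iterate_succ_apply'] at hx
        obtain ⟨y, hy, hyx⟩ := hb j hx
        rwa [← (hg.isHomeomorph _).injective hyx]
      · exact (hn j).preimage (bijective_skewProduct_iterate_snd
          (fun ω => (hg.isHomeomorph ω).bijective) j ω).surjective
    exact hfalse.exists.elim fun _ h => h

end Minimality

/-! ### Invariant measures on random compact sets -/

/-- The functional c e ↦ c is non-negative on the multiples of `e` in the cone, and every element of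
`H` enters the cone after adding a multiple of `e`. These are the hypotheses of the M. Riesz
extension theorem. -/
theorem exists_linearMap_nonneg_of_cone {V : Type*} [AddCommGroup V] [Module ℝ V]
    (H : Submodule ℝ V) {e : V} (he : e ∈ H) (S : Set V) (hzero : (0 : V) ∈ S)
    (hadd : ∀ f ∈ S, ∀ g ∈ S, f + g ∈ S) (hsmul : ∀ c : ℝ, 0 ≤ c → ∀ f ∈ S, c • f ∈ S)
    (hneg : ∀ c : ℝ, c • e ∈ S → 0 ≤ c) (hdense : ∀ f ∈ H, ∃ c : ℝ, c • e + f ∈ S) :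
    ∃ L : V →ₗ[ℝ] ℝ, L e = 1 ∧ ∀ f ∈ H, f ∈ S → 0 ≤ L f := by
  let s : PointedCone ℝ H :=
    { carrier := {f | (f : V) ∈ S}
      add_mem' := fun {f g} hf hg => hadd _ hf _ hg
      zero_mem' := hzero
      smul_mem' := fun c f hf => hsmul c c.2 _ hf }
  have hs : ∀ f : H, f ∈ s ↔ (f : V) ∈ S := fun f => Iff.rfl
  have he0 : (⟨e, he⟩ : H) ≠ 0 := by
    intro h
    have h0 : e = 0 := congrArg Subtype.val h
    have := hneg (-1) (by rw [h0, smul_zero]; exact hzero)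
    linarith
  let l : H →ₗ.[ℝ] ℝ := LinearPMap.mkSpanSingleton (⟨e, he⟩ : H) (1 : ℝ) he0
  have hl : ∀ (c : ℝ) (h), l ⟨c • (⟨e, he⟩ : H), h⟩ = c := fun c h => by
    have := LinearPMap.mkSpanSingleton'_apply (σ := RingHom.id ℝ) (⟨e, he⟩ : H) (1 : ℝ)
      (fun c hc => by rw [(smul_eq_zero.1 hc).resolve_right he0]; simp) c h
    exact this.trans (by simp)
  obtain ⟨G, hG, hGs⟩ := riesz_extension s l
    (by
      rintro ⟨x, hx⟩ hxs
      obtain ⟨c, rfl⟩ := Submodule.mem_span_singleton.1 hx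
      rw [hl]
      exact hneg c hxs)
    (by
      rintro ⟨f, hf⟩
      obtain ⟨c, hc⟩ := hdense f hf
      exact ⟨⟨c • (⟨e, he⟩ : H), Submodule.mem_span_singleton.2 ⟨c, rfl⟩⟩, hc⟩)
  obtain ⟨L, hL⟩ := G.exists_extend
  have hLG : ∀ f : H, L f = G f := fun f => by rw [← hL]; rfl
  refine ⟨L, ?_, fun f hf hfS => ?_⟩
  · have h1 := hG ⟨(1 : ℝ) • (⟨e, he⟩ : H), Submodule.mem_span_singleton.2 ⟨1, rfl⟩⟩
    have h2 := h1.trans (hl 1 _)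
    rw [← hLG] at h2
    simpa using h2
  · rw [hLG ⟨f, hf⟩]
    exact hGs _ hfS

/-! ### Bounded Carathéodory functions determine and generate the product structure. -/

section CaratheodoryAlgebra

variable {Ω M : Type*} [MeasurableSpace Ω] [MetricSpace M] [MeasurableSpace M]

/-- The algebra of the bounded Carathéodory functions. -/
def caratheodoryAlgebra (Ω M : Type*) [MeasurableSpace Ω] [MetricSpace M] [MeasurableSpace M] :
    Subalgebra ℝ (Ω × M → ℝ) where
  carrier := {f | IsCaratheodory f ∧ ∃ B, ∀ p, |f p| ≤ B}
  mul_mem' := by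
    rintro f g ⟨hf, A, hA⟩ ⟨hg, B, hB⟩
    refine ⟨⟨hf.measurable.mul hg.measurable, fun ω => (hf.continuous ω).mul (hg.continuous ω)⟩,
      A * B, fun p => ?_⟩
    rw [Pi.mul_apply, abs_mul]
    exact mul_le_mul (hA p) (hB p) (abs_nonneg _) ((abs_nonneg _).trans (hA p))
  add_mem' := by
    rintro f g ⟨hf, A, hA⟩ ⟨hg, B, hB⟩
    exact ⟨⟨hf.measurable.add hg.measurable, fun ω => (hf.continuous ω).add (hg.continuous ω)⟩,
      A + B, fun p => (abs_add_le _ _).trans (add_le_add (hA p) (hB p))⟩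
  algebraMap_mem' := fun c =>
    ⟨⟨measurable_const, fun ω => continuous_const⟩, |c|, fun p => le_rfl⟩

theorem mem_caratheodoryAlgebra {f : Ω × M → ℝ} :
    f ∈ caratheodoryAlgebra Ω M ↔ IsCaratheodory f ∧ ∃ B, ∀ p, |f p| ≤ B := Iff.rfl

theorem indicator_mul_mem_caratheodoryAlgebra {A : Set Ω} (hA : MeasurableSet A) {f : Ω × M → ℝ}
    (hf : f ∈ caratheodoryAlgebra Ω M) :
    (fun p : Ω × M => A.indicator 1 p.1 * f p) ∈ caratheodoryAlgebra Ω M := by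
  refine (caratheodoryAlgebra Ω M).mul_mem (x := fun p : Ω × M => A.indicator (1 : Ω → ℝ) p.1)
    ⟨⟨(measurable_one.indicator hA).comp measurable_fst, fun ω => continuous_const (y := A.indicator (1 : Ω → ℝ) ω)⟩, 1,
      fun p => ?_⟩ hf
  by_cases h : p.1 ∈ A <;> simp [h]

theorem indicator_mem_caratheodoryAlgebra {A : Set Ω} (hA : MeasurableSet A) :
    (fun p : Ω × M => A.indicator 1 p.1) ∈ caratheodoryAlgebra Ω M := by
  simpa using indicator_mul_mem_caratheodoryAlgebra hA (caratheodoryAlgebra Ω M).one_mem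

variable [BorelSpace M]

/-- For measurable `A`, the finite Borel measure t ↦ μ(A × t) is determined by bounded continuous
functions, and the product of such a function with the indicator of `A` is a Carathéodory function.
-/
theorem ext_of_integral_caratheodory {μ ν : Measure (Ω × M)} [IsProbabilityMeasure μ]
    [IsProbabilityMeasure ν]
    (h : ∀ f ∈ caratheodoryAlgebra Ω M, ∫ p, f p ∂μ = ∫ p, f p ∂ν) : μ = ν := by
  refine Measure.ext_prod fun {A t} hA ht => ?_
  have key : (μ.restrict (A ×ˢ univ)).map Prod.snd = (ν.restrict (A ×ˢ univ)).map Prod.snd := by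
    refine ext_of_forall_integral_eq_of_IsFiniteMeasure fun f => ?_
    have hi : ∀ ρ : Measure (Ω × M), ∫ x, f x ∂(ρ.restrict (A ×ˢ univ)).map Prod.snd =
        ∫ p, A.indicator 1 p.1 * f p.2 ∂ρ := by
      intro ρ
      rw [integral_map measurable_snd.aemeasurable f.continuous.measurable.aestronglyMeasurable,
        ← integral_indicator (hA.prod MeasurableSet.univ)]
      refine integral_congr_ae (ae_of_all _ fun p => ?_)
      by_cases hp : p.1 ∈ A
      · simp [indicator_of_mem, hp]
      · simp [indicator_of_notMem, hp]
    rw [hi, hi]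
    refine h _ (indicator_mul_mem_caratheodoryAlgebra hA (f := fun p => f p.2) ?_)
    exact ⟨⟨f.continuous.measurable.comp measurable_snd, fun _ => f.continuous⟩, ‖f‖,
      fun p => f.norm_coe_le_norm _⟩
  have := congrArg (fun ρ : Measure M => ρ t) key
  simp only [Measure.map_apply measurable_snd ht,
    Measure.restrict_apply (measurable_snd ht)] at this
  have hset : Prod.snd ⁻¹' t ∩ A ×ˢ univ = A ×ˢ t := by
    ext p
    simp [and_comm]
  rwa [hset] at this

/-- For open U, the indicator of A times the cut-off distance to the complement of U is positive
exactly on A × U. -/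
theorem generateFrom_caratheodoryAlgebra [SecondCountableTopology M] :
    ∃ 𝒢 : Set (Set (Ω × M)), Prod.instMeasurableSpace = MeasurableSpace.generateFrom 𝒢 ∧
      ∀ G ∈ 𝒢, ∃ f ∈ caratheodoryAlgebra Ω M, 0 ≤ f ∧ G = {x | 0 < f x} := by
  refine ⟨image2 (· ×ˢ ·) {s : Set Ω | MeasurableSet s} {t : Set M | IsOpen t},
    (generateFrom_eq_prod MeasurableSpace.generateFrom_measurableSet BorelSpace.measurable_eq.symm
      isCountablySpanning_measurableSet
      ⟨fun _ => univ, fun _ => isOpen_univ, iUnion_const _⟩).symm, ?_⟩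
  rintro _ ⟨A, hA, U, hU, rfl⟩
  have hC : IsRandomClosed (univ ×ˢ Uᶜ : Set (Ω × M)) := by
    have : ∀ ω : Ω, fibre (univ ×ˢ Uᶜ : Set (Ω × M)) ω = Uᶜ := fun ω => by ext; simp [fibre]
    refine ⟨fun ω => by rw [this]; exact hU.isClosed_compl, fun x => ?_⟩
    simp only [this]
    exact measurable_const
  refine ⟨_, indicator_mul_mem_caratheodoryAlgebra hA (f := cutDist (univ ×ˢ Uᶜ))
    ⟨hC.isCaratheodory_cutDist, 1, fun p => ?_⟩, fun p => ?_, ?_⟩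
  · rw [abs_of_nonneg (cutDist_nonneg _ _)]
    exact cutDist_le_one _ _
  · exact mul_nonneg (indicator_nonneg (fun _ _ => zero_le_one) _) (cutDist_nonneg _ _)
  · ext p
    have h0 := cutDist_eq_zero_iff (p := p) (hC.isClosed p.1)
    have hp : 0 < cutDist (univ ×ˢ Uᶜ) p ↔ p.2 ∈ U := by
      rw [lt_iff_le_and_ne, and_iff_right (cutDist_nonneg _ _), ne_comm, Ne, h0]
      simp
    by_cases h : p.1 ∈ A
    · simp [h, hp]
    · simp [h]

end CaratheodoryAlgebra

/-- Averages of a subadditive sequence along an orbit, where `a n j` is the value of the `n`-th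
member at time `j`. -/
theorem mul_le_sum_of_subadditive {a : ℕ → ℕ → ℝ} {C b : ℝ} (hC : 0 ≤ C) {m : ℕ}
    (hsub : ∀ n k j, a (n + k) j ≤ a n j + a k (j + n)) (hle : ∀ n j, a n j ≤ n * C)
    (hb : ∀ j, -b ≤ a m j) {n : ℕ} (hn : m ≤ n) :
    m * a n 0 - m * (2 * m * C + b) ≤ ∑ j ∈ Finset.range n, a m j := by
  obtain ⟨n', rfl⟩ := Nat.exists_eq_add_of_le' hn
  -- `e j` is the value at time `j` over the remaining stretch of the orbit, up to the fixed end
  -- time. Subadditivity bounds e j - e (j + m) by `a m j`, and the sum of these differences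
  -- telescopes to two blocks of length `m`.
  set e : ℕ → ℝ := fun j => a (n' + m - j) j with he
  have hstep : ∀ j ∈ Finset.range n', e j - e (j + m) ≤ a m j := by
    intro j hj
    have hj' := Finset.mem_range.1 hj
    have := hsub m (n' + m - (j + m)) j
    rw [show m + (n' + m - (j + m)) = n' + m - j by omega] at this
    simp only [he]
    linarith
  have h1 : ∑ j ∈ Finset.range n', (e j - e (j + m)) =
      ∑ j ∈ Finset.range m, e j - ∑ j ∈ Finset.range m, e (n' + j) := by
    have h2 := Finset.sum_range_add e n' m
    have h3 := Finset.sum_range_add e m n'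
    rw [add_comm n' m] at h2
    rw [Finset.sum_sub_distrib]
    simp only [add_comm _ m]
    linarith
  have h4 : ∑ _j ∈ Finset.range m, (a (n' + m) 0 - m * C) ≤ ∑ j ∈ Finset.range m, e j := by
    refine Finset.sum_le_sum fun j hj => ?_
    have hj' := Finset.mem_range.1 hj
    have := hsub j (n' + m - j) 0
    rw [show j + (n' + m - j) = n' + m by omega, zero_add] at this
    have h5 : (j : ℝ) * C ≤ m * C := by gcongr
    linarith [hle j 0]
  have h5 : ∑ j ∈ Finset.range m, e (n' + j) ≤ ∑ _j ∈ Finset.range m, (m * C) := by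
    refine Finset.sum_le_sum fun j hj => (hle _ _).trans ?_
    gcongr
    omega
  have h6 : ∑ _j ∈ Finset.range m, (-b) ≤ ∑ j ∈ Finset.range m, a m (n' + j) :=
    Finset.sum_le_sum fun j _ => hb _
  have h7 := Finset.sum_le_sum hstep
  rw [Finset.sum_range_add (fun j => a m j)]
  simp only [Finset.sum_const, Finset.card_range, nsmul_eq_mul] at h4 h5 h6
  linarith

/-! ### The cone of Birkhoff sums and the resulting invariant measure. -/

section InvariantMeasure

variable {Ω M : Type*} {θ : Ω → Ω} {F : Ω → M → M}
  {K : Set (Ω × M)} {φ : ℕ → ℕ → Ω × M → ℝ}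

theorem iterate_eq_mk (j : ℕ) (ω : Ω) (x : M) :
    (skewProduct θ F)^[j] (ω, x) = (θ^[j] ω, ((skewProduct θ F)^[j] (ω, x)).2) :=
  Prod.ext (skewProduct_iterate_fst j _) rfl

variable [MeasurableSpace Ω] {P : Measure Ω}

/-- The functions with asymptotically non-negative Birkhoff sums on `K`, up to Birkhoff sums
of functions on the base with non-negative mean and up to multiples of the sequences
`n ↦ φ n R`. -/
def birkhoffCone (P : Measure Ω) (θ : Ω → Ω) (F : Ω → M → M) (K : Set (Ω × M))
    (φ : ℕ → ℕ → Ω × M → ℝ) : Set (Ω × M → ℝ) :=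
  {f | ∃ a : ℝ, 0 ≤ a ∧ ∃ (R : ℕ) (B : ℝ) (u : Ω → ℝ), Measurable u ∧ Integrable u P ∧
    0 ≤ ∫ ω, u ω ∂P ∧ ∀ᶠ n in atTop, ∀ᵐ ω ∂P, ∀ x ∈ fibre K ω,
      birkhoffSum θ u n ω + a * φ n R (ω, x) - B ≤ birkhoffSum (skewProduct θ F) f n (ω, x)}

theorem ae_iterate_mem (hθ : MeasurePreserving θ P P) (hK : IsForwardInvariant P θ F K) :
    ∀ᵐ ω ∂P, ∀ x ∈ fibre K ω, ∀ j, ((skewProduct θ F)^[j] (ω, x)).2 ∈ fibre K (θ^[j] ω) := by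
  filter_upwards [ae_forall_iterate hθ hK] with ω hω x hx j
  induction j with
  | zero => exact hx
  | succ j ih =>
    rw [skewProduct_iterate_succ_snd, Function.iterate_succ_apply']
    exact hω j ⟨_, ih, rfl⟩

theorem mem_birkhoffCone_of_le (hθ : MeasurePreserving θ P P) (hK : IsForwardInvariant P θ F K)
    {f : Ω × M → ℝ} {u : Ω → ℝ} (hu : Measurable u) (hui : Integrable u P)
    (hu0 : 0 ≤ ∫ ω, u ω ∂P) (hf : ∀ᵐ ω ∂P, ∀ x ∈ fibre K ω, u ω ≤ f (ω, x)) :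
    f ∈ birkhoffCone P θ F K φ := by
  refine ⟨0, le_rfl, 0, 0, u, hu, hui, hu0, Eventually.of_forall fun n => ?_⟩
  filter_upwards [ae_forall_iterate hθ hf, ae_iterate_mem hθ hK] with ω hω hmem x hx
  rw [zero_mul, add_zero, sub_zero]
  refine Finset.sum_le_sum fun j _ => ?_
  rw [iterate_eq_mk]
  exact hω j _ (hmem x hx j)

theorem mem_birkhoffCone_of_nonneg [IsFiniteMeasure P] (hθ : MeasurePreserving θ P P)
    (hK : IsForwardInvariant P θ F K) {f : Ω × M → ℝ} (hf : ∀ p ∈ K, 0 ≤ f p) :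
    f ∈ birkhoffCone P θ F K φ :=
  mem_birkhoffCone_of_le hθ hK (u := fun _ => 0) measurable_const (integrable_const _) (by simp)
    (ae_of_all _ fun ω x hx => hf (ω, x) hx)

/-- Birkhoff sums of coboundaries telescope to bounded functions. Applied to `f` and `-f`, this
forces a functional non-negative on the cone to be invariant. -/
theorem comp_sub_mem_birkhoffCone {f : Ω × M → ℝ} {B : ℝ} (hf : ∀ p, |f p| ≤ B) :
    (fun p => f (skewProduct θ F p) - f p) ∈ birkhoffCone P θ F K φ := by
  refine ⟨0, le_rfl, 0, 2 * B, fun _ => 0, measurable_const, integrable_zero _ _ _, by simp,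
    Eventually.of_forall fun n => ae_of_all _ fun ω x _ => ?_⟩
  have h1 : birkhoffSum (skewProduct θ F) (fun p => f (skewProduct θ F p) - f p) n (ω, x) =
      f ((skewProduct θ F)^[n] (ω, x)) - f (ω, x) := by
    have := Finset.sum_range_sub (fun j => f ((skewProduct θ F)^[j] (ω, x))) n
    simp only [Function.iterate_succ_apply'] at this
    exact this
  have h2 : birkhoffSum θ (fun _ => (0 : ℝ)) n ω = 0 := by simp [birkhoffSum]
  rw [h1, h2]
  linarith [neg_le_of_abs_le (hf ((skewProduct θ F)^[n] (ω, x))), le_of_abs_le (hf (ω, x))]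

/-- Passing to the larger of the two truncation levels only decreases the lower bounds, because `φ
n` is antitone. -/
theorem add_mem_birkhoffCone (hφ : ∀ n, Antitone (φ n)) {f g : Ω × M → ℝ}
    (hf : f ∈ birkhoffCone P θ F K φ) (hg : g ∈ birkhoffCone P θ F K φ) :
    f + g ∈ birkhoffCone P θ F K φ := by
  obtain ⟨a, ha, R, B, u, hu, hui, hu0, h⟩ := hf
  obtain ⟨a', ha', R', B', u', hu', hui', hu0', h'⟩ := hg
  refine ⟨a + a', add_nonneg ha ha', max R R', B + B', u + u', hu.add hu', hui.add hui', ?_, ?_⟩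
  · simp only [Pi.add_apply]
    rw [integral_add hui hui']
    exact add_nonneg hu0 hu0'
  · filter_upwards [h, h'] with n hn hn'
    filter_upwards [hn, hn'] with ω hω hω' x hx
    rw [birkhoffSum_add', birkhoffSum_add']
    have h1 := hω x hx
    have h2 := hω' x hx
    have h3 := mul_le_mul_of_nonneg_left (hφ n (le_max_left R R') (ω, x)) ha
    have h4 := mul_le_mul_of_nonneg_left (hφ n (le_max_right R R') (ω, x)) ha'
    linarith

theorem smul_mem_birkhoffCone {c : ℝ} (hc : 0 ≤ c) {f : Ω × M → ℝ}
    (hf : f ∈ birkhoffCone P θ F K φ) : c • f ∈ birkhoffCone P θ F K φ := by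
  obtain ⟨a, ha, R, B, u, hu, hui, hu0, h⟩ := hf
  refine ⟨c * a, mul_nonneg hc ha, R, c * B, fun ω => c * u ω, hu.const_mul c, hui.const_mul c,
    ?_, ?_⟩
  · rw [integral_const_mul]
    exact mul_nonneg hc hu0
  · filter_upwards [h] with n hn
    filter_upwards [hn] with ω hω x hx
    have h1 : birkhoffSum θ (fun ω => c * u ω) n ω = c * birkhoffSum θ u n ω := by
      simp [birkhoffSum, Finset.mul_sum]
    have h2 : birkhoffSum (skewProduct θ F) (c • f) n (ω, x) =
        c * birkhoffSum (skewProduct θ F) f n (ω, x) := by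
      simp [birkhoffSum, Finset.mul_sum]
    rw [h1, h2]
    have := mul_le_mul_of_nonneg_left (hω x hx) hc
    linarith

/-- The Birkhoff sum of `φ m R` over n steps is at least m times `φ n R`, up to a constant
independent of n. This is what the term `a * φ n R` in the cone is for. -/
theorem mem_birkhoffCone_of_subadditive [IsFiniteMeasure P] (hθ : MeasurePreserving θ P P)
    (hK : IsForwardInvariant P θ F K)
    (hsub : ∀ᵐ ω ∂P, ∀ R, ∀ x ∈ fibre K ω, ∀ n m,
      φ (n + m) R (ω, x) ≤ φ n R (ω, x) + φ m R ((skewProduct θ F)^[n] (ω, x)))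
    {C : ℝ} (hC : 0 ≤ C) (hφC : ∀ n R p, φ n R p ≤ n * C) {b : ℝ} {m R : ℕ}
    (hb : ∀ p, |φ m R p| ≤ b) : φ m R ∈ birkhoffCone P θ F K φ := by
  refine ⟨m, m.cast_nonneg, R, m * (2 * m * C + b), fun _ => 0, measurable_const,
    integrable_const _, by simp, ?_⟩
  filter_upwards [eventually_ge_atTop m] with n hn
  filter_upwards [ae_forall_iterate hθ hsub, ae_iterate_mem hθ hK] with ω hω hmem x hx
  have h2 : birkhoffSum θ (fun _ => (0 : ℝ)) n ω = 0 := by simp [birkhoffSum]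
  rw [h2, zero_add]
  refine mul_le_sum_of_subadditive (a := fun n j => φ n R ((skewProduct θ F)^[j] (ω, x))) hC
    (fun n k j => ?_) (fun n j => hφC _ _ _) (fun j => neg_le_of_abs_le (hb _)) hn
  have := hω j R _ (hmem x hx j) n k
  rw [← iterate_eq_mk, ← Function.iterate_add_apply] at this
  rwa [add_comm j n]

variable [MetricSpace M] [MeasurableSpace M] [SecondCountableTopology M] [Nonempty M]
  [IsProbabilityMeasure P]

/-- Evaluating the defining inequality at a point where `φ n R` attains its maximum on `K(ω)` and
integrating bounds n c from below by a constant for all large n. -/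
theorem nonneg_of_const_mem_birkhoffCone (hθ : MeasurePreserving θ P P)
    (hK : IsRandomCompact K) (hne : ∀ᵐ ω ∂P, (fibre K ω).Nonempty)
    (hφ : ∀ n R, IsCaratheodory (φ n R)) {B : ℕ → ℕ → ℝ} (hB : ∀ n R p, |φ n R p| ≤ B n R)
    (hnonneg : ∀ n R, 0 ≤ ∫ ω, fibreSup K (φ n R) (B n R) ω ∂P) {c : ℝ}
    (hc : (fun _ => c) ∈ birkhoffCone P θ F K φ) : 0 ≤ c := by
  obtain ⟨a, ha, R, b, u, hu, hui, hu0, h⟩ := hc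
  have hev : ∀ᶠ n : ℕ in atTop, -b ≤ n * c := by
    filter_upwards [h] with n hn
    have hsupi : Integrable (fibreSup K (φ n R) (B n R)) P :=
      Integrable.of_bound (measurable_fibreSup hK.measurable
        (hφ n R).measurable_left).aestronglyMeasurable (B n R)
        (ae_of_all _ fun ω => abs_fibreSup_le (hB n R) ω)
    have hbi : ∀ j, Integrable (fun ω => u (θ^[j] ω)) P := fun j =>
      (hθ.iterate j).integrable_comp_of_integrable hui
    have hSi : Integrable (birkhoffSum θ u n) P := by
      unfold birkhoffSum
      exact integrable_finsetSum _ fun j _ => hbi j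
    have hSu : ∫ ω, birkhoffSum θ u n ω ∂P = n * ∫ ω, u ω ∂P := by
      unfold birkhoffSum
      rw [integral_finsetSum _ fun j _ => hbi j]
      simp [integral_comp_of_measurePreserving (hθ.iterate _) hu]
    have hle : ∀ᵐ ω ∂P, birkhoffSum θ u n ω + a * fibreSup K (φ n R) (B n R) ω ≤ n * c + b := by
      filter_upwards [hn, hne] with ω hω hneω
      obtain ⟨x, hx, hxe⟩ := exists_eq_fibreSup (hφ n R).continuous (hB n R) (hK.isCompact ω) hneω
      have := hω x hx
      have h3 : birkhoffSum (skewProduct θ F) (fun _ => c) n (ω, x) = n * c := by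
        simp [birkhoffSum]
      rw [h3] at this
      rw [hxe]
      linarith
    have := integral_mono_ae (hSi.add (hsupi.const_mul a)) (integrable_const _) hle
    simp only [Pi.add_apply] at this
    rw [integral_add hSi (hsupi.const_mul a), hSu, integral_const_mul] at this
    simp at this
    have h4 := mul_nonneg ha (hnonneg n R)
    have h5 := mul_nonneg (n.cast_nonneg (α := ℝ)) hu0
    linarith
  by_contra! hneg
  have hlim : Tendsto (fun n : ℕ => (n : ℝ) * c) atTop atBot :=
    tendsto_natCast_atTop_atTop.atTop_mul_const_of_neg hneg
  obtain ⟨n, h1, h2⟩ := (hev.and (hlim.eventually_lt_atBot (-b))).exists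
  linarith

variable [BorelSpace M]

/-- If the functions `φ n R` are subadditive in `n` and the suprema over the fibres of `K` have
non-negative means, then all `φ n R` have non-negative integrals with respect to a common
invariant measure supported on `K`. -/
theorem exists_invariantMeasure_integral_nonneg (hθ : MeasurePreserving θ P P)
    (hF : IsRandomMap F) (hK : IsRandomCompact K) (hKF : IsForwardInvariant P θ F K)
    (hne : ∀ᵐ ω ∂P, (fibre K ω).Nonempty)
    (hφ : ∀ n R, IsCaratheodory (φ n R)) {B : ℕ → ℕ → ℝ} (hB : ∀ n R p, |φ n R p| ≤ B n R)
    (hanti : ∀ n, Antitone (φ n))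
    (hsub : ∀ᵐ ω ∂P, ∀ R, ∀ x ∈ fibre K ω, ∀ n m,
      φ (n + m) R (ω, x) ≤ φ n R (ω, x) + φ m R ((skewProduct θ F)^[n] (ω, x)))
    {C : ℝ} (hC : 0 ≤ C) (hφC : ∀ n R p, φ n R p ≤ n * C)
    (hnonneg : ∀ n R, 0 ≤ ∫ ω, fibreSup K (φ n R) (B n R) ω ∂P) :
    ∃ μ ∈ invariantMeasures P θ F K, ∀ n R, 0 ≤ ∫ p, φ n R p ∂μ := by
  set H := caratheodoryAlgebra Ω M
  obtain ⟨L, hL1, hL⟩ := exists_linearMap_nonneg_of_cone (Subalgebra.toSubmodule H)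
    (e := (1 : Ω × M → ℝ)) H.one_mem (birkhoffCone P θ F K φ)
    (mem_birkhoffCone_of_nonneg hθ hKF fun p _ => le_rfl)
    (fun f hf g hg => add_mem_birkhoffCone hanti hf hg)
    (fun c hc f hf => smul_mem_birkhoffCone hc hf)
    (fun c hc => nonneg_of_const_mem_birkhoffCone hθ hK hne hφ hB hnonneg
      (by convert hc using 1; ext; simp))
    (fun f hf => by
      obtain ⟨b, hb⟩ := (mem_caratheodoryAlgebra.1 hf).2
      refine ⟨b, mem_birkhoffCone_of_nonneg hθ hKF fun p _ => ?_⟩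
      have := neg_le_of_abs_le (hb p)
      simp only [Pi.add_apply, Pi.smul_apply, Pi.one_apply, smul_eq_mul, mul_one]
      linarith)
  have hLH : ∀ f ∈ H, f ∈ birkhoffCone P θ F K φ → 0 ≤ L f := fun f hf => hL f hf
  have hLc : ∀ c : ℝ, L (fun _ => c) = c := fun c => by
    have : (fun _ => c : Ω × M → ℝ) = c • (1 : Ω × M → ℝ) := by ext; simp
    rw [this, map_smul, hL1, smul_eq_mul, mul_one]
  -- This upper bound by base functions yields continuity along decreasing sequences, the projection
  -- to `P`, and the support on `K`.
  have hLle : ∀ f ∈ H, ∀ u : Ω → ℝ, Measurable u → Integrable u P →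
      (∀ᵐ ω ∂P, ∀ x ∈ fibre K ω, f (ω, x) ≤ u ω) → L f ≤ ∫ ω, u ω ∂P := by
    intro f hf u hu hui hle
    have := hLH _ (H.sub_mem (const_mem_subalgebra (∫ ω, u ω ∂P)) hf)
      (mem_birkhoffCone_of_le hθ hKF (u := fun ω => ∫ ω, u ω ∂P - u ω)
        (measurable_const.sub hu) ((integrable_const _).sub hui)
        (by rw [integral_sub (integrable_const _) hui]; simp) (by
          filter_upwards [hle] with ω hω x hx
          have := hω x hx
          simp only [Pi.sub_apply]
          linarith))
    rw [map_sub, hLc] at this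
    linarith
  have hcont : ∀ f : ℕ → Ω × M → ℝ, (∀ n, f n ∈ H) → (∀ n, 0 ≤ f n) → Antitone f →
      (∀ p, Tendsto (fun n => f n p) atTop (𝓝 0)) → Tendsto (fun n => L (f n)) atTop (𝓝 0) := by
    intro f hfH hf0 hfa hflim
    obtain ⟨b, hb⟩ := (mem_caratheodoryAlgebra.1 (hfH 0)).2
    have hbn : ∀ n p, |f n p| ≤ b := fun n p => by
      rw [abs_of_nonneg (hf0 n p)]
      exact (hfa (Nat.zero_le n) p).trans (le_of_abs_le (hb p))
    have hcar : ∀ n, IsCaratheodory (f n) := fun n => (mem_caratheodoryAlgebra.1 (hfH n)).1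
    have hm : ∀ n, Measurable (fibreSup K (f n) b) := fun n =>
      measurable_fibreSup hK.measurable (hcar n).measurable_left
    have hlim : Tendsto (fun n => ∫ ω, fibreSup K (f n) b ω ∂P) atTop (𝓝 (∫ _, (0 : ℝ) ∂P)) := by
      refine tendsto_integral_of_dominated_convergence (fun _ => b)
        (fun n => (hm n).aestronglyMeasurable) (integrable_const _)
        (fun n => ae_of_all _ fun ω => abs_fibreSup_le (hbn n) ω) ?_
      filter_upwards [hne] with ω hω
      -- Dini's theorem on the compact fibre makes the fibre suprema tend to 0; dominated
      -- convergence does the rest.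
      have hdini := Antitone.tendstoUniformlyOn_of_forall_tendsto (f := fun _ => (0 : ℝ))
        (hK.isCompact ω) (F := fun n x => f n (ω, x)) (fun n => ((hcar n).continuous ω).continuousOn)
        (fun x _ i j hij => hfa hij _) continuousOn_const fun x _ => hflim (ω, x)
      rw [Metric.tendstoUniformlyOn_iff] at hdini
      rw [Metric.tendsto_atTop']
      intro ε hε
      obtain ⟨N, hN⟩ := eventually_atTop.1 (hdini ε hε)
      refine ⟨N, fun n hn => ?_⟩
      obtain ⟨x, hx, hxe⟩ := exists_eq_fibreSup (hcar n).continuous (hbn n) (hK.isCompact ω) hω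
      rw [hxe, dist_comm]
      exact hN n hn.le x hx
    rw [integral_zero] at hlim
    refine squeeze_zero (fun n => hLH _ (hfH n) (mem_birkhoffCone_of_nonneg hθ hKF
      fun p _ => hf0 n p)) (fun n => hLle _ (hfH n) _ (hm n) ?_ ?_) hlim
    · exact Integrable.of_bound (hm n).aestronglyMeasurable b
        (ae_of_all _ fun ω => abs_fibreSup_le (hbn n) ω)
    · exact ae_of_all _ fun ω x hx => le_fibreSup (hcar n).continuous (hbn n) hx
  obtain ⟨μ, hμ, hμL⟩ := exists_probabilityMeasure_integral_eq (H := H) (L := L)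
    (fun f hf => by
      obtain ⟨hc, b, hb⟩ := mem_caratheodoryAlgebra.1 hf
      refine ⟨⟨hc.measurable.max measurable_const, fun ω => (hc.continuous ω).max continuous_const⟩,
        b, fun p => ?_⟩
      have h0 := (abs_nonneg _).trans (hb p)
      rw [abs_of_nonneg (le_max_right _ _)]
      exact max_le (le_of_abs_le (hb p)) h0)
    (fun f hf => (mem_caratheodoryAlgebra.1 hf).2)
    (fun f hf => (mem_caratheodoryAlgebra.1 hf).1.measurable)
    generateFrom_caratheodoryAlgebra
    (fun f hf h0 => hLH f hf (mem_birkhoffCone_of_nonneg hθ hKF fun p _ => h0 p)) hL1 hcont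
  have hTm : Measurable (skewProduct θ F) := measurable_skewProduct hθ.measurable hF
  have hpres : μ.map (skewProduct θ F) = μ := by
    have : IsProbabilityMeasure (μ.map (skewProduct θ F)) :=
      Measure.isProbabilityMeasure_map hTm.aemeasurable
    refine ext_of_integral_caratheodory fun f hf => ?_
    obtain ⟨hc, b, hb⟩ := mem_caratheodoryAlgebra.1 hf
    have hfT : (fun p => f (skewProduct θ F p)) ∈ H :=
      ⟨hc.comp_iterate hθ.measurable hF 1, b, fun p => hb _⟩
    rw [integral_map hTm.aemeasurable hc.measurable.aestronglyMeasurable, hμL _ hfT, hμL f hf]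
    have h1 := hLH _ (H.sub_mem hfT hf) (comp_sub_mem_birkhoffCone hb)
    have h2 := hLH _ (H.sub_mem (H.neg_mem hfT) (H.neg_mem hf))
      (comp_sub_mem_birkhoffCone (f := -f) (B := b) fun p => by
        rw [Pi.neg_apply, abs_neg]; exact hb p)
    rw [map_sub] at h1
    rw [map_sub, map_neg, map_neg] at h2
    linarith
  refine ⟨μ, ⟨hμ, ⟨hTm, hpres⟩, ?_, ?_⟩, fun n R => ?_⟩
  · ext A hA
    rw [Measure.map_apply measurable_fst hA]
    have h1 := hμL _ (indicator_mem_caratheodoryAlgebra (M := M) hA)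
    have hAm : MeasurableSet (Prod.fst ⁻¹' A : Set (Ω × M)) := measurable_fst hA
    have h2 : ∫ p : Ω × M, A.indicator 1 p.1 ∂μ = μ.real (Prod.fst ⁻¹' A) := by
      rw [← integral_indicator_one hAm]
      rfl
    have hu : Measurable (A.indicator (1 : Ω → ℝ)) := measurable_one.indicator hA
    have hui : Integrable (A.indicator (1 : Ω → ℝ)) P := (integrable_const (1 : ℝ)).indicator hA
    have h3 := hLle _ (indicator_mem_caratheodoryAlgebra (M := M) hA) _ hu hui
      (ae_of_all _ fun ω x _ => le_rfl)
    have h4 := hLle _ (H.neg_mem (indicator_mem_caratheodoryAlgebra (M := M) hA)) _ hu.neg hui.neg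
      (ae_of_all _ fun ω x _ => le_rfl)
    rw [map_neg] at h4
    simp only [Pi.neg_apply] at h4
    rw [integral_neg] at h4
    have h5 : μ.real (Prod.fst ⁻¹' A) = P.real A := by
      rw [← h2, h1, ← integral_indicator_one hA]
      exact le_antisymm h3 (by linarith)
    exact (measureReal_eq_measureReal_iff).1 h5
  · have hcut : cutDist K ∈ H := ⟨hK.isRandomClosed.isCaratheodory_cutDist, 1, fun p => by
      rw [abs_of_nonneg (cutDist_nonneg _ _)]
      exact cutDist_le_one _ _⟩
    have hint : Integrable (cutDist K) μ := by
      obtain ⟨hc, b, hb⟩ := mem_caratheodoryAlgebra.1 hcut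
      exact Integrable.of_bound hc.measurable.aestronglyMeasurable b (ae_of_all _ hb)
    have h0 : ∫ p, cutDist K p ∂μ = 0 := by
      refine le_antisymm ?_ (integral_nonneg (cutDist_nonneg K))
      rw [hμL _ hcut]
      have := hLle _ hcut (fun _ => 0) measurable_const (integrable_const _)
        (ae_of_all _ fun ω x hx => ((cutDist_eq_zero_iff (p := (ω, x))
          (hK.isRandomClosed.isClosed ω)).2 hx).le)
      simpa using this
    filter_upwards [(integral_eq_zero_iff_of_nonneg (cutDist_nonneg K) hint).1 h0] with p hp
    exact (cutDist_eq_zero_iff (hK.isRandomClosed.isClosed p.1)).1 hp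
  · rw [hμL _ ⟨hφ n R, B n R, hB n R⟩]
    exact hLH _ ⟨hφ n R, B n R, hB n R⟩
      (mem_birkhoffCone_of_subadditive hθ hKF hsub hC hφC (hB n R))

end InvariantMeasure

/-! ### The derivative cocycle of a double skew product -/

/-- The operator norm is a continuous function of the images of the basis vectors, and these are
limits of difference quotients. -/
theorem measurable_norm_fderiv {Ω : Type*} [MeasurableSpace Ω] {d : ℕ}
    {f : Ω → EuclideanSpace ℝ (Fin d) → EuclideanSpace ℝ (Fin d)}
    (hd : ∀ ω, Differentiable ℝ (f ω)) (hm : ∀ y, Measurable fun ω => f ω y)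
    (y : EuclideanSpace ℝ (Fin d)) : Measurable fun ω => ‖fderiv ℝ (f ω) y‖ := by
  set b := EuclideanSpace.basisFun (Fin d) ℝ
  set G : (Fin d → EuclideanSpace ℝ (Fin d)) → ℝ := fun v =>
    ‖∑ i, (EuclideanSpace.proj i : EuclideanSpace ℝ (Fin d) →L[ℝ] ℝ).smulRight (v i)‖ with hG
  have hGc : Continuous G := by
    refine continuous_norm.comp (continuous_finsetSum _ fun i _ => ?_)
    exact ((ContinuousLinearMap.smulRightL ℝ (EuclideanSpace ℝ (Fin d))
      (EuclideanSpace ℝ (Fin d)) (EuclideanSpace.proj i)).continuous).comp (continuous_apply i)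
  have heq : ∀ A : EuclideanSpace ℝ (Fin d) →L[ℝ] EuclideanSpace ℝ (Fin d),
      ‖A‖ = G fun i => A (b i) := by
    intro A
    simp only [hG]
    congr 1
    ext x : 1
    conv_lhs => rw [← b.sum_repr x]
    simp [b, map_sum]
  simp only [heq]
  refine hGc.measurable.comp (measurable_pi_lambda _ fun i => ?_)
  refine measurable_of_tendsto_metrizable
    (f := fun (n : ℕ) ω => (n : ℝ) • (f ω (y + (n : ℝ)⁻¹ • b i) - f ω y))
    (fun n => by exact ((hm (y + (n : ℝ)⁻¹ • b i)).sub (hm y)).const_smul (n : ℝ)) (tendsto_pi_nhds.2 fun ω => ?_)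
  refine ((hd ω y).hasFDerivAt).lim (b i) (c := fun n : ℕ => (n : ℝ)) ?_
  simpa using tendsto_natCast_atTop_atTop (R := ℝ)

section Cocycle

variable {Ω Ξ : Type*} {d : ℕ} {θ : Ω → Ω} {g : Ω → Ξ → Ξ}
  {h : Ω → Ξ → EuclideanSpace ℝ (Fin d) → EuclideanSpace ℝ (Fin d)}

theorem doubleSkewProduct_iterate (k : ℕ) (ω : Ω) (ξ : Ξ) (y : EuclideanSpace ℝ (Fin d)) :
    (skewProduct θ (doubleFibreMap g h))^[k] (ω, ξ, y) =
      (θ^[k] ω, ((skewProduct θ g)^[k] (ω, ξ)).2, iterFibre θ g h k ω ξ y) := by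
  refine Prod.ext (skewProduct_iterate_fst k _) (Prod.ext ?_ rfl)
  induction k with
  | zero => rfl
  | succ k ih =>
    simp only [skewProduct_iterate_succ_snd] at ih ⊢
    simp only [doubleFibreMap, ih]

theorem iterFibre_add (n m : ℕ) (ω : Ω) (ξ : Ξ) (y : EuclideanSpace ℝ (Fin d)) :
    iterFibre θ g h (n + m) ω ξ y = iterFibre θ g h m (θ^[n] ω)
      ((skewProduct θ g)^[n] (ω, ξ)).2 (iterFibre θ g h n ω ξ y) := by
  rw [iterFibre, add_comm, Function.iterate_add_apply, doubleSkewProduct_iterate n]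
  rfl

theorem iterFibre_succ (k : ℕ) (ω : Ω) (ξ : Ξ) (y : EuclideanSpace ℝ (Fin d)) :
    iterFibre θ g h (k + 1) ω ξ y =
      h (θ^[k] ω) ((skewProduct θ g)^[k] (ω, ξ)).2 (iterFibre θ g h k ω ξ y) :=
  iterFibre_add k 1 ω ξ y

/-- The derivative `D_y h^k_{ω,ξ}(y)`. -/
noncomputable def fibreDeriv (θ : Ω → Ω) (g : Ω → Ξ → Ξ)
    (h : Ω → Ξ → EuclideanSpace ℝ (Fin d) → EuclideanSpace ℝ (Fin d))
    (k : ℕ) (p : Ω × Ξ × EuclideanSpace ℝ (Fin d)) :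
    EuclideanSpace ℝ (Fin d) →L[ℝ] EuclideanSpace ℝ (Fin d) :=
  fderiv ℝ (iterFibre θ g h k p.1 p.2.1) p.2.2

theorem logDeriv_eq (k : ℕ) (p : Ω × Ξ × EuclideanSpace ℝ (Fin d)) :
    logDeriv θ g h k p = ENNReal.log ‖fibreDeriv θ g h k p‖ₑ := rfl

theorem differentiable_iterFibre (hd : ∀ ω ξ, Differentiable ℝ (h ω ξ)) (k : ℕ) (ω : Ω) (ξ : Ξ) :
    Differentiable ℝ (iterFibre θ g h k ω ξ) := by
  induction k with
  | zero => exact differentiable_id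
  | succ k ih =>
    rw [show iterFibre θ g h (k + 1) ω ξ = _ from funext fun y => iterFibre_succ k ω ξ y]
    exact (hd _ _).comp ih

theorem fibreDeriv_add (hd : ∀ ω ξ, Differentiable ℝ (h ω ξ)) (n m : ℕ)
    (p : Ω × Ξ × EuclideanSpace ℝ (Fin d)) :
    fibreDeriv θ g h (n + m) p =
      (fibreDeriv θ g h m ((skewProduct θ (doubleFibreMap g h))^[n] p)).comp
        (fibreDeriv θ g h n p) := by
  obtain ⟨ω, ξ, y⟩ := p
  rw [doubleSkewProduct_iterate]
  simp only [fibreDeriv]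
  rw [show iterFibre θ g h (n + m) ω ξ = _ from funext fun y => iterFibre_add n m ω ξ y]
  exact fderiv_comp y ((differentiable_iterFibre hd m _ _) _) ((differentiable_iterFibre hd n _ _) y)

theorem norm_fibreDeriv_add_le (hd : ∀ ω ξ, Differentiable ℝ (h ω ξ)) (n m : ℕ)
    (p : Ω × Ξ × EuclideanSpace ℝ (Fin d)) :
    ‖fibreDeriv θ g h (n + m) p‖ ≤ ‖fibreDeriv θ g h n p‖ *
      ‖fibreDeriv θ g h m ((skewProduct θ (doubleFibreMap g h))^[n] p)‖ := by
  rw [fibreDeriv_add hd, mul_comm]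
  exact ContinuousLinearMap.opNorm_comp_le _ _

theorem norm_fibreDeriv_zero_le (p : Ω × Ξ × EuclideanSpace ℝ (Fin d)) :
    ‖fibreDeriv θ g h 0 p‖ ≤ 1 := by
  have : fibreDeriv θ g h 0 p = ContinuousLinearMap.id ℝ _ := fderiv_id
  rw [this]
  exact ContinuousLinearMap.norm_id_le

/-- Along an orbit on which the first derivatives are bounded by `exp C`, the `n`-th derivatives
are bounded by `exp (n * C)`. -/
theorem norm_fibreDeriv_le_exp (hd : ∀ ω ξ, Differentiable ℝ (h ω ξ)) {C : ℝ}
    {p : Ω × Ξ × EuclideanSpace ℝ (Fin d)}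
    (hp : ∀ j, ‖fibreDeriv θ g h 1 ((skewProduct θ (doubleFibreMap g h))^[j] p)‖ ≤ Real.exp C)
    (n : ℕ) : ‖fibreDeriv θ g h n p‖ ≤ Real.exp (n * C) := by
  induction n with
  | zero => simpa using norm_fibreDeriv_zero_le p
  | succ n ih =>
    refine (norm_fibreDeriv_add_le hd n 1 p).trans ?_
    push_cast
    rw [add_mul, one_mul, Real.exp_add]
    exact mul_le_mul ih (hp n) (norm_nonneg _) (Real.exp_nonneg _)

/-- The logarithm of the norm of the derivative, truncated from below at `-n * R`. -/
noncomputable def truncLogDeriv (θ : Ω → Ω) (g : Ω → Ξ → Ξ)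
    (h : Ω → Ξ → EuclideanSpace ℝ (Fin d) → EuclideanSpace ℝ (Fin d))
    (n R : ℕ) (p : Ω × Ξ × EuclideanSpace ℝ (Fin d)) : ℝ :=
  Real.log (max ‖fibreDeriv θ g h n p‖ (Real.exp (-(n * R))))

theorem norm_fibreDeriv_le_exp_truncLogDeriv (n R : ℕ) (p : Ω × Ξ × EuclideanSpace ℝ (Fin d)) :
    ‖fibreDeriv θ g h n p‖ ≤ Real.exp (truncLogDeriv θ g h n R p) := by
  rw [truncLogDeriv, Real.exp_log (lt_max_of_lt_right (Real.exp_pos _))]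
  exact le_max_left _ _

theorem neg_le_truncLogDeriv (n R : ℕ) (p : Ω × Ξ × EuclideanSpace ℝ (Fin d)) :
    -(n * R : ℝ) ≤ truncLogDeriv θ g h n R p := by
  rw [truncLogDeriv, Real.le_log_iff_exp_le (lt_max_of_lt_right (Real.exp_pos _))]
  exact le_max_right _ _

/-- The truncation level -nR is additive in n, so cutting off from below preserves subadditivity. -/
theorem truncLogDeriv_add_le (hd : ∀ ω ξ, Differentiable ℝ (h ω ξ)) (n m R : ℕ)
    (p : Ω × Ξ × EuclideanSpace ℝ (Fin d)) :
    truncLogDeriv θ g h (n + m) R p ≤ truncLogDeriv θ g h n R p +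
      truncLogDeriv θ g h m R ((skewProduct θ (doubleFibreMap g h))^[n] p) := by
  have h1 : ∀ (a : ℝ) (k : ℕ), 0 < max a (Real.exp (-(k * R))) := fun a k =>
    lt_max_of_lt_right (Real.exp_pos _)
  simp only [truncLogDeriv]
  rw [← Real.log_mul (h1 _ n).ne' (h1 _ m).ne']
  refine Real.log_le_log (h1 _ _) (max_le ?_ ?_)
  · exact (norm_fibreDeriv_add_le hd n m p).trans (mul_le_mul (le_max_left _ _) (le_max_left _ _)
      (norm_nonneg _) (h1 _ n).le)
  · have : Real.exp (-(((n + m : ℕ) : ℝ) * R)) = Real.exp (-(n * R)) * Real.exp (-(m * R)) := by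
      rw [← Real.exp_add]
      congr 1
      push_cast
      ring
    rw [this]
    exact mul_le_mul (le_max_right _ _) (le_max_right _ _) (Real.exp_nonneg _) (h1 _ n).le

theorem truncLogDeriv_le {C : ℝ} (hC : 0 ≤ C) {n R : ℕ} {p : Ω × Ξ × EuclideanSpace ℝ (Fin d)}
    (hp : ‖fibreDeriv θ g h n p‖ ≤ Real.exp (n * C)) : truncLogDeriv θ g h n R p ≤ n * C := by
  rw [truncLogDeriv, Real.log_le_iff_le_exp (lt_max_of_lt_right (Real.exp_pos _))]
  refine max_le hp (Real.exp_le_exp.2 ?_)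
  have h1 : (0 : ℝ) ≤ n * R := by positivity
  have h2 : 0 ≤ n * C := by positivity
  linarith

/-- The logarithm of the norm of the derivative, truncated to the interval `[-n * R, n * C]`. -/
noncomputable def clampLogDeriv (θ : Ω → Ω) (g : Ω → Ξ → Ξ)
    (h : Ω → Ξ → EuclideanSpace ℝ (Fin d) → EuclideanSpace ℝ (Fin d)) (C : ℝ)
    (n R : ℕ) (p : Ω × Ξ × EuclideanSpace ℝ (Fin d)) : ℝ :=
  min (truncLogDeriv θ g h n R p) (n * C)

theorem clampLogDeriv_eq {C : ℝ} (hC : 0 ≤ C) {n R : ℕ} {p : Ω × Ξ × EuclideanSpace ℝ (Fin d)}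
    (hp : ‖fibreDeriv θ g h n p‖ ≤ Real.exp (n * C)) :
    clampLogDeriv θ g h C n R p = truncLogDeriv θ g h n R p :=
  min_eq_left (truncLogDeriv_le hC hp)

theorem abs_clampLogDeriv_le {C : ℝ} (hC : 0 ≤ C) (n R : ℕ)
    (p : Ω × Ξ × EuclideanSpace ℝ (Fin d)) :
    |clampLogDeriv θ g h C n R p| ≤ n * (R + C) := by
  have h1 : (0 : ℝ) ≤ n * R := by positivity
  have h2 : 0 ≤ n * C := by positivity
  rw [mul_add]
  refine abs_le.2 ⟨le_min ?_ ?_, (min_le_right _ _).trans (by linarith)⟩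
  · linarith [neg_le_truncLogDeriv (θ := θ) (g := g) (h := h) n R p]
  · linarith

theorem antitone_clampLogDeriv (C : ℝ) (n : ℕ) : Antitone (clampLogDeriv θ g h C n) := by
  intro R R' hR p
  refine min_le_min (Real.log_le_log (lt_max_of_lt_right (Real.exp_pos _))
    (max_le_max le_rfl (Real.exp_le_exp.2 ?_))) le_rfl
  have : (R : ℝ) ≤ R' := by exact_mod_cast hR
  have := mul_le_mul_of_nonneg_left this n.cast_nonneg
  linarith

/-- The upper cut-off only makes the functions globally bounded. Along an orbit with first
derivatives at most exp C it is inactive, and subadditivity of the lower truncation carries over. -/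
theorem clampLogDeriv_add_le (hd : ∀ ω ξ, Differentiable ℝ (h ω ξ)) {C : ℝ} (hC : 0 ≤ C)
    {p : Ω × Ξ × EuclideanSpace ℝ (Fin d)}
    (hp : ∀ j, ‖fibreDeriv θ g h 1 ((skewProduct θ (doubleFibreMap g h))^[j] p)‖ ≤ Real.exp C)
    (n m R : ℕ) :
    clampLogDeriv θ g h C (n + m) R p ≤ clampLogDeriv θ g h C n R p +
      clampLogDeriv θ g h C m R ((skewProduct θ (doubleFibreMap g h))^[n] p) := by
  have hp' : ∀ j, ‖fibreDeriv θ g h 1 ((skewProduct θ (doubleFibreMap g h))^[j]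
      ((skewProduct θ (doubleFibreMap g h))^[n] p))‖ ≤ Real.exp C := fun j => by
    rw [← Function.iterate_add_apply]
    exact hp _
  rw [clampLogDeriv_eq hC (norm_fibreDeriv_le_exp hd hp _),
    clampLogDeriv_eq hC (norm_fibreDeriv_le_exp hd hp _),
    clampLogDeriv_eq hC (norm_fibreDeriv_le_exp hd hp' _)]
  exact truncLogDeriv_add_le hd n m R p

variable [MeasurableSpace Ω] [MetricSpace Ξ] [CompactSpace Ξ] [MeasurableSpace Ξ] [BorelSpace Ξ]

theorem measurable_iterFibre (hθ : Measurable θ) (hT : IsDoubleSkewProduct g h) (k : ℕ) (ξ : Ξ)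
    (y : EuclideanSpace ℝ (Fin d)) : Measurable fun ω => iterFibre θ g h k ω ξ y :=
  measurable_snd.comp (measurable_snd.comp
    (((measurable_skewProduct hθ hT.isRandomMap).iterate k).comp measurable_prodMk_right))

omit [CompactSpace Ξ] [BorelSpace Ξ] in
theorem continuous_fibreDeriv (hT : IsDoubleSkewProduct g h) (k : ℕ) (ω : Ω) :
    Continuous fun x => fibreDeriv θ g h k (ω, x) := by
  induction k with
  | zero =>
    have : (fun x => fibreDeriv θ g h 0 (ω, x)) = fun _ => ContinuousLinearMap.id ℝ _ :=
      funext fun x => fderiv_id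
    rw [this]
    exact continuous_const
  | succ k ih =>
    simp only [fibreDeriv_add hT.differentiable k 1]
    refine Continuous.clm_comp ?_ ih
    have : (fun x => fibreDeriv θ g h 1 ((skewProduct θ (doubleFibreMap g h))^[k] (ω, x))) =
        fun x => fderiv ℝ (h (θ^[k] ω) ((skewProduct θ (doubleFibreMap g h))^[k] (ω, x)).2.1)
          ((skewProduct θ (doubleFibreMap g h))^[k] (ω, x)).2.2 := by
      ext1 x
      rw [← skewProduct_iterate_fst (F := doubleFibreMap g h) k (ω, x)]
      rfl
    rw [this]
    exact (hT.continuous_fderiv _).comp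
      (continuous_skewProduct_iterate_snd hT.isRandomMap.continuous k ω)

theorem isCaratheodory_norm_fibreDeriv (hθ : Measurable θ) (hT : IsDoubleSkewProduct g h) (k : ℕ) :
    IsCaratheodory fun p => ‖fibreDeriv θ g h k p‖ :=
  .mk' (fun ω => (continuous_fibreDeriv hT k ω).norm) fun x =>
    measurable_norm_fderiv (fun ω => differentiable_iterFibre hT.differentiable k ω x.1)
      (fun y => measurable_iterFibre hθ hT k x.1 y) x.2

theorem isCaratheodory_clampLogDeriv (hθ : Measurable θ) (hT : IsDoubleSkewProduct g h) (C : ℝ)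
    (n R : ℕ) : IsCaratheodory (clampLogDeriv θ g h C n R) := by
  have := isCaratheodory_norm_fibreDeriv hθ hT n
  refine ⟨(Real.measurable_log.comp (this.measurable.max measurable_const)).min measurable_const,
    fun ω => (Continuous.log ((this.continuous ω).max continuous_const) fun x =>
      (lt_max_of_lt_right (Real.exp_pos _)).ne').min continuous_const⟩

end Cocycle

/-! ### From truncated integrals to the Lyapunov exponent. -/

section Lyapunov

variable {Ω Ξ : Type*} {d : ℕ} {θ : Ω → Ω} {g : Ω → Ξ → Ξ}
  {h : Ω → Ξ → EuclideanSpace ℝ (Fin d) → EuclideanSpace ℝ (Fin d)}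

theorem toENNReal_logDeriv {n R : ℕ} (p : Ω × Ξ × EuclideanSpace ℝ (Fin d)) :
    (logDeriv θ g h n p).toENNReal = ENNReal.ofReal (truncLogDeriv θ g h n R p) := by
  have h0 : -(n * R : ℝ) ≤ 0 := neg_nonpos.2 (by positivity)
  rw [logDeriv_eq, ← ofReal_norm, truncLogDeriv]
  rcases (norm_nonneg (fibreDeriv θ g h n p)).eq_or_lt with h1 | h1
  · rw [← h1, max_eq_right (Real.exp_nonneg _), Real.log_exp, ENNReal.ofReal_of_nonpos h0]
    simp
  · rw [ENNReal.log_ofReal_of_pos h1, EReal.real_coe_toENNReal]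
    rcases le_total (Real.exp (-(n * R))) ‖fibreDeriv θ g h n p‖ with h2 | h2
    · rw [max_eq_left h2]
    · rw [max_eq_right h2, Real.log_exp, ENNReal.ofReal_of_nonpos h0, ENNReal.ofReal_of_nonpos]
      exact ((Real.log_le_iff_le_exp h1).2 h2).trans h0

/-- The levels -nR exhaust the negative axis as R grows, provided n ≥ 1; this covers the value log 0
= -∞ as well. -/
theorem toENNReal_neg_logDeriv_le {n : ℕ} (hn : 1 ≤ n) (p : Ω × Ξ × EuclideanSpace ℝ (Fin d)) :
    (-logDeriv θ g h n p).toENNReal ≤ ⨆ R : ℕ, ENNReal.ofReal (-truncLogDeriv θ g h n R p) := by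
  have hn' : (1 : ℝ) ≤ n := by exact_mod_cast hn
  rw [logDeriv_eq, ← ofReal_norm]
  rcases (norm_nonneg (fibreDeriv θ g h n p)).eq_or_lt with h1 | h1
  · have h2 : ∀ R : ℕ, truncLogDeriv θ g h n R p = -(n * R) := fun R => by
      rw [truncLogDeriv, ← h1, max_eq_right (Real.exp_nonneg _), Real.log_exp]
    simp only [h2, neg_neg]
    refine le_top.trans (top_le_iff.2 ?_)
    rw [iSup_eq_top]
    intro b hb
    obtain ⟨R, hR⟩ := ENNReal.exists_nat_gt hb.ne
    refine ⟨R, hR.trans_le ?_⟩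
    rw [← ENNReal.ofReal_natCast]
    refine ENNReal.ofReal_le_ofReal ?_
    nlinarith [R.cast_nonneg (α := ℝ)]
  · obtain ⟨R, hR⟩ := exists_nat_ge (-Real.log ‖fibreDeriv θ g h n p‖)
    refine le_trans ?_ (le_iSup _ R)
    rw [ENNReal.log_ofReal_of_pos h1, ← EReal.coe_neg, EReal.real_coe_toENNReal]
    refine ENNReal.ofReal_le_ofReal ?_
    rw [truncLogDeriv, max_eq_left]
    rw [← Real.le_log_iff_exp_le h1]
    nlinarith [R.cast_nonneg (α := ℝ)]

/-- The Lyapunov exponent is non-negative if all truncated integrals are non-negative. -/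
theorem lyapunovExponent_nonneg [MeasurableSpace Ω] [MetricSpace Ξ] [CompactSpace Ξ]
    [MeasurableSpace Ξ] [BorelSpace Ξ] (hθ : Measurable θ) (hT : IsDoubleSkewProduct g h)
    {μ : Measure (Ω × Ξ × EuclideanSpace ℝ (Fin d))} [IsProbabilityMeasure μ] {C : ℝ} (hC : 0 ≤ C)
    (hμ : ∀ n : ℕ, ∀ᵐ p ∂μ, ‖fibreDeriv θ g h n p‖ ≤ Real.exp (n * C))
    (hint : ∀ n R, 0 ≤ ∫ p, clampLogDeriv θ g h C n R p ∂μ) :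
    0 ≤ lyapunovExponent θ g h μ := by
  refine le_iInf₂ fun n hn => EReal.mul_nonneg (EReal.coe_nonneg.2 (by positivity)) ?_
  have hcar := fun R => isCaratheodory_clampLogDeriv hθ hT C n R
  have heq : ∀ R, ∀ᵐ p ∂μ, clampLogDeriv θ g h C n R p = truncLogDeriv θ g h n R p := fun R => by
    filter_upwards [hμ n] with p hp
    exact clampLogDeriv_eq hC hp
  have hi : ∀ R, Integrable (clampLogDeriv θ g h C n R) μ := fun R =>
    Integrable.of_bound (hcar R).measurable.aestronglyMeasurable _
      (ae_of_all _ (abs_clampLogDeriv_le hC n R))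
  -- The positive part does not depend on `R`, since the truncation level is at most 0. It bounds
  -- all truncated negative parts, and monotone convergence in `R` gives the untruncated one.
  have hpos : ∀ R, ∫⁻ p, ENNReal.ofReal (clampLogDeriv θ g h C n R p) ∂μ =
      ∫⁻ p, (logDeriv θ g h n p).toENNReal ∂μ := fun R =>
    lintegral_congr_ae (by
      filter_upwards [heq R] with p hp
      rw [hp, toENNReal_logDeriv])
  have hfin : ∀ f : Ω × Ξ × EuclideanSpace ℝ (Fin d) → ℝ, Integrable f μ →
      ∫⁻ p, ENNReal.ofReal (f p) ∂μ ≠ ⊤ := fun f hf =>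
    (hf.lintegral_lt_top).ne
  have hle : ∀ R, ∫⁻ p, ENNReal.ofReal (-clampLogDeriv θ g h C n R p) ∂μ ≤
      ∫⁻ p, (logDeriv θ g h n p).toENNReal ∂μ := fun R => by
    have h1 := hint n R
    rw [integral_eq_lintegral_pos_part_sub_lintegral_neg_part (hi R), hpos R] at h1
    refine (ENNReal.toReal_le_toReal (hfin _ (hi R).neg) ?_).1 (by simpa using h1)
    rw [← hpos R]
    exact hfin _ (hi R)
  have hneg : ∫⁻ p, (-logDeriv θ g h n p).toENNReal ∂μ ≤
      ∫⁻ p, (logDeriv θ g h n p).toENNReal ∂μ := by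
    calc ∫⁻ p, (-logDeriv θ g h n p).toENNReal ∂μ
        ≤ ∫⁻ p, ⨆ R : ℕ, ENNReal.ofReal (-clampLogDeriv θ g h C n R p) ∂μ := by
          refine lintegral_mono_ae ?_
          filter_upwards [ae_all_iff.2 heq] with p hp
          simp only [hp]
          exact toENNReal_neg_logDeriv_le hn p
      _ = ⨆ R : ℕ, ∫⁻ p, ENNReal.ofReal (-clampLogDeriv θ g h C n R p) ∂μ :=
          lintegral_iSup (fun R => (hcar R).measurable.neg.ennreal_ofReal)
            fun R R' hR p => ENNReal.ofReal_le_ofReal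
              (neg_le_neg (antitone_clampLogDeriv C n hR p))
      _ ≤ _ := iSup_le hle
  have htop : ∫⁻ p, (logDeriv θ g h n p).toENNReal ∂μ ≠ ⊤ := by
    rw [← hpos 0]
    exact hfin _ (hi 0)
  rw [extIntegral, EReal.sub_nonneg]
  · exact EReal.coe_ennreal_le_coe_ennreal_iff.2 hneg
  · left
    simpa using htop
  · left
    exact EReal.coe_ennreal_ne_bot _

end Lyapunov

/-! ### Distances along pairs of orbits -/

section PairDistances

/-- The product of `k + 1` consecutive distances. -/
def windowProd (d : ℕ → ℝ) (k j : ℕ) : ℝ := ∏ i ∈ Finset.range (k + 1), d (j + i)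

variable {d : ℕ → ℝ} {r C : ℝ}

theorem le_exp_mul_of_forall_lt (hstep : ∀ j, d j < r → d (j + 1) ≤ Real.exp C * d j) {j m : ℕ}
    (hr : ∀ i < m, d (j + i) < r) : d (j + m) ≤ Real.exp (m * C) * d j := by
  induction m with
  | zero => simp
  | succ m ih =>
    have h1 := ih fun i hi => hr i (hi.trans m.lt_succ_self)
    have h2 := hstep (j + m) (hr m m.lt_succ_self)
    rw [← add_assoc]
    refine h2.trans ((mul_le_mul_of_nonneg_left h1 (Real.exp_nonneg _)).trans_eq ?_)
    rw [← mul_assoc, ← Real.exp_add]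
    push_cast
    ring_nf

/-- The last distance of the window is at most exp(kC) times each of the k+1 distances in it;
multiply these bounds. Thus a small product controls the last individual distance. -/
theorem pow_le_mul_windowProd (hd : ∀ j, 0 ≤ d j) (hC : 0 ≤ C)
    (hstep : ∀ j, d j < r → d (j + 1) ≤ Real.exp C * d j) {j k : ℕ}
    (hr : ∀ i < k, d (j + i) < r) :
    d (j + k) ^ (k + 1) ≤ Real.exp (k * C) ^ (k + 1) * windowProd d k j := by
  have h1 : ∀ i ∈ Finset.range (k + 1), d (j + k) ≤ Real.exp (k * C) * d (j + i) := by
    intro i hi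
    have hi' : i ≤ k := Nat.lt_succ_iff.1 (Finset.mem_range.1 hi)
    have h2 := le_exp_mul_of_forall_lt hstep (j := j + i) (m := k - i) fun l hl => by
      rw [add_assoc]
      exact hr _ (by omega)
    rw [show j + i + (k - i) = j + k by omega] at h2
    refine h2.trans (mul_le_mul_of_nonneg_right (Real.exp_le_exp.2 ?_) (hd _))
    exact mul_le_mul_of_nonneg_right (by exact_mod_cast Nat.sub_le k i) hC
  have h3 := Finset.prod_le_prod (fun i _ => hd (j + k)) h1
  rw [Finset.prod_const, Finset.card_range, Finset.prod_mul_distrib, Finset.prod_const,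
    Finset.card_range] at h3
  exact h3

/-- Shifting the window by one replaces the factor d j by d (j + k + 1), so a bound over k+1 steps
acts in a single shift. -/
theorem windowProd_succ_le (hd : ∀ j, 0 ≤ d j) {j k : ℕ} {a : ℝ}
    (h : d (j + (k + 1)) ≤ a * d j) : windowProd d k (j + 1) ≤ a * windowProd d k j := by
  have h1 : windowProd d k (j + 1) = (∏ i ∈ Finset.range k, d (j + 1 + i)) * d (j + (k + 1)) := by
    rw [windowProd, Finset.prod_range_succ]
    congr 2
    ring
  have h2 : windowProd d k j = (∏ i ∈ Finset.range k, d (j + 1 + i)) * d j := by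
    rw [windowProd, Finset.prod_range_succ', add_zero]
    congr 1
    refine Finset.prod_congr rfl fun i _ => ?_
    congr 1
    ring
  rw [h1, h2, mul_left_comm]
  exact mul_le_mul_of_nonneg_left h (Finset.prod_nonneg fun i _ => hd _)

/-- Nearness of two orbits at time `j`: `k + 1` consecutive distances are less than `r`, and their
product is less than `b`. -/
def IsNearAt (d : ℕ → ℝ) (k : ℕ) (r b : ℝ) (j : ℕ) : Prop :=
  windowProd d k j < b ∧ ∀ i ≤ k, d (j + i) < r

/-- Only the newly entering distance has to be shown less than r. It is bounded through the
contracted product, and `hb'` is the smallness of the threshold that makes this work. -/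
theorem IsNearAt.succ (hd : ∀ j, 0 ≤ d j) (hC : 0 ≤ C) (hr : 0 ≤ r)
    (hstep : ∀ j, d j < r → d (j + 1) ≤ Real.exp C * d j) {k j : ℕ} {s b b' : ℝ}
    (hk : (∀ i ≤ k, d (j + i) < r) → d (j + (k + 1)) ≤ Real.exp s * d j)
    (hb : Real.exp s * b ≤ b') (hb' : Real.exp (k * C) ^ (k + 1) * b' ≤ r ^ (k + 1))
    (h : IsNearAt d k r b j) :
    IsNearAt d k r b' (j + 1) ∧ windowProd d k (j + 1) ≤ Real.exp s * windowProd d k j := by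
  obtain ⟨h1, h2⟩ := h
  have h3 := windowProd_succ_le hd (hk h2)
  have h4 : windowProd d k (j + 1) < b' :=
    (h3.trans_lt (mul_lt_mul_of_pos_left h1 (Real.exp_pos _))).trans_le hb
  have h5 : ∀ i < k, d (j + 1 + i) < r := fun i hi => by
    rw [add_assoc, add_comm 1 i]
    exact h2 _ hi
  refine ⟨⟨h4, fun i hi => ?_⟩, h3⟩
  rcases hi.lt_or_eq with hi | rfl
  · exact h5 i hi
  · refine lt_of_pow_lt_pow_left₀ (i + 1) hr
      ((pow_le_mul_windowProd hd hC hstep h5).trans_lt (lt_of_lt_of_le ?_ hb'))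
    exact mul_lt_mul_of_pos_left h4 (by positivity)

theorem IsNearAt.forall (hd : ∀ j, 0 ≤ d j) (hC : 0 ≤ C) (hr : 0 ≤ r)
    (hstep : ∀ j, d j < r → d (j + 1) ≤ Real.exp C * d j) {k : ℕ} {s b : ℕ → ℝ}
    (hk : ∀ j, (∀ i ≤ k, d (j + i) < r) → d (j + (k + 1)) ≤ Real.exp (s j) * d j)
    (hb : ∀ j, Real.exp (s j) * b j ≤ b (j + 1))
    (hb' : ∀ j, Real.exp (k * C) ^ (k + 1) * b j ≤ r ^ (k + 1))
    (h : IsNearAt d k r (b 0) 0) (j : ℕ) :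
    IsNearAt d k r (b j) j ∧
      windowProd d k j ≤ Real.exp (∑ i ∈ Finset.range j, s i) * windowProd d k 0 := by
  induction j with
  | zero => exact ⟨h, by simp⟩
  | succ j ih =>
    obtain ⟨h1, h2⟩ := IsNearAt.succ hd hC hr hstep (hk j) (hb j) (hb' (j + 1)) ih.1
    refine ⟨h1, h2.trans ?_⟩
    rw [Finset.sum_range_succ, add_comm, Real.exp_add, mul_assoc]
    exact mul_le_mul_of_nonneg_left ih.2 (Real.exp_nonneg _)

/-- The distances grow at most by exp C per step while below r, so the whole window stays below r;
since r ≤ 1, the remaining factors do not increase the product. -/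
theorem isNearAt_zero_of_lt (hd : ∀ j, 0 ≤ d j) (hC : 0 ≤ C) (hr1 : r ≤ 1)
    (hstep : ∀ j, d j < r → d (j + 1) ≤ Real.exp C * d j) {k : ℕ} {b : ℝ}
    (h : d 0 < Real.exp (-(k * C)) * min r b) : IsNearAt d k r b 0 := by
  have h0 : Real.exp (k * C) * d 0 < min r b := by
    have := mul_lt_mul_of_pos_left h (Real.exp_pos (k * C))
    rwa [← mul_assoc, ← Real.exp_add, add_neg_cancel, Real.exp_zero, one_mul] at this
  have hexp : (1 : ℝ) ≤ Real.exp (k * C) := Real.one_le_exp (by positivity)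
  have h1 : ∀ i, i ≤ k → ∀ l ≤ i, d (0 + l) < r := by
    intro i
    induction i with
    | zero =>
      intro _ l hl
      rw [Nat.le_zero.1 hl, add_zero]
      exact ((le_mul_of_one_le_left (hd 0) hexp).trans_lt h0).trans_le (min_le_left _ _)
    | succ i ih =>
      intro hi l hl
      rcases hl.lt_or_eq with hl | rfl
      · exact ih (by omega) l (by omega)
      · refine (le_exp_mul_of_forall_lt hstep fun l hl => ih (by omega) l (by omega)).trans_lt
          (lt_of_le_of_lt ?_ (h0.trans_le (min_le_left _ _)))
        refine mul_le_mul_of_nonneg_right (Real.exp_le_exp.2 ?_) (hd _)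
        exact mul_le_mul_of_nonneg_right (by exact_mod_cast hi) hC
  refine ⟨?_, h1 k le_rfl⟩
  rw [windowProd, Finset.prod_range_succ']
  have h2 : ∏ i ∈ Finset.range k, d (0 + (i + 1)) ≤ 1 :=
    Finset.prod_le_one (fun i _ => hd _) fun i hi =>
      ((h1 k le_rfl _ (Finset.mem_range.1 hi)).le).trans hr1
  calc (∏ i ∈ Finset.range k, d (0 + (i + 1))) * d (0 + 0) ≤ 1 * d 0 :=
        mul_le_mul_of_nonneg_right h2 (hd 0)
    _ ≤ Real.exp (k * C) * d 0 := mul_le_mul_of_nonneg_right hexp (hd 0)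
    _ < b := h0.trans_le (min_le_right _ _)

end PairDistances

/-! ### Distances between orbits over the same base point. -/

section OrbitDist

variable {Ω Ξ : Type*} {d : ℕ} {θ : Ω → Ω} {g : Ω → Ξ → Ξ}
  {h : Ω → Ξ → EuclideanSpace ℝ (Fin d) → EuclideanSpace ℝ (Fin d)}

/-- The distances of the iterates of two points over the same `(ω, ξ)`. -/
noncomputable def orbitDist (θ : Ω → Ω) (g : Ω → Ξ → Ξ)
    (h : Ω → Ξ → EuclideanSpace ℝ (Fin d) → EuclideanSpace ℝ (Fin d)) (ω : Ω) (ξ : Ξ)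
    (z z' : EuclideanSpace ℝ (Fin d)) (i : ℕ) : ℝ :=
  dist (iterFibre θ g h i ω ξ z) (iterFibre θ g h i ω ξ z')

theorem orbitDist_nonneg (ω : Ω) (ξ : Ξ) (z z' : EuclideanSpace ℝ (Fin d)) (i : ℕ) :
    0 ≤ orbitDist θ g h ω ξ z z' i := dist_nonneg

theorem orbitDist_add (ω : Ω) (ξ : Ξ) (z z' : EuclideanSpace ℝ (Fin d)) (j i : ℕ) :
    orbitDist θ g h ω ξ z z' (j + i) = orbitDist θ g h (θ^[j] ω) ((skewProduct θ g)^[j] (ω, ξ)).2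
      (iterFibre θ g h j ω ξ z) (iterFibre θ g h j ω ξ z') i := by
  rw [orbitDist, orbitDist, iterFibre_add, iterFibre_add]

theorem windowProd_orbitDist (ω : Ω) (ξ : Ξ) (z z' : EuclideanSpace ℝ (Fin d)) (k j : ℕ) :
    windowProd (orbitDist θ g h ω ξ z z') k j =
      windowProd (orbitDist θ g h (θ^[j] ω) ((skewProduct θ g)^[j] (ω, ξ)).2
        (iterFibre θ g h j ω ξ z) (iterFibre θ g h j ω ξ z')) k 0 := by
  simp only [windowProd, orbitDist_add _ _ _ _ j, zero_add]

theorem isNearAt_orbitDist {r b : ℝ} (ω : Ω) (ξ : Ξ) (z z' : EuclideanSpace ℝ (Fin d)) (k j : ℕ) :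
    IsNearAt (orbitDist θ g h ω ξ z z') k r b j ↔
      IsNearAt (orbitDist θ g h (θ^[j] ω) ((skewProduct θ g)^[j] (ω, ξ)).2
        (iterFibre θ g h j ω ξ z) (iterFibre θ g h j ω ξ z')) k r b 0 := by
  simp only [IsNearAt, windowProd_orbitDist _ _ _ _ k j, orbitDist_add _ _ _ _ j, zero_add]

/-- Mean value inequality on the ball around `z`: in the maximum metric the points (ξ, w) with w in
this ball lie in the r-neighbourhood of `K(ω)`, even if only `z` belongs to `K`. -/
theorem dist_iterFibre_le [MetricSpace Ξ] (hd : ∀ ω ξ, Differentiable ℝ (h ω ξ))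
    {K : Set (Ω × Ξ × EuclideanSpace ℝ (Fin d))} {n : ℕ} {ω : Ω} {ξ : Ξ}
    {z z' : EuclideanSpace ℝ (Fin d)} {r A : ℝ} (hz : (ξ, z) ∈ fibre K ω) (hr : dist z z' < r)
    (hA : ∀ x ∈ Metric.thickening r (fibre K ω), ‖fibreDeriv θ g h n (ω, x)‖ ≤ A) :
    dist (iterFibre θ g h n ω ξ z) (iterFibre θ g h n ω ξ z') ≤ A * dist z z' := by
  have hr0 : 0 < r := dist_nonneg.trans_lt hr
  have hz' : z' ∈ Metric.ball z r := by rwa [Metric.mem_ball, dist_comm]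
  have := (convex_ball z r).norm_image_sub_le_of_norm_fderiv_le (𝕜 := ℝ)
    (f := iterFibre θ g h n ω ξ) (C := A)
    (fun w _ => differentiable_iterFibre hd n ω ξ w) (fun w hw => hA (ξ, w) ?_)
    hz' (Metric.mem_ball_self hr0)
  · rwa [← dist_eq_norm, ← dist_eq_norm] at this
  · refine Metric.mem_thickening_iff.2 ⟨(ξ, z), hz, ?_⟩
    rw [Prod.dist_eq, dist_self]
    exact max_lt hr0 hw

end OrbitDist

/-! ### Derivative bounds as contraction bounds. -/

section Contraction

variable {Ω Ξ : Type*} {d : ℕ} {θ : Ω → Ω} {g : Ω → Ξ → Ξ}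
  {h : Ω → Ξ → EuclideanSpace ℝ (Fin d) → EuclideanSpace ℝ (Fin d)}
  [MetricSpace Ξ] {K : Set (Ω × Ξ × EuclideanSpace ℝ (Fin d))} {C r : ℝ}

theorem orbitDist_succ_le (hd : ∀ ω ξ, Differentiable ℝ (h ω ξ))
    (hC : ∀ ω, ∀ x ∈ Metric.thickening r (fibre K ω), ‖fibreDeriv θ g h 1 (ω, x)‖ ≤ Real.exp C)
    {ω : Ω} {ξ : Ξ} {z z' : EuclideanSpace ℝ (Fin d)}
    (hz : ∀ j, ((skewProduct θ (doubleFibreMap g h))^[j] (ω, ξ, z)).2 ∈ fibre K (θ^[j] ω)) (j : ℕ)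
    (hj : orbitDist θ g h ω ξ z z' j < r) :
    orbitDist θ g h ω ξ z z' (j + 1) ≤ Real.exp C * orbitDist θ g h ω ξ z z' j := by
  rw [orbitDist_add]
  have hzj := hz j
  rw [doubleSkewProduct_iterate] at hzj
  exact dist_iterFibre_le hd hzj hj (hC _)

variable [CompactSpace Ξ] [Nonempty Ξ] [MeasurableSpace Ω] [MeasurableSpace Ξ]

/-- On `K`, the fibre maps of the `k`-th iterate contract small distances by the supremum
of the derivative on a neighbourhood. -/
theorem orbitDist_add_le (hT : IsDoubleSkewProduct g h) (hC0 : 0 ≤ C)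
    (hC : ∀ ω, ∀ x ∈ Metric.thickening r (fibre K ω), ‖fibreDeriv θ g h 1 (ω, x)‖ ≤ Real.exp C)
    {k R : ℕ} (hcont : ∀ ω, Continuous fun x => clampLogDeriv θ g h C k R (ω, x))
    {ω : Ω} {ξ : Ξ} {z z' : EuclideanSpace ℝ (Fin d)}
    (hz : ∀ j, ((skewProduct θ (doubleFibreMap g h))^[j] (ω, ξ, z)).2 ∈ fibre K (θ^[j] ω)) (j : ℕ)
    (hr : ∀ i < k, orbitDist θ g h ω ξ z z' (j + i) < r) :
    orbitDist θ g h ω ξ z z' (j + k) ≤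
      Real.exp (envelope K (clampLogDeriv θ g h C k R) (k * (R + C)) r (θ^[j] ω)) *
        orbitDist θ g h ω ξ z z' j := by
  set ψ := envelope K (clampLogDeriv θ g h C k R) (k * (R + C)) r (θ^[j] ω) with hψ
  rcases k.eq_zero_or_pos with rfl | hk0
  · have h1 := abs_envelope_le (K := K) (abs_clampLogDeriv_le (θ := θ) (g := g) (h := h) hC0 0 R) r
      (θ^[j] ω)
    have h2 : ψ = 0 := by
      rw [Nat.cast_zero, zero_mul] at h1
      exact abs_nonpos_iff.1 (by simpa [hψ] using h1)
    rw [h2]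
    simp
  -- If `ψ` is less than k C, the upper cut-off is inactive on the whole neighbourhood and `ψ`
  -- bounds the true derivative. Otherwise chaining the one-step bounds already gives the factor
  -- exp(k C).
  rcases lt_or_ge ψ (k * C) with hlt | hge
  · have hzj := hz j
    rw [doubleSkewProduct_iterate] at hzj
    rw [orbitDist_add]
    refine dist_iterFibre_le hT.differentiable hzj (hr 0 hk0) fun x hx => ?_
    have h1 : clampLogDeriv θ g h C k R (θ^[j] ω, x) ≤ ψ :=
      le_envelope hcont (abs_clampLogDeriv_le hC0 k R) hx
    have h2 : truncLogDeriv θ g h k R (θ^[j] ω, x) ≤ ψ := by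
      rcases min_le_iff.1 h1 with h | h
      · exact h
      · exact absurd h (not_le.2 hlt)
    exact (norm_fibreDeriv_le_exp_truncLogDeriv k R _).trans (Real.exp_le_exp.2 h2)
  · refine (le_exp_mul_of_forall_lt
      (fun i hi => orbitDist_succ_le hT.differentiable hC hz i hi) hr).trans ?_
    exact mul_le_mul_of_nonneg_right (Real.exp_le_exp.2 hge) (orbitDist_nonneg _ _ _ _ _)

end Contraction

/-! ### A random threshold adapted to the Birkhoff sums. -/

section Radius

variable {Ω : Type*} {θ : Ω → Ω} {ψ : Ω → ℝ} {b₀ : ℝ}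

/-- The random radius `b(ω) = inf_n b₀ exp(-S_n ψ(ω))`. -/
noncomputable def stableRadius (θ : Ω → Ω) (ψ : Ω → ℝ) (b₀ : ℝ) (ω : Ω) : ℝ :=
  ⨅ n : ℕ, b₀ * Real.exp (-birkhoffSum θ ψ n ω)

theorem bddBelow_stableRadius (hb : 0 ≤ b₀) (ω : Ω) :
    BddBelow (range fun n : ℕ => b₀ * Real.exp (-birkhoffSum θ ψ n ω)) :=
  ⟨0, by rintro _ ⟨n, rfl⟩; positivity⟩

theorem stableRadius_le (hb : 0 ≤ b₀) (ω : Ω) : stableRadius θ ψ b₀ ω ≤ b₀ := by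
  exact (ciInf_le (bddBelow_stableRadius (θ := θ) (ψ := ψ) hb ω) 0).trans_eq (by simp)

/-- Since S_{n+1}ψ(ω) = ψ(ω) + S_nψ(θ ω), the infimum at θ ω runs over the terms at ω of index at
least 1, times exp ψ(ω). Hence contraction by exp ψ carries pairs below the threshold at ω to pairs
below the threshold at θ ω. -/
theorem exp_mul_stableRadius_le (hb : 0 ≤ b₀) (ω : Ω) :
    Real.exp (ψ ω) * stableRadius θ ψ b₀ ω ≤ stableRadius θ ψ b₀ (θ ω) := by
  refine le_ciInf fun n => ?_
  have := ciInf_le (bddBelow_stableRadius (θ := θ) (ψ := ψ) hb ω) (n + 1)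
  refine (mul_le_mul_of_nonneg_left this (Real.exp_nonneg _)).trans_eq ?_
  rw [birkhoffSum_succ', mul_left_comm, ← Real.exp_add]
  ring_nf

theorem stableRadius_pos (hb : 0 < b₀) {ω : Ω}
    (h : Tendsto (fun n => birkhoffSum θ ψ n ω) atTop atBot) : 0 < stableRadius θ ψ b₀ ω := by
  obtain ⟨a, ha⟩ := bddAbove_range_of_tendsto_atTop_atBot h
  refine lt_of_lt_of_le (mul_pos hb (Real.exp_pos (-a))) (le_ciInf fun n => ?_)
  have := ha ⟨n, rfl⟩
  gcongr

theorem measurable_stableRadius [MeasurableSpace Ω] (hθ : Measurable θ) (hψ : Measurable ψ) :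
    Measurable (stableRadius θ ψ b₀) :=
  Measurable.iInf fun n => ((measurable_birkhoffSum hθ hψ n).neg.exp).const_mul _

/-- Birkhoff sums up to time `-k` which start in the past. -/
theorem birkhoffSum_symm_iterate [MeasurableSpace Ω] (θ : Ω ≃ᵐ Ω) (ψ : Ω → ℝ) (M k : ℕ) (ω : Ω) :
    birkhoffSum θ ψ M (θ.symm^[M + k] ω) = birkhoffSum θ.symm ψ M (θ.symm^[k + 1] ω) := by
  have hinv : ∀ i x, θ^[i] (θ.symm^[i] x) = x := fun i =>
    Function.RightInverse.iterate (g := θ.symm) (f := θ) θ.apply_symm_apply i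
  rw [birkhoffSum, birkhoffSum, ← Finset.sum_range_reflect]
  refine Finset.sum_congr rfl fun i hi => ?_
  have hi' := Finset.mem_range.1 hi
  rw [← Function.iterate_add_apply, show M + k = (M - 1 - i) + (i + (k + 1)) by omega,
    Function.iterate_add_apply θ.symm (M - 1 - i), hinv]

end Radius

/-! ### Separated points in the fibres -/

theorem exists_pos_le_dist_of_injective {ι X : Type*} [Finite ι] [MetricSpace X] {v : ι → X}
    (hv : Function.Injective v) : ∃ η > 0, ∀ i j, i ≠ j → η ≤ dist (v i) (v j) := by
  rcases isEmpty_or_nonempty {p : ι × ι // p.1 ≠ p.2} with h | h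
  · exact ⟨1, one_pos, fun i j hij => (h.false ⟨(i, j), hij⟩).elim⟩
  · obtain ⟨p, hp⟩ := Finite.exists_min fun p : {p : ι × ι // p.1 ≠ p.2} => dist (v p.1.1) (v p.1.2)
    exact ⟨_, dist_pos.2 (hv.ne p.2), fun i j hij => hp ⟨(i, j), hij⟩⟩

/-- A compact set does not contain arbitrarily many points of a given mutual distance. -/
theorem IsCompact.exists_not_separated {X : Type*} [MetricSpace X] {s : Set X} (hs : IsCompact s)
    {c : ℝ} (hc : 0 < c) : ∃ n : ℕ, ∀ y : Fin (n + 1) → X, (∀ i, y i ∈ s) →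
      ∃ i j, i ≠ j ∧ dist (y i) (y j) < c := by
  obtain ⟨t, -, htf, hst⟩ := hs.finite_cover_balls (half_pos hc)
  have := htf.to_subtype
  have := Fintype.ofFinite t
  refine ⟨Fintype.card t, fun y hy => ?_⟩
  have : ∀ i, ∃ x : t, dist (y i) x < c / 2 := fun i => by
    obtain ⟨x, hx, hyx⟩ := mem_iUnion₂.1 (hst (hy i))
    exact ⟨⟨x, hx⟩, hyx⟩
  choose f hf using this
  obtain ⟨i, j, hij, hfij⟩ := Fintype.exists_ne_map_eq_of_card_lt f (by simp)
  refine ⟨i, j, hij, ?_⟩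
  have h1 := hf i
  have h2 := hf j
  rw [← hfij] at h2
  linarith [dist_triangle_right (y i) (y j) (f i)]

/-- The slices of a compact set are continuous in the Hausdorff distance if they all have the same
finite number of points, with mutual distances bounded below. -/
theorem continuous_slices {X Y : Type*} [MetricSpace X] [MetricSpace Y] {A : Set (X × Y)}
    (hA : IsCompact A) {κ : X → TopologicalSpace.NonemptyCompacts Y}
    (hκ : ∀ x, (κ x : Set Y) = {y | (x, y) ∈ A}) {n : ℕ} (hn : ∀ x, (κ x : Set Y).encard = n)
    {c : ℝ} (hc : 0 < c) (hsep : ∀ x, ∀ y ∈ κ x, ∀ y' ∈ κ x, y ≠ y' → c ≤ dist y y') :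
    Continuous κ := by
  rw [continuous_iff_continuousAt]
  intro x₀
  rw [ContinuousAt, Metric.tendsto_nhds]
  intro ε hε
  -- The half ε/2 is for the Hausdorff distance; c/2 prevents two points of one slice from being
  -- matched with the same point of `κ x₀`.
  set δ := min (ε / 2) (c / 2) with hδ
  have hδ0 : 0 < δ := lt_min (half_pos hε) (half_pos hc)
  -- Upper semicontinuity: the base points whose slice leaves the δ-neighbourhood of `κ x₀` form a
  -- closed set missing x₀.
  have hZ : IsClosed (Prod.fst '' (A ∩ {p | p.2 ∉ Metric.thickening δ (κ x₀ : Set Y)})) :=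
    ((hA.inter_right (Metric.isOpen_thickening.isClosed_compl.preimage continuous_snd)).image
      continuous_fst).isClosed
  have hx₀ : x₀ ∉ Prod.fst '' (A ∩ {p | p.2 ∉ Metric.thickening δ (κ x₀ : Set Y)}) := by
    rintro ⟨⟨x, y⟩, ⟨hp, hp'⟩, rfl⟩
    refine hp' (Metric.self_subset_thickening hδ0 _ ?_)
    rw [hκ]
    exact hp
  filter_upwards [hZ.isOpen_compl.mem_nhds hx₀] with x hx
  have hup : ∀ y ∈ (κ x : Set Y), ∃ y' ∈ (κ x₀ : Set Y), dist y y' < δ := by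
    intro y hy
    by_contra hcon
    refine hx ⟨(x, y), ⟨by rw [hκ] at hy; exact hy, fun hmem => hcon ?_⟩, rfl⟩
    exact Metric.mem_thickening_iff.1 hmem
  choose! f hf hfd using hup
  have hinj : InjOn f (κ x : Set Y) := by
    intro y hy y' hy' hyy
    by_contra hne
    have h1 := hsep x y hy y' hy' hne
    have h2 := hfd y hy
    have h3 := hfd y' hy'
    rw [← hyy] at h3
    have h4 := dist_triangle_right y y' (f y)
    have h5 : δ ≤ c / 2 := min_le_right _ _
    linarith
  -- An injection between finite sets of equal size is onto, which supplies lower semicontinuity.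
  have hsurj : f '' (κ x : Set Y) = (κ x₀ : Set Y) := by
    refine Set.Finite.eq_of_subset_of_encard_le' (finite_of_encard_eq_coe (hn x₀))
      (image_subset_iff.2 hf) ?_
    rw [hinj.encard_image, hn, hn]
  rw [Metric.NonemptyCompacts.dist_eq]
  refine (Metric.hausdorffDist_le_of_mem_dist (r := δ) hδ0.le
    (fun y hy => ⟨f y, hf y hy, (hfd y hy).le⟩) fun y' hy' => ?_).trans_lt
    ((min_le_left _ _).trans_lt (half_lt_self hε))
  rw [← hsurj] at hy'
  obtain ⟨y, hy, rfl⟩ := hy'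
  exact ⟨y, hy, by rw [dist_comm]; exact (hfd y hy).le⟩

/-! ### The random closed set of base points carrying many separated points. -/

section SeparatedSet

variable {Ω Ξ : Type*} {d : ℕ} {θ : Ω → Ω} {g : Ω → Ξ → Ξ}
  {h : Ω → Ξ → EuclideanSpace ℝ (Fin d) → EuclideanSpace ℝ (Fin d)}
  {K : Set (Ω × Ξ × EuclideanSpace ℝ (Fin d))} {k m : ℕ} {r : ℝ} {b : Ω → ℝ}

/-- The set of the `(ω, ξ)` for which `K(ω, ξ)` contains `m + 1` points which are pairwise
not near. -/
def separatedSet (θ : Ω → Ω) (g : Ω → Ξ → Ξ)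
    (h : Ω → Ξ → EuclideanSpace ℝ (Fin d) → EuclideanSpace ℝ (Fin d))
    (K : Set (Ω × Ξ × EuclideanSpace ℝ (Fin d))) (k : ℕ) (r : ℝ) (b : Ω → ℝ) (m : ℕ) :
    Set (Ω × Ξ) :=
  {p | ∃ y : Fin (m + 1) → EuclideanSpace ℝ (Fin d), (∀ i, (p.1, p.2, y i) ∈ K) ∧
    ∀ i j, i ≠ j → ¬IsNearAt (orbitDist θ g h p.1 p.2 (y i) (y j)) k r (b p.1) 0}

/-- A continuous function of pairs of points which is positive exactly on the near pairs. -/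
noncomputable def nearGap (θ : Ω → Ω) (g : Ω → Ξ → Ξ)
    (h : Ω → Ξ → EuclideanSpace ℝ (Fin d) → EuclideanSpace ℝ (Fin d)) (k : ℕ) (r : ℝ) (b : Ω → ℝ)
    (ω : Ω) (ξ : Ξ) (z z' : EuclideanSpace ℝ (Fin d)) : ℝ :=
  max 0 (b ω - windowProd (orbitDist θ g h ω ξ z z') k 0) *
    ∏ i ∈ Finset.range (k + 1), max 0 (r - orbitDist θ g h ω ξ z z' i)

theorem nearGap_nonneg (ω : Ω) (ξ : Ξ) (z z' : EuclideanSpace ℝ (Fin d)) :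
    0 ≤ nearGap θ g h k r b ω ξ z z' :=
  mul_nonneg (le_max_left _ _) (Finset.prod_nonneg fun _ _ => le_max_left _ _)

theorem nearGap_eq_zero_iff (ω : Ω) (ξ : Ξ) (z z' : EuclideanSpace ℝ (Fin d)) :
    nearGap θ g h k r b ω ξ z z' = 0 ↔
      ¬IsNearAt (orbitDist θ g h ω ξ z z') k r (b ω) 0 := by
  rw [nearGap, mul_eq_zero, Finset.prod_eq_zero_iff, IsNearAt, not_and_or, max_eq_left_iff,
    sub_nonpos, not_lt]
  refine or_congr Iff.rfl ?_
  simp only [max_eq_left_iff, sub_nonpos, Finset.mem_range, zero_add]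
  push Not
  refine exists_congr fun i => and_congr (by omega) Iff.rfl

/-- The deviation of a tuple of points from being a tuple of pairwise separated points over
the same point of the base. -/
noncomputable def tupleGap [MetricSpace Ξ] (θ : Ω → Ω) (g : Ω → Ξ → Ξ)
    (h : Ω → Ξ → EuclideanSpace ℝ (Fin d) → EuclideanSpace ℝ (Fin d)) (k : ℕ) (r : ℝ) (b : Ω → ℝ)
    (ω : Ω) (x : Fin (m + 1) → Ξ × EuclideanSpace ℝ (Fin d)) : ℝ :=
  ∑ i, ∑ j, (dist (x i).1 (x j).1 +
    if i = j then 0 else nearGap θ g h k r b ω (x i).1 (x i).2 (x j).2)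

theorem tupleGap_nonpos_iff [MetricSpace Ξ] (ω : Ω)
    (x : Fin (m + 1) → Ξ × EuclideanSpace ℝ (Fin d)) :
    tupleGap θ g h k r b ω x ≤ 0 ↔ (∀ i j, (x i).1 = (x j).1) ∧ ∀ i j, i ≠ j →
      ¬IsNearAt (orbitDist θ g h ω (x i).1 (x i).2 (x j).2) k r (b ω) 0 := by
  have h0 : ∀ i j, 0 ≤ if i = j then 0 else nearGap θ g h k r b ω (x i).1 (x i).2 (x j).2 := by
    intro i j
    split_ifs
    · exact le_rfl
    · exact nearGap_nonneg _ _ _ _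
  have hnn : ∀ i j, 0 ≤ dist (x i).1 (x j).1 +
      if i = j then 0 else nearGap θ g h k r b ω (x i).1 (x i).2 (x j).2 := fun i j =>
    add_nonneg dist_nonneg (h0 i j)
  have h1 : tupleGap θ g h k r b ω x ≤ 0 ↔ ∀ i j, dist (x i).1 (x j).1 +
      (if i = j then 0 else nearGap θ g h k r b ω (x i).1 (x i).2 (x j).2) = 0 := by
    rw [tupleGap, le_antisymm_iff.trans (and_iff_left (Finset.sum_nonneg fun i _ =>
      Finset.sum_nonneg fun j _ => hnn i j)) |>.symm, Finset.sum_eq_zero_iff_of_nonneg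
      fun i _ => Finset.sum_nonneg fun j _ => hnn i j]
    simp only [Finset.mem_univ, true_imp_iff]
    refine forall_congr' fun i => ?_
    rw [Finset.sum_eq_zero_iff_of_nonneg fun j _ => hnn i j]
    simp only [Finset.mem_univ, true_imp_iff]
  rw [h1]
  simp only [← forall_and]
  refine forall₂_congr fun i j => ?_
  rw [add_eq_zero_iff_of_nonneg dist_nonneg (h0 i j), dist_eq_zero]
  refine and_congr Iff.rfl ?_
  by_cases hij : i = j
  · simp [hij]
  · simp [hij, nearGap_eq_zero_iff]

variable [MetricSpace Ξ]

theorem mem_separatedSet_iff {ω : Ω} {ξ : Ξ} :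
    (ω, ξ) ∈ separatedSet θ g h K k r b m ↔
      ∃ x : Fin (m + 1) → Ξ × EuclideanSpace ℝ (Fin d), (∀ i, x i ∈ fibre K ω) ∧
        tupleGap θ g h k r b ω x ≤ 0 ∧ (x 0).1 = ξ := by
  constructor
  · rintro ⟨y, hy, hsep⟩
    exact ⟨fun i => (ξ, y i), hy, (tupleGap_nonpos_iff _ _).2 ⟨fun _ _ => rfl, hsep⟩, rfl⟩
  · rintro ⟨x, hx, hgap, rfl⟩
    obtain ⟨h1, h2⟩ := (tupleGap_nonpos_iff _ _).1 hgap
    refine ⟨fun i => (x i).2, fun i => ?_, fun i j hij => ?_⟩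
    · have := hx i
      rw [show x i = ((x 0).1, (x i).2) from Prod.ext (h1 i 0) rfl] at this
      exact this
    · have := h2 i j hij
      rwa [h1 i 0] at this

variable [MeasurableSpace Ω] [CompactSpace Ξ] [MeasurableSpace Ξ] [BorelSpace Ξ]

omit [CompactSpace Ξ] [BorelSpace Ξ] in
theorem continuous_tupleGap (hT : IsDoubleSkewProduct g h) (ω : Ω) :
    Continuous (tupleGap (m := m) θ g h k r b ω) := by
  have hiter : ∀ l, Continuous fun x : Ξ × EuclideanSpace ℝ (Fin d) =>
      iterFibre θ g h l ω x.1 x.2 := fun l =>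
    continuous_snd.comp (continuous_skewProduct_iterate_snd hT.isRandomMap.continuous l ω)
  have hdist : ∀ (i j : Fin (m + 1)) (l : ℕ),
      Continuous fun x : Fin (m + 1) → Ξ × EuclideanSpace ℝ (Fin d) =>
        orbitDist θ g h ω (x i).1 (x i).2 (x j).2 l := fun i j l => by
    have hij : Continuous fun x : Fin (m + 1) → Ξ × EuclideanSpace ℝ (Fin d) =>
        ((x i).1, (x j).2) := by fun_prop
    exact ((hiter l).comp (continuous_apply i)).dist ((hiter l).comp hij)
  refine continuous_finsetSum _ fun i _ => continuous_finsetSum _ fun j _ => ?_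
  refine Continuous.add (by fun_prop) ?_
  by_cases hij : i = j
  · simp only [hij, if_true]
    exact continuous_const
  · simp only [hij, if_false]
    refine Continuous.mul (continuous_const.max (continuous_const.sub ?_)) ?_
    · exact continuous_finsetProd _ fun l _ => hdist i j _
    · exact continuous_finsetProd _ fun l _ => continuous_const.max
        (continuous_const.sub (hdist i j l))

theorem measurable_tupleGap (hθ : Measurable θ) (hT : IsDoubleSkewProduct g h) (hb : Measurable b)
    (x : Fin (m + 1) → Ξ × EuclideanSpace ℝ (Fin d)) :
    Measurable fun ω => tupleGap θ g h k r b ω x := by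
  have hdist : ∀ (ξ : Ξ) (z z' : EuclideanSpace ℝ (Fin d)) (l : ℕ),
      Measurable fun ω => orbitDist θ g h ω ξ z z' l := fun ξ z z' l =>
    (measurable_iterFibre hθ hT l ξ z).dist (measurable_iterFibre hθ hT l ξ z')
  refine Finset.measurable_fun_sum _ fun i _ => Finset.measurable_fun_sum _ fun j _ => ?_
  refine measurable_const.add ?_
  by_cases hij : i = j
  · simp only [hij, if_true]
    exact measurable_const
  · simp only [hij, if_false]
    refine Measurable.mul (measurable_const.max (hb.sub ?_)) ?_
    · exact Finset.measurable_fun_prod _ fun l _ => hdist _ _ _ _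
    · exact Finset.measurable_fun_prod _ fun l _ => measurable_const.max
        (measurable_const.sub (hdist _ _ _ l))

/-- Nearness is an open condition, so separated tuples over a common base point form a compact set
of tuples in `K(ω)`, cut out by the single Carathéodory function `tupleGap`. The fibre is its
projection, and `measurableSet_exists_tuple` gives the measurability. -/
theorem isRandomClosed_separatedSet (hθ : Measurable θ) (hT : IsDoubleSkewProduct g h)
    (hK : IsRandomCompact K) (hb : Measurable b) :
    IsRandomClosed (separatedSet θ g h K k r b m) := by
  refine .of_measurableSet (fun ω => ?_) fun ξ s => ?_
  · have : fibre (separatedSet θ g h K k r b m) ω =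
        (fun x : Fin (m + 1) → Ξ × EuclideanSpace ℝ (Fin d) => (x 0).1) ''
          ((univ.pi fun _ => fibre K ω) ∩ {x | tupleGap θ g h k r b ω x ≤ 0}) := by
      ext ξ
      refine mem_separatedSet_iff.trans ⟨?_, ?_⟩
      · rintro ⟨x, hx, hgap, h0⟩
        exact ⟨x, ⟨fun i _ => hx i, hgap⟩, h0⟩
      · rintro ⟨x, ⟨hx, hgap⟩, h0⟩
        exact ⟨x, fun i => hx i trivial, hgap, h0⟩
    rw [this]
    refine (IsCompact.image ?_ (by fun_prop)).isClosed
    exact (isCompact_univ_pi fun _ => hK.isCompact ω).inter_right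
      (isClosed_le (continuous_tupleGap hT ω) continuous_const)
  · convert measurableSet_exists_tuple hK (n := m + 1)
      (F := fun ω x => min (s - dist ξ (x 0).1) (-tupleGap θ g h k r b ω x))
      (fun ω => Continuous.min (by fun_prop) (continuous_tupleGap hT ω).neg)
      (fun x => measurable_const.min (measurable_tupleGap hθ hT hb x).neg) using 1
    ext ω
    simp only [mem_ofPred_eq, le_min_iff, sub_nonneg, neg_nonneg]
    constructor
    · rintro ⟨ξ', hξ', hs⟩
      obtain ⟨x, hx, hgap, rfl⟩ := mem_separatedSet_iff.1 hξ'
      exact ⟨x, hx, hs, hgap⟩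
    · rintro ⟨x, hx, hs, hgap⟩
      exact ⟨(x 0).1, mem_separatedSet_iff.2 ⟨x, hx, hgap, rfl⟩, hs⟩

end SeparatedSet

/-! ### Uniform contraction near the fibres -/

section Contraction

variable {Ω Ξ : Type*} [MeasurableSpace Ω] {P : Measure Ω} {d : ℕ} {θ : Ω → Ω} {g : Ω → Ξ → Ξ}
  {h : Ω → Ξ → EuclideanSpace ℝ (Fin d) → EuclideanSpace ℝ (Fin d)}
  {K : Set (Ω × Ξ × EuclideanSpace ℝ (Fin d))}

omit [MeasurableSpace Ω] in
theorem norm_fibreDeriv_le_exp_of_logDeriv_le {n : ℕ} {C : ℝ}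
    {p : Ω × Ξ × EuclideanSpace ℝ (Fin d)} (hp : logDeriv θ g h n p ≤ (C : EReal)) :
    ‖fibreDeriv θ g h n p‖ ≤ Real.exp C := by
  rw [logDeriv_eq] at hp
  have h1 := EReal.exp_le_exp_iff.2 hp
  rw [ENNReal.exp_log, EReal.exp_coe, ← ofReal_norm] at h1
  exact (ENNReal.ofReal_le_ofReal_iff (Real.exp_pos _).le).1 h1

theorem IsInvariant.isForwardInvariant {Ω M : Type*} [MeasurableSpace Ω] {P : Measure Ω}
    {θ : Ω → Ω} {F : Ω → M → M} {K : Set (Ω × M)} (hK : IsInvariant P θ F K) :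
    IsForwardInvariant P θ F K := hK.mono fun _ hω => hω.subset

theorem IsInvariant.ae_nonempty {Ω M : Type*} [MeasurableSpace Ω] {P : Measure Ω}
    [IsProbabilityMeasure P]
    {θ : Ω → Ω} {F : Ω → M → M} [MetricSpace M] [Nonempty M] {K : Set (Ω × M)}
    (hK : IsInvariant P θ F K) (hθ : Ergodic θ P) (hKr : IsRandomCompact K)
    (hne : ∃ᵐ ω ∂P, (fibre K ω).Nonempty) : ∀ᵐ ω ∂P, (fibre K ω).Nonempty := by
  refine (ae_mem_or_ae_notMem_of_ae_imp hθ (measurableSet_fibre_nonempty hKr.measurable)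
    (hK.mono fun ω hω h => ?_)).resolve_right fun h => hne h
  have h' : (fibre K (θ ω)).Nonempty := h
  rw [← hω, image_nonempty] at h'
  exact h'

variable [MetricSpace Ξ] [CompactSpace Ξ] [MeasurableSpace Ξ]
  [BorelSpace Ξ]

omit [MeasurableSpace Ω] [CompactSpace Ξ] [MeasurableSpace Ξ] [BorelSpace Ξ] in
theorem exists_radius_norm_fibreDeriv_le (hbdd : supOn θ g h K 1 < ⊤)
    (hunif : ∃ r : ℝ, 0 < r ∧ supNear θ g h K 1 r ≤ supOn θ g h K 1 + ((1 : ℝ) : EReal)) :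
    ∃ C r : ℝ, 0 ≤ C ∧ 0 < r ∧
      ∀ ω, ∀ x ∈ Metric.thickening r (fibre K ω), ‖fibreDeriv θ g h 1 (ω, x)‖ ≤ Real.exp C := by
  obtain ⟨r, hr, hle⟩ := hunif
  have hlt : supNear θ g h K 1 r < ⊤ :=
    hle.trans_lt (EReal.add_lt_top hbdd.ne (EReal.coe_ne_top _))
  obtain ⟨C, hC, -⟩ := EReal.lt_iff_exists_real_btwn.1 hlt
  refine ⟨max C 0, r, le_max_right _ _, hr, fun ω x hx => ?_⟩
  refine norm_fibreDeriv_le_exp_of_logDeriv_le (le_trans ?_ (hC.le.trans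
    (EReal.coe_le_coe_iff.2 (le_max_left _ _))))
  exact le_iSup_of_le ω (le_iSup₂_of_le x hx le_rfl)

variable [IsProbabilityMeasure P]

theorem exists_integral_fibreSup_neg [Nonempty Ξ] (hθ : MeasurePreserving θ P P)
    (hT : IsDoubleSkewProduct g h)
    (hK : IsRandomCompact K) (hKF : IsForwardInvariant P θ (doubleFibreMap g h) K)
    (hne : ∀ᵐ ω ∂P, (fibre K ω).Nonempty) {C : ℝ} (hC : 0 ≤ C)
    (hKC : ∀ p ∈ K, ‖fibreDeriv θ g h 1 p‖ ≤ Real.exp C)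
    (hlyap : ∀ μ ∈ invariantMeasures P θ (doubleFibreMap g h) K, lyapunovExponent θ g h μ < 0) :
    ∃ n R, ∫ ω, fibreSup K (clampLogDeriv θ g h C n R) (n * (R + C)) ω ∂P < 0 := by
  by_contra! hcon
  have hmem := ae_iterate_mem hθ hKF
  obtain ⟨μ, hμ, hint⟩ := exists_invariantMeasure_integral_nonneg hθ hT.isRandomMap hK hKF hne
    (φ := clampLogDeriv θ g h C) (isCaratheodory_clampLogDeriv hθ.measurable hT C)
    (B := fun n R => n * (R + C)) (fun n R p => abs_clampLogDeriv_le hC n R p)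
    (antitone_clampLogDeriv C) (by
      filter_upwards [hmem] with ω hω R x hx n m
      refine clampLogDeriv_add_le hT.differentiable hC (fun j => hKC _ ?_) n m R
      rw [iterate_eq_mk]
      exact hω x hx j) hC (fun n R p => min_le_right _ _) hcon
  refine (hlyap μ hμ).not_ge ?_
  obtain ⟨hprob, hpres, -, hsupp⟩ := hμ
  refine lyapunovExponent_nonneg hθ.measurable hT hC (fun n => ?_) hint
  filter_upwards [ae_forall_iterate hpres hsupp] with p hp
  exact norm_fibreDeriv_le_exp hT.differentiable (fun j => hKC _ (hp j)) n

/-- The suprema over shrinking neighbourhoods converge boundedly to the suprema over the fibres. The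
time is not 0, because the functions at time 0 vanish; writing it as k+1 fits a window of k+1
distances. -/
theorem exists_integral_envelope_neg [Nonempty Ξ] (hθ : MeasurePreserving θ P P)
    (hT : IsDoubleSkewProduct g h)
    (hK : IsRandomCompact K) (hKF : IsForwardInvariant P θ (doubleFibreMap g h) K)
    (hne : ∀ᵐ ω ∂P, (fibre K ω).Nonempty) {C : ℝ} (hC : 0 ≤ C)
    (hKC : ∀ p ∈ K, ‖fibreDeriv θ g h 1 p‖ ≤ Real.exp C)
    (hlyap : ∀ μ ∈ invariantMeasures P θ (doubleFibreMap g h) K, lyapunovExponent θ g h μ < 0)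
    {r₁ : ℝ} (hr₁ : 0 < r₁) :
    ∃ k R : ℕ, ∃ r : ℝ, 0 < r ∧ r ≤ 1 ∧ r ≤ r₁ ∧
      ∫ ω, envelope K (clampLogDeriv θ g h C (k + 1) R) ((k + 1 : ℕ) * (R + C)) r ω ∂P < 0 := by
  obtain ⟨n, R, hneg⟩ := exists_integral_fibreSup_neg hθ hT hK hKF hne hC hKC hlyap
  have hn : n ≠ 0 := by
    rintro rfl
    refine hneg.ne ?_
    have : ∀ ω, fibreSup K (clampLogDeriv θ g h C 0 R) ((0 : ℕ) * (R + C)) ω = 0 := fun ω => by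
      have := abs_fibreSup_le (K := K) (fun p => abs_clampLogDeriv_le (θ := θ) (g := g) (h := h)
        hC 0 R p) ω
      rw [Nat.cast_zero, zero_mul] at this ⊢
      exact abs_nonpos_iff.1 this
    simp only [this, integral_zero]
  obtain ⟨k, rfl⟩ := Nat.exists_eq_succ_of_ne_zero hn
  have hB := fun p => abs_clampLogDeriv_le (θ := θ) (g := g) (h := h) hC (k + 1) R p
  have hcar := isCaratheodory_clampLogDeriv hθ.measurable hT C (k + 1) R
  have hlim : Tendsto (fun j : ℕ => ∫ ω, envelope K (clampLogDeriv θ g h C (k + 1) R)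
      ((k + 1 : ℕ) * (R + C)) (1 / ((j : ℝ) + 1)) ω ∂P) atTop
      (𝓝 (∫ ω, fibreSup K (clampLogDeriv θ g h C (k + 1) R) ((k + 1 : ℕ) * (R + C)) ω ∂P)) := by
    refine tendsto_integral_of_dominated_convergence (fun _ => ((k + 1 : ℕ) : ℝ) * (R + C))
      (fun j => (measurable_envelope hK.measurable hcar.measurable_left _).aestronglyMeasurable)
      (integrable_const _) (fun j => ae_of_all _ fun ω => ?_)
      (ae_of_all _ fun ω => tendsto_envelope hB ω)
    exact abs_envelope_le hB _ ω
  have hsmall : ∀ᶠ j : ℕ in atTop, 1 / ((j : ℝ) + 1) < r₁ :=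
    tendsto_one_div_add_atTop_nhds_zero_nat.eventually_lt_const hr₁
  obtain ⟨j, hj, hj'⟩ := ((hlim.eventually_lt_const hneg).and hsmall).exists
  refine ⟨k, R, 1 / ((j : ℝ) + 1), by positivity, ?_, hj'.le, hj⟩
  rw [div_le_one (by positivity)]
  linarith [(Nat.cast_nonneg j : (0 : ℝ) ≤ j)]

end Contraction

/-! ### Near pairs stay near -/

section Near

variable {Ω Ξ : Type*} {d : ℕ} {θ : Ω → Ω} {g : Ω → Ξ → Ξ}
  {h : Ω → Ξ → EuclideanSpace ℝ (Fin d) → EuclideanSpace ℝ (Fin d)}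
  {K : Set (Ω × Ξ × EuclideanSpace ℝ (Fin d))} {C r : ℝ} {k m : ℕ} {ψ b : Ω → ℝ}

/-- Near pairs of points of `K` stay near along their orbits, and the products of their
distances are controlled by the Birkhoff sums of `ψ`. -/
def IsNearInvariant (θ : Ω → Ω) (g : Ω → Ξ → Ξ)
    (h : Ω → Ξ → EuclideanSpace ℝ (Fin d) → EuclideanSpace ℝ (Fin d))
    (K : Set (Ω × Ξ × EuclideanSpace ℝ (Fin d))) (k : ℕ) (r : ℝ) (ψ b : Ω → ℝ) : Prop :=
  ∀ ω ξ z z', (∀ j, ((skewProduct θ (doubleFibreMap g h))^[j] (ω, ξ, z)).2 ∈ fibre K (θ^[j] ω)) →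
    IsNearAt (orbitDist θ g h ω ξ z z') k r (b ω) 0 → ∀ j,
      IsNearAt (orbitDist θ g h ω ξ z z') k r (b (θ^[j] ω)) j ∧
      windowProd (orbitDist θ g h ω ξ z z') k j ≤
        Real.exp (birkhoffSum θ ψ j ω) * windowProd (orbitDist θ g h ω ξ z z') k 0

/-- The constant r^{k+1} exp(-kC)^{k+1} is the largest threshold for which a small window product
forces its last distance below r; `stableRadius` never exceeds it. -/
theorem isNearInvariant_stableRadius [MetricSpace Ξ] [CompactSpace Ξ] [Nonempty Ξ]
    [MeasurableSpace Ω] [MeasurableSpace Ξ] [BorelSpace Ξ] (hθ : Measurable θ)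
    (hT : IsDoubleSkewProduct g h) (hC0 : 0 ≤ C) (hr : 0 ≤ r)
    (hC : ∀ ω, ∀ x ∈ Metric.thickening r (fibre K ω), ‖fibreDeriv θ g h 1 (ω, x)‖ ≤ Real.exp C)
    (R : ℕ) :
    IsNearInvariant θ g h K k r
      (envelope K (clampLogDeriv θ g h C (k + 1) R) ((k + 1 : ℕ) * (R + C)) r)
      (stableRadius θ (envelope K (clampLogDeriv θ g h C (k + 1) R) ((k + 1 : ℕ) * (R + C)) r)
        (r ^ (k + 1) / Real.exp (k * C) ^ (k + 1))) := by
  intro ω ξ z z' hz hnear j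
  have hb0 : 0 ≤ r ^ (k + 1) / Real.exp (k * C) ^ (k + 1) := by positivity
  refine IsNearAt.forall (orbitDist_nonneg ω ξ z z') hC0 hr
    (orbitDist_succ_le hT.differentiable hC hz)
    (s := fun j => envelope K (clampLogDeriv θ g h C (k + 1) R) ((k + 1 : ℕ) * (R + C)) r
      (θ^[j] ω)) (b := fun j => stableRadius θ _ _ (θ^[j] ω)) (fun j hj => ?_) (fun j => ?_)
    (fun j => ?_) hnear j
  · exact orbitDist_add_le hT hC0 hC (isCaratheodory_clampLogDeriv hθ hT C (k + 1) R).continuous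
      hz j fun i hi => hj i (Nat.lt_succ_iff.1 hi)
  · rw [Function.iterate_succ_apply']
    exact exp_mul_stableRadius_le hb0 _
  · calc _ ≤ Real.exp (k * C) ^ (k + 1) * (r ^ (k + 1) / Real.exp (k * C) ^ (k + 1)) := by
          gcongr
          exact stableRadius_le hb0 _
      _ = r ^ (k + 1) := by field_simp

/-- By invariance of `K` the separated points have preimages in `K`, over one base point as `g ω` is
injective. A near pair among the preimages would have a near image pair. -/
theorem fibre_separatedSet_subset_image (hnear : IsNearInvariant θ g h K k r ψ b) {ω : Ω}
    (hg : Function.Bijective (g ω))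
    (horb : ∀ x ∈ fibre K ω, ∀ j,
      ((skewProduct θ (doubleFibreMap g h))^[j] (ω, x)).2 ∈ fibre K (θ^[j] ω))
    (hinv : doubleFibreMap g h ω '' fibre K ω = fibre K (θ ω)) :
    fibre (separatedSet θ g h K k r b m) (θ ω) ⊆
      g ω '' fibre (separatedSet θ g h K k r b m) ω := by
  rintro ξ' ⟨y, hy, hsep⟩
  obtain ⟨ξ, rfl⟩ := hg.surjective ξ'
  have : ∀ i, ∃ z, (ξ, z) ∈ fibre K ω ∧ h ω ξ z = y i := fun i => by
    have hi : (g ω ξ, y i) ∈ fibre K (θ ω) := hy i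
    rw [← hinv] at hi
    obtain ⟨⟨ξ₁, z⟩, hz, hzy⟩ := hi
    obtain rfl : ξ₁ = ξ := hg.injective (congrArg Prod.fst hzy)
    exact ⟨z, hz, congrArg Prod.snd hzy⟩
  choose z hz hzy using this
  refine ⟨ξ, ⟨z, hz, fun i j hij hn => hsep i j hij ?_⟩, rfl⟩
  have h1 := (hnear ω ξ (z i) (z j) (horb _ (hz i)) hn 1).1
  rw [isNearAt_orbitDist] at h1
  rw [← hzy i, ← hzy j]
  exact h1

theorem le_dist_of_not_isNearAt [MetricSpace Ξ] (hd : ∀ ω ξ, Differentiable ℝ (h ω ξ))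
    (hC0 : 0 ≤ C) (hr1 : r ≤ 1)
    (hC : ∀ ω, ∀ x ∈ Metric.thickening r (fibre K ω), ‖fibreDeriv θ g h 1 (ω, x)‖ ≤ Real.exp C)
    {ω : Ω} {ξ : Ξ} {z z' : EuclideanSpace ℝ (Fin d)} {b : ℝ}
    (hz : ∀ j, ((skewProduct θ (doubleFibreMap g h))^[j] (ω, ξ, z)).2 ∈ fibre K (θ^[j] ω))
    (hnear : ¬IsNearAt (orbitDist θ g h ω ξ z z') k r b 0) :
    Real.exp (-(k * C)) * min r b ≤ dist z z' := by
  by_contra! hlt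
  exact hnear (isNearAt_zero_of_lt (orbitDist_nonneg ω ξ z z') hC0 hr1
    (orbitDist_succ_le hd hC hz) hlt)

end Near

/-! ### Counting points by pulling back into the past. -/

section Count

variable {Ω Ξ : Type*} [MeasurableSpace Ω] {d : ℕ} {θ : Ω ≃ᵐ Ω} {g : Ω → Ξ → Ξ}
  {h : Ω → Ξ → EuclideanSpace ℝ (Fin d) → EuclideanSpace ℝ (Fin d)}
  {K : Set (Ω × Ξ × EuclideanSpace ℝ (Fin d))} {C r : ℝ} {k m : ℕ} {ψ b : Ω → ℝ}

theorem exists_iterate_eq_of_mem {M : Type*} {F : Ω → M → M} {K : Set (Ω × M)} {ω : Ω}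
    (hinv : ∀ N, F (θ.symm^[N + 1] ω) '' fibre K (θ.symm^[N + 1] ω) = fibre K (θ.symm^[N] ω))
    (N : ℕ) {x : M} (hx : x ∈ fibre K ω) :
    ∃ x' ∈ fibre K (θ.symm^[N] ω), (skewProduct θ F)^[N] (θ.symm^[N] ω, x') = (ω, x) := by
  induction N with
  | zero => exact ⟨x, hx, rfl⟩
  | succ N ih =>
    obtain ⟨x', hx', hxx'⟩ := ih
    rw [← hinv] at hx'
    obtain ⟨x'', hx'', rfl⟩ := hx'
    refine ⟨x'', hx'', ?_⟩
    rw [Function.iterate_succ_apply, ← hxx']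
    congr 1
    refine Prod.ext ?_ rfl
    change θ (θ.symm^[N + 1] ω) = _
    rw [Function.iterate_succ_apply', θ.apply_symm_apply]

/-- If along the backward orbit no fibre contains `m + 1` pairwise separated points, then the
fibres over `ω` have at most `m` points. -/
theorem not_injective_of_separatedSet_eq_empty [MetricSpace Ξ]
    (hd : ∀ ω ξ, Differentiable ℝ (h ω ξ)) (hg : ∀ ω, Function.Bijective (g ω)) (hC0 : 0 ≤ C)
    (hC : ∀ ω, ∀ x ∈ Metric.thickening r (fibre K ω), ‖fibreDeriv θ g h 1 (ω, x)‖ ≤ Real.exp C)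
    (hnear : IsNearInvariant θ g h K k r ψ b) {b₀ : ℝ} (hb : ∀ ω, b ω ≤ b₀) {ω : Ω}
    (hinv : ∀ N, doubleFibreMap g h (θ.symm^[N + 1] ω) '' fibre K (θ.symm^[N + 1] ω) =
      fibre K (θ.symm^[N] ω))
    (horb : ∀ N, ∀ x ∈ fibre K (θ.symm^[N] ω), ∀ j,
      ((skewProduct θ (doubleFibreMap g h))^[j] (θ.symm^[N] ω, x)).2 ∈
        fibre K (θ^[j] (θ.symm^[N] ω)))
    (hsep : ∀ N, fibre (separatedSet θ g h K k r b m) (θ.symm^[N] ω) = ∅)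
    (hS : Tendsto (fun M => birkhoffSum θ.symm ψ M (θ.symm^[k + 1] ω)) atTop atBot) {ξ : Ξ}
    {v : Fin (m + 1) → EuclideanSpace ℝ (Fin d)} (hv : ∀ i, v i ∈ fibre₂ K ω ξ) :
    ¬Function.Injective v := by
  intro hinj
  obtain ⟨η, hη, hηv⟩ := exists_pos_le_dist_of_injective hinj
  have hlim : Tendsto (fun M => Real.exp (k * C) ^ (k + 1) *
      (Real.exp (birkhoffSum θ.symm ψ M (θ.symm^[k + 1] ω)) * b₀)) atTop (𝓝 0) := by
    have := ((Real.tendsto_exp_atBot.comp hS).mul_const b₀).const_mul (Real.exp (k * C) ^ (k + 1))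
    simpa using this
  -- The points are pulled back M + k steps, so that the window beginning at time M ends at the
  -- present. The sums of ψ over its first M steps are the backward sums started at θ^{-(k+1)} ω.
  obtain ⟨M, hM⟩ := (hlim.eventually_lt_const (pow_pos hη (k + 1))).exists
  have hpull := fun i => exists_iterate_eq_of_mem hinv (M + k) (x := (ξ, v i)) (hv i)
  choose x hx hxv using hpull
  have hbase : ∀ i, ((skewProduct θ g)^[M + k] (θ.symm^[M + k] ω, (x i).1)).2 = ξ := fun i => by
    have := hxv i
    rw [← Prod.mk.eta (p := x i), doubleSkewProduct_iterate] at this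
    exact congrArg (fun p => p.2.1) this
  have hpt : ∀ i, iterFibre θ g h (M + k) (θ.symm^[M + k] ω) (x i).1 (x i).2 = v i := fun i =>
    congrArg (fun p => p.2.2) (hxv i)
  have h0 : ∀ i, (x i).1 = (x 0).1 := fun i =>
    (bijective_skewProduct_iterate_snd hg (M + k) (θ.symm^[M + k] ω)).injective
      ((hbase i).trans (hbase 0).symm)
  have hempty : (x 0).1 ∉ fibre (separatedSet θ g h K k r b m) (θ.symm^[M + k] ω) := by
    rw [hsep]
    exact notMem_empty _
  have hxK : ∀ i, ((x 0).1, (x i).2) ∈ fibre K (θ.symm^[M + k] ω) := fun i => by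
    rw [← h0 i]
    exact hx i
  -- Emptiness of the separated set in the past produces a near pair. Contraction bounds its
  -- distance at the present by less than the minimal distance η of the original points.
  obtain ⟨i, j, hij, hn⟩ : ∃ i j, i ≠ j ∧ IsNearAt
      (orbitDist θ g h (θ.symm^[M + k] ω) (x 0).1 (x i).2 (x j).2) k r (b (θ.symm^[M + k] ω)) 0 := by
    by_contra! hcon
    exact hempty ⟨fun i => (x i).2, hxK, hcon⟩
  have hz := horb (M + k) _ (hxK i)
  obtain ⟨h1, h2⟩ := hnear _ _ _ _ hz hn M
  have h3 := pow_le_mul_windowProd (orbitDist_nonneg _ _ _ _) hC0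
    (orbitDist_succ_le hd hC hz) (j := M) (k := k) fun i hi => h1.2 i hi.le
  have h4 : η ≤ orbitDist θ g h (θ.symm^[M + k] ω) (x 0).1 (x i).2 (x j).2 (M + k) := by
    refine (hηv i j hij).trans_eq ?_
    rw [← hpt i, ← hpt j, h0 i, h0 j]
    rfl
  refine hM.not_ge (((pow_le_pow_left₀ hη.le h4 _).trans h3).trans ?_)
  rw [← birkhoffSum_symm_iterate]
  have h5 := hn.1.le.trans (hb _)
  gcongr
  exact h2.trans (by gcongr)

omit [MeasurableSpace Ω] in
theorem fibre₂_eq_range {ω : Ω} {ξ : Ξ} {y : Fin m → EuclideanSpace ℝ (Fin d)}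
    (hy : ∀ i, y i ∈ fibre₂ K ω ξ) (hinj : Function.Injective y)
    (hmax : ∀ v : Fin (m + 1) → EuclideanSpace ℝ (Fin d), (∀ i, v i ∈ fibre₂ K ω ξ) →
      ¬Function.Injective v) : fibre₂ K ω ξ = range y := by
  refine Subset.antisymm (fun w hw => ?_) (range_subset_iff.2 hy)
  by_contra hwy
  exact hmax (Fin.cons w y) (Fin.cases hw hy) (Fin.cons_injective_iff.2 ⟨hwy, hinj⟩)

end Count

/-- The number of pairwise separated points in the fibres is almost surely constant. -/
theorem exists_card_separatedSet {Ω Ξ : Type*} [MeasurableSpace Ω] {P : Measure Ω}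
    [IsProbabilityMeasure P] {θ : Ω → Ω} (hθ : Ergodic θ P)
    [MetricSpace Ξ] [CompactSpace Ξ] [MeasurableSpace Ξ] [BorelSpace Ξ] [Nonempty Ξ] {d : ℕ}
    {g : Ω → Ξ → Ξ} {h : Ω → Ξ → EuclideanSpace ℝ (Fin d) → EuclideanSpace ℝ (Fin d)}
    (hT : IsDoubleSkewProduct g h) {K : Set (Ω × Ξ × EuclideanSpace ℝ (Fin d))}
    (hK : IsRandomCompact K) (hKinv : IsInvariant P θ (doubleFibreMap g h) K)
    (hKne : ∀ᵐ ω ∂P, (fibre K ω).Nonempty) (hmin : IsRandomMinimal P θ g)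
    {k : ℕ} {r : ℝ} {ψ b : Ω → ℝ} (hb : Measurable b) (hnear : IsNearInvariant θ g h K k r ψ b)
    (hsep : ∀ᵐ ω ∂P, ∃ ε > 0, ∀ ξ z z', (ξ, z) ∈ fibre K ω →
      ¬IsNearAt (orbitDist θ g h ω ξ z z') k r (b ω) 0 → ε ≤ dist z z') :
    ∃ m, (∀ᵐ ω ∂P, fibre (separatedSet θ g h K k r b m) ω = univ) ∧
      ∀ᵐ ω ∂P, fibre (separatedSet θ g h K k r b (m + 1)) ω = ∅ := by
  have horb := ae_iterate_mem hθ.toMeasurePreserving hKinv.isForwardInvariant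
  have hdich : ∀ m, (∀ᵐ ω ∂P, fibre (separatedSet θ g h K k r b m) ω = univ) ∨
      (∀ᵐ ω ∂P, fibre (separatedSet θ g h K k r b m) ω = ∅) := fun m => by
    refine IsRandomMinimal.ae_eq_univ_or_empty hθ hT.isRandomHomeomorph hmin
      (isRandomClosed_separatedSet hθ.measurable hT hK hb) ?_
    filter_upwards [horb, hKinv] with ω h1 h2
    exact fibre_separatedSet_subset_image hnear
      (hT.isRandomHomeomorph.isHomeomorph ω).bijective h1 h2
  have hzero : ∀ᵐ ω ∂P, fibre (separatedSet θ g h K k r b 0) ω = univ := by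
    refine (hdich 0).resolve_right fun hempty => ?_
    obtain ⟨ω, h1, ⟨ξ, y⟩, hy⟩ := (hempty.and hKne).exists
    have : ξ ∈ fibre (separatedSet θ g h K k r b 0) ω :=
      ⟨fun _ => y, fun _ => hy, fun i j hij => (hij (Fin.ext (by omega))).elim⟩
    rw [h1] at this
    exact this
  -- Otherwise some compact fibre would contain arbitrarily many points with mutual distances at
  -- least a fixed ε.
  have hex : ∃ m, ¬∀ᵐ ω ∂P, fibre (separatedSet θ g h K k r b m) ω = univ := by
    by_contra! hall
    obtain ⟨ω, hω, ε, hε, hω'⟩ := ((ae_all_iff.2 hall).and hsep).exists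
    obtain ⟨n, hn⟩ := IsCompact.exists_not_separated
      ((hK.isCompact ω).image continuous_snd) hε
    obtain ⟨ξ⟩ := ‹Nonempty Ξ›
    obtain ⟨y, hy, hys⟩ : ξ ∈ fibre (separatedSet θ g h K k r b n) ω := by
      rw [hω n]
      trivial
    obtain ⟨i, j, hij, hlt⟩ := hn y fun i => ⟨_, hy i, rfl⟩
    exact hlt.not_ge (hω' ξ _ _ (hy i) (hys i j hij))
  classical
  obtain ⟨m, hm⟩ := Nat.exists_eq_succ_of_ne_zero (n := Nat.find hex) fun h0 => by
    have := Nat.find_spec hex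
    rw [h0] at this
    exact this hzero
  -- m + 1 is the first index at which the set is not almost surely full; the dichotomy makes it
  -- almost surely empty there.
  refine ⟨m, not_not.1 (Nat.find_min hex (hm ▸ Nat.lt_succ_self m)), ?_⟩
  have h1 := Nat.find_spec hex
  rw [hm] at h1
  exact (hdich _).resolve_left h1

end RandomGraphs

/-! ### Assembly of contraction, counting and continuity. -/

open RandomGraphs in
theorem theorem3p1 {Ω Ξ : Type*} [MeasurableSpace Ω] (P : Measure Ω) [IsProbabilityMeasure P]
    (θ : Ω ≃ᵐ Ω) (hθ : Ergodic θ P)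
    [MetricSpace Ξ] [CompactSpace Ξ] [MeasurableSpace Ξ] [BorelSpace Ξ] (d : ℕ)
    (g : Ω → Ξ → Ξ) (h : Ω → Ξ → EuclideanSpace ℝ (Fin d) → EuclideanSpace ℝ (Fin d))
    (hT : RandomGraphs.IsDoubleSkewProduct g h)
    (K : Set (Ω × Ξ × EuclideanSpace ℝ (Fin d)))
    (hK : RandomGraphs.IsRandomCompact K)
    (hKinv : RandomGraphs.IsInvariant P θ (RandomGraphs.doubleFibreMap g h) K)
    (hKne : ∃ᵐ ω ∂P, (RandomGraphs.fibre K ω).Nonempty)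
    (hbdd : RandomGraphs.supOn θ g h K 1 < ⊤)
    (hunif : ∀ k : ℕ, 1 ≤ k → ∀ ε : ℝ, 0 < ε → ∃ r : ℝ, 0 < r ∧
      RandomGraphs.supNear θ g h K k r ≤ RandomGraphs.supOn θ g h K k + (ε : EReal))
    (hlyap : ∀ μ ∈ RandomGraphs.invariantMeasures P θ (RandomGraphs.doubleFibreMap g h) K,
      RandomGraphs.lyapunovExponent θ g h μ < 0)
    (hmin : RandomGraphs.IsRandomMinimal P θ g) :
    ∃ n : ℕ, 0 < n ∧ ∃ c : Ω → ℝ, Measurable c ∧ (∀ ω, 0 < c ω) ∧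
      ∀ᵐ ω ∂P,
        (∀ ξ, (RandomGraphs.fibre₂ K ω ξ).encard = n) ∧
        (∃ κ : Ξ → TopologicalSpace.NonemptyCompacts (EuclideanSpace ℝ (Fin d)),
          (∀ ξ, (κ ξ : Set (EuclideanSpace ℝ (Fin d))) = RandomGraphs.fibre₂ K ω ξ) ∧
          Continuous κ) ∧
        (∀ ξ, ∀ y ∈ RandomGraphs.fibre₂ K ω ξ, ∀ y' ∈ RandomGraphs.fibre₂ K ω ξ,
          y ≠ y' → c ω ≤ dist y y') := by
  obtain ⟨-, ⟨ξ₀, -⟩, -⟩ := hKne.exists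
  have : Nonempty Ξ := ⟨ξ₀⟩
  have hne := hKinv.ae_nonempty hθ hK hKne
  have hmp := hθ.toMeasurePreserving
  have hKF := hKinv.isForwardInvariant
  have hd := hT.differentiable
  obtain ⟨C, r₁, hC0, hr₁, hC₁⟩ := exists_radius_norm_fibreDeriv_le hbdd (hunif 1 le_rfl 1 one_pos)
  obtain ⟨k, R, r, hr0, hr1, hrr, hneg⟩ := exists_integral_envelope_neg hmp hT hK hKF hne hC0
    (fun p hp => hC₁ p.1 p.2 (Metric.self_subset_thickening hr₁ _ hp)) hlyap hr₁
  have hC : ∀ ω, ∀ x ∈ Metric.thickening r (fibre K ω),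
      ‖fibreDeriv θ g h 1 (ω, x)‖ ≤ Real.exp C := fun ω x hx =>
    hC₁ ω x (Metric.thickening_mono hrr _ hx)
  have hnear := isNearInvariant_stableRadius (k := k) θ.measurable hT hC0 hr0.le hC R
  have hψB := abs_envelope_le (K := K) (fun p => abs_clampLogDeriv_le (θ := θ) (g := g) (h := h)
    hC0 (k + 1) R p) r
  have hψm := measurable_envelope (B := (k + 1 : ℕ) * (R + C)) hK.measurable
    (isCaratheodory_clampLogDeriv θ.measurable hT C (k + 1) R).measurable_left r
  set ψ := envelope K (clampLogDeriv θ g h C (k + 1) R) ((k + 1 : ℕ) * (R + C)) r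
  have hb₀ : 0 < r ^ (k + 1) / Real.exp (k * C) ^ (k + 1) := by positivity
  set b₀ := r ^ (k + 1) / Real.exp (k * C) ^ (k + 1)
  have hbm : Measurable (stableRadius θ ψ b₀) := measurable_stableRadius θ.measurable hψm
  have hble : ∀ ω, stableRadius θ ψ b₀ ω ≤ b₀ := stableRadius_le hb₀.le
  have hbpos : ∀ᵐ ω ∂P, 0 < stableRadius θ ψ b₀ ω := by
    filter_upwards [ae_tendsto_birkhoffSum_atBot hθ hψm hψB hneg] with ω hω
    exact stableRadius_pos hb₀ hω
  set b := stableRadius θ ψ b₀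
  have horb := ae_iterate_mem hmp hKF
  have hsep : ∀ᵐ ω ∂P, ∀ ξ z z', (ξ, z) ∈ fibre K ω →
      ¬IsNearAt (orbitDist θ g h ω ξ z z') k r (b ω) 0 →
        Real.exp (-(k * C)) * min r (b ω) ≤ dist z z' := by
    filter_upwards [horb] with ω hω ξ z z' hz hn
    exact le_dist_of_not_isNearAt hd hC0 hr1 hC (hω _ hz) hn
  obtain ⟨m, hfull, hempty⟩ := exists_card_separatedSet hθ hT hK hKinv hne hmin hbm hnear (by
    filter_upwards [hsep, hbpos] with ω hω hb
    exact ⟨_, mul_pos (Real.exp_pos _) (lt_min hr0 hb), hω⟩)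
  have hsymm : MeasurePreserving θ.symm P P := hmp.symm θ
  have hS : ∀ᵐ ω ∂P, Tendsto (fun M => birkhoffSum θ.symm ψ M ω) atTop atBot :=
    ae_tendsto_birkhoffSum_atBot hθ.symm hψm hψB hneg
  classical
  -- Index m of the separated set stands for m + 1 points. The value 1 serves only on the null set
  -- where `b` is not positive.
  refine ⟨m + 1, m.succ_pos, fun ω => if 0 < b ω then Real.exp (-(k * C)) * min r (b ω) else 1,
    Measurable.ite (measurableSet_lt measurable_const hbm)
      (measurable_const.mul (measurable_const.min hbm)) measurable_const, fun ω => ?_, ?_⟩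
  · dsimp only
    split_ifs with hb
    · exact mul_pos (Real.exp_pos _) (lt_min hr0 hb)
    · exact one_pos
  filter_upwards [hfull, hsep, hbpos, ae_forall_iterate hsymm hempty, ae_forall_iterate hsymm hKinv,
    ae_forall_iterate hsymm horb, ae_forall_iterate hsymm hS] with ω hω hsω hb heω hiω hoω hSω
  rw [if_pos hb]
  have hε : 0 < Real.exp (-(k * C)) * min r (b ω) := mul_pos (Real.exp_pos _) (lt_min hr0 hb)
  have hinv : ∀ N, doubleFibreMap g h (θ.symm^[N + 1] ω) '' fibre K (θ.symm^[N + 1] ω) =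
      fibre K (θ.symm^[N] ω) := fun N => by
    rw [hiω (N + 1), Function.iterate_succ_apply', θ.apply_symm_apply]
  have hrange : ∀ ξ, ∃ y : Fin (m + 1) → EuclideanSpace ℝ (Fin d),
      Function.Injective y ∧ fibre₂ K ω ξ = range y ∧
      ∀ i j, i ≠ j → Real.exp (-(k * C)) * min r (b ω) ≤ dist (y i) (y j) := fun ξ => by
    obtain ⟨y, hy, hys⟩ : ξ ∈ fibre (separatedSet θ g h K k r b m) ω := by
      rw [hω]
      trivial
    have hdist : ∀ i j, i ≠ j → Real.exp (-(k * C)) * min r (b ω) ≤ dist (y i) (y j) :=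
      fun i j hij => hsω ξ _ _ (hy i) (hys i j hij)
    have hinj : Function.Injective y := fun i j hij => by
      by_contra hne'
      have := hdist i j hne'
      rw [hij, dist_self] at this
      exact hε.not_ge this
    -- The m + 1 separated points exhaust the fibre, since m + 2 distinct points are excluded by
    -- pulling back.
    exact ⟨y, hinj, fibre₂_eq_range hy hinj fun v hv => not_injective_of_separatedSet_eq_empty hd
      (fun ω => (hT.isRandomHomeomorph.isHomeomorph ω).bijective) hC0 hC hnear hble hinv hoω heω
      (hSω _) hv, hdist⟩
  have hcard : ∀ ξ, (fibre₂ K ω ξ).encard = (m + 1 : ℕ) := fun ξ => by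
    obtain ⟨y, hinj, heq, -⟩ := hrange ξ
    rw [heq, ← image_univ, hinj.encard_image, encard_univ]
    simp
  have hdist : ∀ ξ, ∀ y ∈ fibre₂ K ω ξ, ∀ y' ∈ fibre₂ K ω ξ, y ≠ y' →
      Real.exp (-(k * C)) * min r (b ω) ≤ dist y y' := fun ξ y hy y' hy' hne' => by
    obtain ⟨v, -, heq, hv⟩ := hrange ξ
    rw [heq] at hy hy'
    obtain ⟨i, rfl⟩ := hy
    obtain ⟨j, rfl⟩ := hy'
    exact hv i j fun hij => hne' (hij ▸ rfl)
  refine ⟨hcard, ⟨fun ξ => ⟨⟨fibre₂ K ω ξ, (finite_of_encard_eq_coe (hcard ξ)).isCompact⟩, ?_⟩,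
    fun ξ => rfl, ?_⟩, hdist⟩
  · change (fibre₂ K ω ξ).Nonempty
    rw [← encard_ne_zero, hcard]
    simp
  · exact continuous_slices (hK.isCompact ω) (fun ξ => rfl) hcard hε hdist
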